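/- Let $n \ge 3$ and let $\mathcal{K}^n$ be the set of convex bodies (nonempty compact convex subsets) of $\mathbb{R}^n$, with Minkowski addition $K+L=\{x+y : x\in K,\ y\in L\}$, dilations $aK=\{ax : x\in K\}$ ($a\in\mathbb{R}$, $-K=(-1)K$) and the Hausdorff metric. For $K \in \mathcal{K}^n$ put $K_o = \operatorname{conv}(\{0\}\cup K)$ and $$m(K)=\int_K x\,dx, \qquad m_*(K)=\int_{K_o\setminus K} x\,dx,$$ vectors that are identified with one-point convex bodies. Let $\mathrm{M}K$ and $\mathrm{M}_*K$ be the convex bodies whose support functions $h(L,x)=\max\{\langle x,y\rangle : y\in L\}$ are $$h(\mathrm{M}K,x)=\int_K |\langle x,y\rangle|\,dy, \qquad h(\mathrm{M}_*K,x)=\int_{K_o\setminus K} |\langle x,y\rangle|\,dy, \qquad x\in\mathbb{R}^n.$$ A map $\Phi:\mathcal{K}^n\to\mathcal{K}^n$ is called a Minkowski valuation if $\Phi K+\Phi L=\Phi(K\cup L)+\Phi(K\cap L)$ whenever $K, L, K\cup L, K\cap L\in\mathcal{K}^n$. It is called $GL(n)$ equivariant if there is $q\in\mathbb{R}$ such that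 $\Phi(\phi K)=|\det\phi|^q\,\phi\,\Phi K$ for all $\phi\in GL(n)$ and $K\in\mathcal{K}^n$. It is called continuous if it is continuous with respect to the Hausdorff metric. **Theorem.** A map $\Phi:\mathcal{K}^n\to\mathcal{K}^n$ is a continuous $GL(n)$ equivariant Minkowski valuation if and only if either there are constants $a_1,a_2,a_3,a_4\ge 0$ such that $$\Phi K=a_1K+a_2(-K)+a_3K_o+a_4(-K_o)$$ for every $K\in\mathcal{K}^n$, or there are constants $a_1,a_2\in\mathbb{R}$ and $a_3,a_4\ge 0$ such that $$\Phi K=a_1m(K)+a_2m_*(K)+a_3\mathrm{M}K+a_4\mathrm{M}_*K$$ for every $K\in\mathcal{K}^n$. -/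

import Mathlib

open MeasureTheory

noncomputable section

namespace MinkowskiValuation

/-- Euclidean space `ℝⁿ`. The type `ConvexBody (E n)` of nonempty compact convex subsets of it
carries Minkowski addition, the dilations `a • K = {a x : x ∈ K}` by real numbers `a`
(so `(-1 : ℝ) • K` is the reflection of `K` in the origin), and the Hausdorff metric. -/
abbrev E (n : ℕ) : Type := EuclideanSpace ℝ (Fin n)

variable {n : ℕ}

/-- The image `φ K` of a convex body under a linear map. -/
def linImage (φ : E n →ₗ[ℝ] E n) (K : ConvexBody (E n)) : ConvexBody (E n) where
  carrier := φ '' (K : Set (E n))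
  convex' := K.convex.linear_image φ
  isCompact' := K.isCompact.image φ.continuous_of_finiteDimensional
  nonempty' := K.nonempty.image φ

/-- The convex body `{x}`. -/
def point (x : E n) : ConvexBody (E n) where
  carrier := {x}
  convex' := convex_singleton x
  isCompact' := isCompact_singleton
  nonempty' := Set.singleton_nonempty x

theorem isCompact_convexHull_insert_zero (K : ConvexBody (E n)) :
    IsCompact (convexHull ℝ (insert 0 (K : Set (E n)))) := by
  have h : convexHull ℝ (insert 0 (K : Set (E n))) =
      (fun p : ℝ × E n => p.1 • p.2) '' (Set.Icc (0 : ℝ) 1 ×ˢ (K : Set (E n))) := by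
    rw [convexHull_insert K.nonempty, K.convex.convexHull_eq]
    ext x
    simp only [convexJoin_singleton_left, Set.mem_iUnion, segment_eq_image, Set.mem_image,
      Set.mem_prod, Prod.exists, smul_zero, zero_add]
    constructor
    · rintro ⟨y, hy, t, ht, rfl⟩
      exact ⟨t, y, ⟨ht, hy⟩, rfl⟩
    · rintro ⟨t, y, ⟨ht, hy⟩, rfl⟩
      exact ⟨y, hy, t, ht, rfl⟩
  rw [h]
  exact (isCompact_Icc.prod K.isCompact).image continuous_smul

/-- `K_o = conv ({0} ∪ K)`. -/
def hullZero (K : ConvexBody (E n)) : ConvexBody (E n) where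
  carrier := convexHull ℝ (insert 0 (K : Set (E n)))
  convex' := convex_convexHull ℝ _
  isCompact' := isCompact_convexHull_insert_zero K
  nonempty' := (Set.insert_nonempty 0 _).convexHull

/-- The set of all `z` with `⟨x, z⟩ ≤ ∫_A |⟨x, y⟩| dy` for every `x`. -/
def momentSet (A : Set (E n)) : Set (E n) :=
  {z | ∀ x : E n, inner ℝ x z ≤ ∫ y in A, |inner ℝ x y|}

theorem isCompact_momentSet (A : Set (E n)) : IsCompact (momentSet A) := by
  have hc : IsClosed (momentSet A) := by
    simp only [momentSet, Set.ofPred_forall]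
    exact isClosed_iInter fun x =>
      isClosed_le (continuous_const.inner continuous_id) continuous_const
  let g : E n → ℝ := fun x => ∫ y in A, |inner ℝ x y|
  let e : Fin n → E n := fun i => EuclideanSpace.single i (1 : ℝ)
  have hbox : IsCompact ((WithLp.toLp 2 : (Fin n → ℝ) → E n) ''
      (Set.univ.pi fun i => Set.Icc (-g (-e i)) (g (e i)))) :=
    (isCompact_univ_pi fun i => isCompact_Icc).image (PiLp.continuous_toLp 2 _)
  refine hbox.of_isClosed_subset hc fun z hz => ?_
  refine ⟨z.ofLp, fun i _ => ?_, rfl⟩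
  have h1 : inner ℝ (e i) z ≤ g (e i) := hz (e i)
  have h2 : inner ℝ (-e i) z ≤ g (-e i) := hz (-e i)
  rw [inner_neg_left] at h2
  have h3 : inner ℝ (e i) z = z i := by simp [e, EuclideanSpace.inner_single_left]
  rw [h3] at h1 h2
  exact ⟨by linarith, h1⟩

/-- For bounded measurable `A`, the convex body with support function
`x ↦ ∫_A |⟨x, y⟩| dy` (see `isGreatest_momentBodyOf`). -/
def momentBodyOf (A : Set (E n)) : ConvexBody (E n) where
  carrier := momentSet A
  convex' := by
    intro z hz w hw a b ha hb hab x
    rw [inner_add_right, inner_smul_right, inner_smul_right]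
    calc a * inner ℝ x z + b * inner ℝ x w
        ≤ a * (∫ y in A, |inner ℝ x y|) + b * (∫ y in A, |inner ℝ x y|) :=
          add_le_add (mul_le_mul_of_nonneg_left (hz x) ha) (mul_le_mul_of_nonneg_left (hw x) hb)
      _ = ∫ y in A, |inner ℝ x y| := by rw [← add_mul, hab, one_mul]
  isCompact' := isCompact_momentSet A
  nonempty' := ⟨0, fun x => by
    rw [inner_zero_right]
    exact integral_nonneg fun y => abs_nonneg _⟩

/-- The support function of `momentBodyOf A` is `h(x) = ∫_A |⟨x, y⟩| dy`. -/
theorem isGreatest_momentBodyOf {A : Set (E n)} (hb : Bornology.IsBounded A)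
    (x : E n) :
    IsGreatest ((fun z : E n => inner ℝ x z) '' (momentBodyOf A : Set (E n)))
      (∫ y in A, |inner ℝ x y|) := by
  have hfin : volume A ≠ ⊤ := hb.measure_lt_top.ne
  obtain ⟨C, hC⟩ := hb.exists_norm_le
  have hid : IntegrableOn (fun y : E n => y) A := by
    obtain ⟨r, hr⟩ := hb.subset_closedBall 0
    exact (continuous_id.continuousOn.integrableOn_compact
      (isCompact_closedBall (0 : E n) r)).mono_set hr
  have hmeas : Measurable fun y : E n => (SignType.sign (inner ℝ x y) : ℝ) := by
    have h1 : Measurable fun y : E n => inner ℝ x y :=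
      (continuous_const.inner continuous_id).measurable
    have h2 : Measurable fun t : ℝ => (SignType.sign t : ℝ) := by
      have : (fun t : ℝ => (SignType.sign t : ℝ)) =
          fun t => if 0 < t then 1 else if t < 0 then -1 else 0 := by
        funext t
        rw [sign_apply]
        split_ifs <;> simp
      rw [this]
      exact Measurable.ite measurableSet_Ioi measurable_const
        (Measurable.ite measurableSet_Iio measurable_const measurable_const)
    exact h2.comp h1
  have hle : ∀ y : E n, |(SignType.sign (inner ℝ x y) : ℝ)| ≤ 1 := fun y => by
    rcases SignType.sign (inner ℝ x y) with _ | _ | _ <;> simp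
  have hint : IntegrableOn (fun y : E n => (SignType.sign (inner ℝ x y) : ℝ) • y) A := by
    refine hid.norm.mono' (hmeas.aestronglyMeasurable.smul hid.aestronglyMeasurable) ?_
    refine Filter.Eventually.of_forall fun y => ?_
    rw [norm_smul, Real.norm_eq_abs]
    exact mul_le_of_le_one_left (norm_nonneg y) (hle y)
  have key : ∀ w : E n, inner ℝ w (∫ y in A, (SignType.sign (inner ℝ x y) : ℝ) • y) =
      ∫ y in A, (SignType.sign (inner ℝ x y) : ℝ) * inner ℝ w y := fun w => by
    rw [← integral_inner hint w]
    simp only [inner_smul_right]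
  have hinner : ∀ w : E n, IntegrableOn (fun y : E n => inner ℝ w y) A := fun w =>
    Integrable.const_inner (𝕜 := ℝ) w hid
  refine ⟨⟨∫ y in A, (SignType.sign (inner ℝ x y) : ℝ) • y, fun w => ?_, ?_⟩, ?_⟩
  · rw [key w]
    refine integral_mono ?_ (hinner w).abs fun y => ?_
    · have := Integrable.const_inner (𝕜 := ℝ) w hint
      simpa only [inner_smul_right] using this
    · refine (le_abs_self _).trans ?_
      rw [abs_mul]
      exact mul_le_of_le_one_left (abs_nonneg _) (hle y)
  · simp only [key x, sign_mul_self]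
  · rintro _ ⟨z, hz, rfl⟩
    exact hz x

/-- The moment body `M K`, with `h(M K, x) = ∫_K |⟨x, y⟩| dy`. -/
def momentBody (K : ConvexBody (E n)) : ConvexBody (E n) :=
  momentBodyOf (K : Set (E n))

/-- The body `M_* K`, with `h(M_* K, x) = ∫_{K_o \ K} |⟨x, y⟩| dy`. -/
def momentBodyStar (K : ConvexBody (E n)) : ConvexBody (E n) :=
  momentBodyOf ((hullZero K : Set (E n)) \ (K : Set (E n)))

/-- The moment vector `m(K) = ∫_K x dx`. -/
def momentVector (K : ConvexBody (E n)) : E n :=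
  ∫ x in (K : Set (E n)), x

/-- The vector `m_*(K) = ∫_{K_o \ K} x dx`. -/
def momentVectorStar (K : ConvexBody (E n)) : E n :=
  ∫ x in (hullZero K : Set (E n)) \ (K : Set (E n)), x

/-- `Φ K + Φ L = Φ (K ∪ L) + Φ (K ∩ L)` whenever `K`, `L`, `K ∪ L` and `K ∩ L` are
convex bodies. -/
def IsMinkowskiValuation (Φ : ConvexBody (E n) → ConvexBody (E n)) : Prop :=
  ∀ K L U I : ConvexBody (E n),
    (U : Set (E n)) = (K : Set (E n)) ∪ L → (I : Set (E n)) = (K : Set (E n)) ∩ L →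
      Φ K + Φ L = Φ U + Φ I

/-- There is a real `q` with `Φ (φ K) = |det φ|^q φ (Φ K)` for all `φ ∈ GL(n)` and all `K`. -/
def IsGLEquivariant (Φ : ConvexBody (E n) → ConvexBody (E n)) : Prop :=
  ∃ q : ℝ, ∀ (φ : E n ≃ₗ[ℝ] E n) (K : ConvexBody (E n)),
    Φ (linImage (φ : E n →ₗ[ℝ] E n) K) =
      (|LinearMap.det (φ : E n →ₗ[ℝ] E n)| ^ q) • linImage (φ : E n →ₗ[ℝ] E n) (Φ K)

end MinkowskiValuation

end

/-!
Both properties to be compared are properties of the functions `K ↦ h(Φ K, ·)`. Dropping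
sublinearity, a continuous `GL(n)` equivariant Minkowski valuation of degree `q` becomes a
*covariant family* (`IsCovariantFamily q`), and covariant families of a fixed degree form a vector
space. That the bodies in the statement are continuous, equivariant valuations follows from the
same properties of `h(K, ·)` (degree `0`), of the moment integrals (degree `1`), and from the
fact that `K ↦ K_o` is continuous, equivariant and compatible with unions and intersections.

For the converse, subtract from `h(Φ K, ·)` a combination of the examples that agrees with it on a
few simplices; the difference must vanish. There are two ingredients.

* A covariant family is determined by its values on the simplices `conv {e_i : i ∈ s}` and
  `conv ({0} ∪ {e_i : i ∈ s})` (`IsCovariantFamily.eq_zero`). This uses no deep dissection theory.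
  By induction on the dimension, sets in proper subspaces do not matter, so that cutting a
  polytope by hyperplanes through the origin is harmless. Cutting along the differences of the
  facet functionals reduces a polytope to frusta `P ∖ Q`, where `P` and `Q` are pyramids with apex
  `0` over polytopes in affine hyperplanes that miss the origin (`IsSetValuation.frustum_eq_zero`).
  Such polytopes, and the pyramids over them, are triangulated by pulling vertices, again with
  cuts by hyperplanes through the origin only (`IsSetValuation.join_eq_zero`). Continuity along
  decreasing sequences of polytopes does the rest.

* Cutting such a simplex at the point `(1 - t) e_i + t e_j` gives a functional equation in `x` for
  its value (`setFn_simplex_cut`). If `q ≠ 0`, the lower-dimensional terms vanish. If moreover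
  `q ≠ 1`, the equation at `t = 1/2` shows that the value is `0` whenever `x i = x j`, and a support
  function with this property is zero for `n ≥ 3`. If `q = 1`, the equation expresses the value at
  `x` as an average, so that a maximum principle (`nonpos_of_diagonal_nonpos`) reduces it to
  vectors `x` with equal coordinates; this leaves two simplices and two signs, that is, four
  constants. If `q = 0`, letting a vertex tend to the origin relates a simplex to its faces, and
  the functional equation reduces everything to simplices with at most one nonzero vertex
  (`eq_zero_of_card_le_one`), which again leaves four constants. Their signs follow from the
  subadditivity of support functions on a segment and a triangle.
-/


open MeasureTheory

noncomputable section

namespace MinkowskiValuation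

/-! ### Valuations on compact convex sets and cuts by hyperplanes -/

/-- A finite family of functions that are pairwise comparable on `K` has a pointwise largest
member. -/
theorem exists_forall_le_of_comparable {ι α : Type*} (K : Set α) (g : ι → α → ℝ) {s : Finset ι}
    (hs : s.Nonempty)
    (hc : ∀ i ∈ s, ∀ j ∈ s, (∀ y ∈ K, g i y ≤ g j y) ∨ (∀ y ∈ K, g j y ≤ g i y)) :
    ∃ i ∈ s, ∀ j ∈ s, ∀ y ∈ K, g j y ≤ g i y := by
  induction hs using Finset.Nonempty.cons_induction with
  | singleton a => exact ⟨a, by simp, by simp⟩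
  | cons a s has hs ih =>
    obtain ⟨i, hi, him⟩ := ih fun i hi j hj => hc i (by simp [hi]) j (by simp [hj])
    rcases hc a (by simp) i (by simp [hi]) with h | h
    · refine ⟨i, by simp [hi], fun j hj => ?_⟩
      rcases Finset.mem_cons.mp hj with rfl | hj
      exacts [h, him j hj]
    · refine ⟨a, by simp, fun j hj => ?_⟩
      rcases Finset.mem_cons.mp hj with rfl | hj
      exacts [fun y _ => le_rfl, fun y hy => (him j hj y hy).trans (h y hy)]

section SetValuation

variable {V : Type*} [NormedAddCommGroup V] [NormedSpace ℝ V]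

/-- A real valuation on the compact convex sets, encoded as a function on all sets that vanishes
at the empty set; its values at sets that are not compact and convex are irrelevant. -/
structure IsSetValuation (f : Set V → ℝ) : Prop where
  empty : f ∅ = 0
  union_inter : ∀ A B : Set V, IsCompact A → Convex ℝ A → IsCompact B → Convex ℝ B →
    Convex ℝ (A ∪ B) → f A + f B = f (A ∪ B) + f (A ∩ B)

/-- Cutting successively along finitely many hyperplanes: a property `Z` that passes from the two
parts of a set to the set holds as soon as it holds for all pieces on which every functional of
`D` has a constant sign. -/
theorem of_sorted_pieces {P Z : Set V → Prop} (D : Finset (V →ₗ[ℝ] ℝ))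
    (hcut : ∀ K, P K → ∀ d ∈ D, Z (K ∩ {y | 0 ≤ d y}) → Z (K ∩ {y | d y ≤ 0}) → Z K)
    (hP : ∀ K, P K → ∀ d ∈ D, P (K ∩ {y | 0 ≤ d y}) ∧ P (K ∩ {y | d y ≤ 0}))
    (hs : ∀ K, P K → (∀ d ∈ D, (∀ y ∈ K, 0 ≤ d y) ∨ (∀ y ∈ K, d y ≤ 0)) → Z K) :
    ∀ K, P K → Z K := by
  classical
  induction D using Finset.induction_on with
  | empty => exact fun K hK => hs K hK (by simp)
  | insert d D hd ih =>
    refine ih (fun K hK e he => hcut K hK e (by simp [he]))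
      (fun K hK e he => hP K hK e (by simp [he])) fun K hK hsort => ?_
    have hsub : ∀ (H : Set V), (∀ e ∈ D, (∀ y ∈ K ∩ H, 0 ≤ e y) ∨ (∀ y ∈ K ∩ H, e y ≤ 0)) :=
      fun H e he => (hsort e he).imp (fun h y hy => h y hy.1) (fun h y hy => h y hy.1)
    refine hcut K hK d (by simp) (hs _ (hP K hK d (by simp)).1 fun e he => ?_)
      (hs _ (hP K hK d (by simp)).2 fun e he => ?_)
    · rcases Finset.mem_insert.mp he with rfl | he
      exacts [Or.inl fun y hy => hy.2, hsub _ e he]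
    · rcases Finset.mem_insert.mp he with rfl | he
      exacts [Or.inr fun y hy => hy.2, hsub _ e he]

theorem eq_zero_of_ray_subset {K : Set V} (hK : Bornology.IsBounded K) {y v : V}
    (h : ∀ t : ℝ, 0 ≤ t → y + t • v ∈ K) : v = 0 := by
  obtain ⟨R, hR⟩ := hK.exists_norm_le
  by_contra hv
  have hv' : 0 < ‖v‖ := norm_pos_iff.mpr hv
  have hR0 : 0 ≤ R := (norm_nonneg _).trans (hR _ (h 0 le_rfl))
  set t : ℝ := (R + ‖y‖ + 1) / ‖v‖ with ht
  have ht0 : 0 ≤ t := by positivity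
  have h1 := hR _ (h t ht0)
  have h2 : ‖t • v‖ ≤ ‖y + t • v‖ + ‖y‖ := by
    have := norm_sub_le (y + t • v) y
    simpa using this
  rw [norm_smul, Real.norm_of_nonneg ht0, ht, div_mul_cancel₀ _ hv'.ne'] at h2
  linarith

theorem isCompact_convexHull_union {A B : Set V} (hA : IsCompact (convexHull ℝ A))
    (hB : IsCompact (convexHull ℝ B)) : IsCompact (convexHull ℝ (A ∪ B)) := by
  rcases A.eq_empty_or_nonempty with rfl | hA0
  · simpa using hB
  rcases B.eq_empty_or_nonempty with rfl | hB0
  · simpa using hA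
  have h : convexHull ℝ (A ∪ B) = (fun p : ℝ × V × V => p.2.1 + p.1 • (p.2.2 - p.2.1)) ''
      (Set.Icc (0 : ℝ) 1 ×ˢ (convexHull ℝ A ×ˢ convexHull ℝ B)) := by
    rw [convexHull_union hA0 hB0]
    ext x
    simp only [mem_convexJoin, segment_eq_image', Set.mem_image, Set.mem_prod, Prod.exists]
    constructor
    · rintro ⟨a, ha, b, hb, t, ht, rfl⟩
      exact ⟨t, a, b, ⟨ht, ha, hb⟩, rfl⟩
    · rintro ⟨t, a, b, ⟨ht, ha, hb⟩, rfl⟩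
      exact ⟨a, ha, b, hb, t, ht, rfl⟩
  rw [h]
  exact (isCompact_Icc.prod (hA.prod hB)).image (by fun_prop)

theorem map_eq_zero_of_mem_convexHull {Y : Set V} {d : V →ₗ[ℝ] ℝ} (hd : ∀ y ∈ Y, d y = 0)
    {y : V} (hy : y ∈ convexHull ℝ Y) : d y = 0 := by
  have : convexHull ℝ Y ⊆ (LinearMap.ker d : Set V) :=
    convexHull_min (fun z hz => hd z hz) (LinearMap.ker d).convex
  exact this hy

/-- A hyperplane through the base `Y` of a join cuts the join into the joins of `Y` with the
pieces of the other factor. -/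
theorem convexHull_union_inter_nonneg {Y F : Set V} {d : V →ₗ[ℝ] ℝ} (hd : ∀ y ∈ Y, d y = 0)
    (hF : Convex ℝ F) :
    convexHull ℝ (Y ∪ F) ∩ {y | 0 ≤ d y} = convexHull ℝ (Y ∪ (F ∩ {y | 0 ≤ d y})) := by
  have hc : Convex ℝ {y | 0 ≤ d y} := convex_halfSpace_ge d.isLinear 0
  refine Set.Subset.antisymm ?_ (Set.subset_inter (convexHull_mono (by gcongr; simp))
    (convexHull_min ?_ hc))
  · rcases Y.eq_empty_or_nonempty with rfl | hY0
    · simp [hF.convexHull_eq, (hF.inter hc).convexHull_eq]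
    rcases F.eq_empty_or_nonempty with rfl | hF0
    · simp
    rintro y ⟨hy, hdy⟩
    rw [convexHull_union hY0 hF0, hF.convexHull_eq, mem_convexJoin] at hy
    obtain ⟨a, ha, b, hb, α, β, hα, hβ, hαβ, rfl⟩ := hy
    have hda := map_eq_zero_of_mem_convexHull hd ha
    rcases hβ.eq_or_lt with rfl | hβ'
    · have hα1 : α = 1 := by linarith
      subst hα1
      simpa using convexHull_mono Set.subset_union_left ha
    · have hdb : 0 ≤ d b := by
        simp only [Set.mem_ofPred_eq, map_add, map_smul, smul_eq_mul, hda, mul_zero, zero_add] at hdy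
        exact nonneg_of_mul_nonneg_right hdy hβ'
      exact convex_convexHull ℝ _ (convexHull_mono Set.subset_union_left ha)
        (subset_convexHull ℝ _ (Set.mem_union_right Y
          (show b ∈ F ∩ {y | 0 ≤ d y} from ⟨hb, hdb⟩))) hα hβ hαβ
  · rintro y (hy | hy)
    · exact (hd y hy).ge
    · exact hy.2

variable [FiniteDimensional ℝ V]

theorem isClosed_nonneg (d : V →ₗ[ℝ] ℝ) : IsClosed {y | 0 ≤ d y} :=
  isClosed_le continuous_const d.continuous_of_finiteDimensional

theorem isClosed_nonpos (d : V →ₗ[ℝ] ℝ) : IsClosed {y | d y ≤ 0} :=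
  isClosed_le d.continuous_of_finiteDimensional continuous_const

/-- `f` vanishes on the compact convex sets that lie in proper subspaces of `W`. -/
def VanishesBelow (f : Set V → ℝ) (W : Submodule ℝ V) : Prop :=
  ∀ W' : Submodule ℝ V, W' < W → ∀ K : Set V, K ⊆ W' → IsCompact K → Convex ℝ K → f K = 0

/-- Cutting a set in `W` by a hyperplane through the origin: the cross-section lies in a proper
subspace of `W`, unless the functional vanishes on `W`. -/
theorem IsSetValuation.eq_zero_of_cut {f : Set V → ℝ} (hf : IsSetValuation f)
    {W : Submodule ℝ V} (hlow : VanishesBelow f W) {K : Set V} (hKW : K ⊆ W) (hK : IsCompact K)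
    (hKc : Convex ℝ K) (d : V →ₗ[ℝ] ℝ) (h1 : f (K ∩ {y | 0 ≤ d y}) = 0)
    (h2 : f (K ∩ {y | d y ≤ 0}) = 0) : f K = 0 := by
  by_cases hd : W ≤ LinearMap.ker d
  · have : K ∩ {y | 0 ≤ d y} = K :=
      Set.inter_eq_left.mpr fun y hy => (LinearMap.mem_ker.mp (hd (hKW hy))).ge
    rwa [this] at h1
  have hu : (K ∩ {y | 0 ≤ d y}) ∪ (K ∩ {y | d y ≤ 0}) = K := by
    rw [← Set.inter_union_distrib_left]
    exact Set.inter_eq_left.mpr fun y _ => le_total 0 (d y)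
  have h := hf.union_inter _ _ (hK.inter_right (isClosed_nonneg d))
    (hKc.inter (convex_halfSpace_ge d.isLinear 0)) (hK.inter_right (isClosed_nonpos d))
    (hKc.inter (convex_halfSpace_le d.isLinear 0)) (hu.symm ▸ hKc)
  have h0 : f ((K ∩ {y | 0 ≤ d y}) ∩ (K ∩ {y | d y ≤ 0})) = 0 := by
    refine hlow (W ⊓ LinearMap.ker d) (inf_le_left.lt_of_ne fun he => hd (he ▸ inf_le_right)) _ ?_
      ((hK.inter_right (isClosed_nonneg d)).inter_right
        (hK.inter_right (isClosed_nonpos d)).isClosed)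
      ((hKc.inter (convex_halfSpace_ge d.isLinear 0)).inter
        (hKc.inter (convex_halfSpace_le d.isLinear 0)))
    rintro y ⟨⟨hy, hy1⟩, -, hy2⟩
    exact ⟨hKW hy, LinearMap.mem_ker.mpr (le_antisymm hy2 hy1)⟩
  rw [hu, h1, h2, h0] at h
  linarith

end SetValuation

/-! ### Pulling a vertex of a polytope -/

section SetValuation

variable {V : Type*} [NormedAddCommGroup V] [NormedSpace ℝ V]

/-- The set cut out in `U` by the equation `ℓ = 1` and the homogeneous constraints `m ≤ 0`,
`m ∈ s`: a section of a polyhedral cone. -/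
def coneSection (U : Submodule ℝ V) (ℓ : V →ₗ[ℝ] ℝ) (s : Finset (V →ₗ[ℝ] ℝ)) : Set V :=
  {y | y ∈ U ∧ ℓ y = 1 ∧ ∀ m ∈ s, m y ≤ 0}

theorem convex_coneSection (U : Submodule ℝ V) (ℓ : V →ₗ[ℝ] ℝ) (s : Finset (V →ₗ[ℝ] ℝ)) :
    Convex ℝ (coneSection U ℓ s) := by
  intro y hy z hz a b ha hb hab
  refine ⟨U.add_mem (U.smul_mem _ hy.1) (U.smul_mem _ hz.1), ?_, fun m hm => ?_⟩
  · simp [hy.2.1, hz.2.1, hab]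
  · have h1 := mul_nonpos_of_nonneg_of_nonpos ha (hy.2.2 m hm)
    have h2 := mul_nonpos_of_nonneg_of_nonpos hb (hz.2.2 m hm)
    simp only [map_add, map_smul, smul_eq_mul]
    linarith

theorem convex_forall_nonpos (s : Finset (V →ₗ[ℝ] ℝ)) : Convex ℝ {y | ∀ m ∈ s, m y ≤ 0} := by
  intro y hy z hz a b ha hb hab m hm
  have h1 := mul_nonpos_of_nonneg_of_nonpos ha (hy m hm)
  have h2 := mul_nonpos_of_nonneg_of_nonpos hb (hz m hm)
  simp only [map_add, map_smul, smul_eq_mul]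
  linarith

open scoped Classical in
/-- Pulling a point `p` of a polytope `F`: if the constraints that are inactive at `p` are
comparable on `F`, then `F` is the pyramid with apex `p` over a face that lies in a
smaller subspace. -/
theorem exists_pyramid {U : Submodule ℝ V} {ℓ : V →ₗ[ℝ] ℝ} {s₀ s₁ : Finset (V →ₗ[ℝ] ℝ)} {p : V}
    (hF : IsCompact (coneSection U ℓ (s₀ ∪ s₁))) (hp : p ∈ coneSection U ℓ (s₀ ∪ s₁))
    (h₁ : ∀ e ∈ s₁, e p = 0)
    (hsort : ∀ m ∈ insert (-ℓ) s₀, ∀ m' ∈ insert (-ℓ) s₀, m p < 0 → m' p < 0 →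
      (∀ y ∈ coneSection U ℓ (s₀ ∪ s₁), 0 ≤ (m p)⁻¹ * m y - (m' p)⁻¹ * m' y) ∨
      (∀ y ∈ coneSection U ℓ (s₀ ∪ s₁), (m p)⁻¹ * m y - (m' p)⁻¹ * m' y ≤ 0)) :
    ∃ m : V →ₗ[ℝ] ℝ, m p ≠ 0 ∧ ∀ y ∈ coneSection U ℓ (s₀ ∪ s₁), y = p ∨
      ∃ z ∈ coneSection (U ⊓ LinearMap.ker m) ℓ (s₀ ∪ s₁), y ∈ segment ℝ p z := by
  set F := coneSection U ℓ (s₀ ∪ s₁) with hFdef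
  have hℓp : ℓ p = 1 := hp.2.1
  -- Normalised inactive constraints `x ↦ -m x / m p ≤ 0`, all equal to `-1` at `p`.
  obtain ⟨m, hm, hmax⟩ := exists_forall_le_of_comparable F (fun m y => -((m p)⁻¹ * m y))
    (s := (insert (-ℓ) s₀).filter fun m => m p < 0)
    ⟨-ℓ, by simp [hℓp]⟩ (by
      intro m hm m' hm'
      rw [Finset.mem_filter] at hm hm'
      refine (hsort m hm.1 m' hm'.1 hm.2 hm'.2).imp (fun h y hy => ?_) (fun h y hy => ?_) <;>
      · have := h y hy
        linarith)
  rw [Finset.mem_filter] at hm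
  obtain ⟨hms, hmp⟩ := hm
  refine ⟨m, hmp.ne, fun y hy => ?_⟩
  -- Points of the ray from `p` through `y` satisfy all constraints as long as they satisfy `m`.
  have hray : ∀ t : ℝ, 0 ≤ t → (m p)⁻¹ * (m (p + t • (y - p))) ≥ 0 → p + t • (y - p) ∈ F := by
    intro t ht hmt
    refine ⟨U.add_mem hp.1 (U.smul_mem _ (U.sub_mem hy.1 hp.1)), ?_, fun e he => ?_⟩
    · simp [hy.2.1, hℓp]
    by_cases hep : e p < 0
    · have hes : e ∈ s₀ := by
        rcases Finset.mem_union.mp he with he | he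
        · exact he
        · exact absurd (h₁ e he) hep.ne
      have h1 := hmax e (by simp [hes, hep]) y hy
      have h2 : (e p)⁻¹ * e (p + t • (y - p)) = 1 + t * ((e p)⁻¹ * e y - 1) := by
        simp only [map_add, map_smul, map_sub, smul_eq_mul]
        field_simp [hep.ne]
      have h3 : (m p)⁻¹ * m (p + t • (y - p)) = 1 + t * ((m p)⁻¹ * m y - 1) := by
        simp only [map_add, map_smul, map_sub, smul_eq_mul]
        field_simp [hmp.ne]
      have h4 : 0 ≤ (e p)⁻¹ * e (p + t • (y - p)) := by
        rw [h2]
        rw [h3] at hmt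
        nlinarith
      by_contra hcon
      push Not at hcon
      exact absurd h4 (not_le.mpr (mul_neg_of_neg_of_pos (inv_lt_zero.mpr hep) hcon))
    · have h0 : e p = 0 := le_antisymm (hp.2.2 e he) (not_lt.mp hep)
      simp only [map_add, map_smul, map_sub, smul_eq_mul, h0, sub_zero, zero_add]
      exact mul_nonpos_of_nonneg_of_nonpos ht (hy.2.2 e he)
  have hval : ∀ t : ℝ, (m p)⁻¹ * m (p + t • (y - p)) = 1 + t * ((m p)⁻¹ * m y - 1) := fun t => by
    simp only [map_add, map_smul, map_sub, smul_eq_mul]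
    field_simp [hmp.ne]
  have hμ0 : 0 ≤ (m p)⁻¹ * m y := by
    have : m y ≤ 0 := by
      rcases Finset.mem_insert.mp hms with rfl | hms
      · simp [hy.2.1]
      · exact hy.2.2 m (Finset.mem_union_left _ hms)
    exact mul_nonneg_of_nonpos_of_nonpos (inv_lt_zero.mpr hmp).le this
  set μ := (m p)⁻¹ * m y with hμ
  by_cases hμ1 : 1 ≤ μ
  · left
    -- Otherwise the ray from `p` through `y` would stay in the bounded set `F`.
    have := eq_zero_of_ray_subset hF.isBounded (y := p) (v := y - p) fun t ht =>
      hray t ht (by rw [hval]; nlinarith)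
    exact sub_eq_zero.mp this
  · right
    push Not at hμ1
    -- The ray from `p` through `y` leaves `F` in the face `m = 0`.
    have hpos : 0 < 1 - μ := by linarith
    have hz0 : (m p)⁻¹ * m (p + (1 - μ)⁻¹ • (y - p)) = 0 := by
      rw [hval]
      field_simp
      ring
    have hz := hray (1 - μ)⁻¹ (by positivity) hz0.ge
    refine ⟨p + (1 - μ)⁻¹ • (y - p), ⟨⟨hz.1, ?_⟩, hz.2⟩, ?_⟩
    · rcases mul_eq_zero.mp hz0 with h | h
      · exact absurd h (inv_ne_zero hmp.ne)
      · exact h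
    · rw [segment_eq_image']
      refine ⟨1 - μ, ⟨hpos.le, by linarith⟩, ?_⟩
      simp only [add_sub_cancel_left]
      rw [smul_smul, mul_inv_cancel₀ hpos.ne', one_smul, add_sub_cancel]

variable [FiniteDimensional ℝ V]

theorem isClosed_forall_nonpos (s : Finset (V →ₗ[ℝ] ℝ)) :
    IsClosed {y | ∀ m ∈ s, m y ≤ 0} := by
  simp only [Set.ofPred_forall]
  exact isClosed_biInter fun m _ => isClosed_nonpos m

end SetValuation

/-! ### Joins of simplices with polytopes -/

section SetValuation

variable {V : Type*} [NormedAddCommGroup V] [NormedSpace ℝ V]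

theorem coneSection_mono {U U' : Submodule ℝ V} (hU : U' ≤ U) (ℓ : V →ₗ[ℝ] ℝ)
    {s s' : Finset (V →ₗ[ℝ] ℝ)} (hs : s ⊆ s') : coneSection U' ℓ s' ⊆ coneSection U ℓ s :=
  fun _ hy => ⟨hU hy.1, hy.2.1, fun m hm => hy.2.2 m (hs hm)⟩

open scoped Classical in
theorem coneSection_inter_nonneg (U : Submodule ℝ V) (ℓ d : V →ₗ[ℝ] ℝ)
    (s s' : Finset (V →ₗ[ℝ] ℝ)) :
    coneSection U ℓ (s ∪ s') ∩ {y | 0 ≤ d y} = coneSection U ℓ (s ∪ insert (-d) s') := by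
  ext y
  simp only [coneSection, Set.mem_inter_iff, Set.mem_ofPred_eq, Finset.mem_union,
    Finset.mem_insert]
  constructor
  · rintro ⟨⟨h1, h2, h3⟩, h4⟩
    refine ⟨h1, h2, ?_⟩
    rintro m (hm | rfl | hm)
    · exact h3 m (Or.inl hm)
    · simpa using h4
    · exact h3 m (Or.inr hm)
  · rintro ⟨h1, h2, h3⟩
    refine ⟨⟨h1, h2, fun m hm => h3 m (by tauto)⟩, ?_⟩
    simpa using h3 (-d) (by simp)

theorem inter_nonpos_eq (K : Set V) (d : V →ₗ[ℝ] ℝ) :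
    K ∩ {y | d y ≤ 0} = K ∩ {y | 0 ≤ (-d) y} := by
  ext y; simp

variable [FiniteDimensional ℝ V]

theorem isClosed_coneSection (U : Submodule ℝ V) (ℓ : V →ₗ[ℝ] ℝ) (s : Finset (V →ₗ[ℝ] ℝ)) :
    IsClosed (coneSection U ℓ s) :=
  U.closed_of_finiteDimensional.inter
    ((isClosed_eq ℓ.continuous_of_finiteDimensional continuous_const).inter
      (isClosed_forall_nonpos s))

/-- The join of a simplex with linearly independent vertices `v` (and possibly the origin) with a
polytope in a complementary subspace is cut, by hyperplanes through `v` and the origin, into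
simplices with linearly independent vertices (and possibly the origin). -/
theorem IsSetValuation.join_eq_zero {f : Set V → ℝ} (hf : IsSetValuation f) {W : Submodule ℝ V}
    (hlow : VanishesBelow f W) {X : Set V} (hX : X ⊆ {0})
    (hsimp : ∀ v : Set V, LinearIndepOn ℝ id v → f (convexHull ℝ (X ∪ v)) = 0) (k : ℕ) :
    ∀ U : Submodule ℝ V, U ≤ W → Module.finrank ℝ U ≤ k → ∀ v : Set V, LinearIndepOn ℝ id v →
      Disjoint (Submodule.span ℝ v) U → v ⊆ W → ∀ (ℓ : V →ₗ[ℝ] ℝ) (s : Finset (V →ₗ[ℝ] ℝ)),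
      IsCompact (coneSection U ℓ s) → f (convexHull ℝ (X ∪ v ∪ coneSection U ℓ s)) = 0 := by
  classical
  induction k with
  | zero =>
    intro U hUW hU v hv hdisj hvW ℓ s hF
    have hU0 : U = ⊥ := Submodule.finrank_eq_zero.mp (Nat.le_zero.mp hU)
    have : coneSection U ℓ s = ∅ := by
      refine Set.eq_empty_of_forall_notMem fun y hy => ?_
      have h0 : y = 0 := by simpa [hU0] using hy.1
      have := hy.2.1
      simp [h0] at this
    rw [this, Set.union_empty]
    exact hsimp v hv
  | succ k ih =>
    intro U hUW hU v hv hdisj hvW ℓ s hF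
    rcases (coneSection U ℓ s).eq_empty_or_nonempty with hemp | ⟨p, hp⟩
    · rw [hemp, Set.union_empty]
      exact hsimp v hv
    obtain ⟨C, hvC, hC⟩ := hdisj.exists_isCompl
    set π : V →ₗ[ℝ] V := U.projection C hC.symm with hπ
    have hπU : ∀ y ∈ U, π y = y := fun y hy => (Submodule.projection_eq_self_iff hC.symm y).mpr hy
    have hπC : ∀ y ∈ C, π y = 0 := fun y hy =>
      (Submodule.projection_apply_eq_zero_iff hC.symm).mpr hy
    -- The differences of the normalised constraints that are inactive at `p`, extended by zero along
    -- a complement of `U` that contains `v`; cutting by them makes `exists_pyramid` applicable.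
    set s' := (insert (-ℓ) s).filter fun m => m p < 0 with hs'
    set D : Finset (V →ₗ[ℝ] ℝ) :=
      (s' ×ˢ s').image fun q => ((q.1 p)⁻¹ • q.1 - (q.2 p)⁻¹ • q.2).comp π with hD
    have hDv : ∀ d ∈ D, ∀ y ∈ X ∪ v, d y = 0 := by
      intro d hd y hy
      obtain ⟨q, -, rfl⟩ := Finset.mem_image.mp hd
      rcases hy with hy | hy
      · have : y = 0 := by simpa using hX hy
        simp [this]
      · simp [hπC y (hvC (Submodule.subset_span hy))]
    have hDp : ∀ d ∈ D, d p = 0 := by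
      intro d hd
      obtain ⟨q, hq, rfl⟩ := Finset.mem_image.mp hd
      obtain ⟨h1, h2⟩ := Finset.mem_product.mp hq
      have h1 := (Finset.mem_filter.mp h1).2.ne
      have h2 := (Finset.mem_filter.mp h2).2.ne
      simp [hπU p hp.1, h1, h2]
    have hcomp : ∀ s₁ : Finset (V →ₗ[ℝ] ℝ), IsCompact (coneSection U ℓ (s ∪ s₁)) := fun s₁ =>
      hF.of_isClosed_subset (isClosed_coneSection _ _ _)
        (coneSection_mono le_rfl ℓ Finset.subset_union_left)
    have hYc : IsCompact (convexHull ℝ (X ∪ v)) :=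
      ((((Set.finite_singleton (0 : V)).subset hX).union
        (LinearIndependent.setFinite hv))).isCompact_convexHull ℝ
    have hXW : X ⊆ W := fun y hy => by
      have : y = 0 := by simpa using hX hy
      simp [this]
    have key := of_sorted_pieces (P := fun G => ∃ s₁ : Finset (V →ₗ[ℝ] ℝ),
        (∀ e ∈ s₁, e p = 0) ∧ G = coneSection U ℓ (s ∪ s₁))
      (Z := fun G => f (convexHull ℝ (X ∪ v ∪ G)) = 0) D ?_ ?_ ?_ (coneSection U ℓ s)
      ⟨∅, by simp, by simp⟩
    · exact key
    · rintro _ ⟨s₁, hs₁, rfl⟩ d hd h1 h2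
      have hGc := convex_coneSection U ℓ (s ∪ s₁)
      refine hf.eq_zero_of_cut hlow (K := convexHull ℝ (X ∪ v ∪ coneSection U ℓ (s ∪ s₁)))
        (convexHull_min (Set.union_subset (Set.union_subset hXW hvW) fun y hy => hUW hy.1)
          W.convex) (isCompact_convexHull_union hYc ?_) (convex_convexHull ℝ _) d ?_ ?_
      · rw [hGc.convexHull_eq]
        exact hcomp s₁
      · rwa [convexHull_union_inter_nonneg (hDv d hd) hGc]
      · rw [inter_nonpos_eq] at h2 ⊢
        rwa [convexHull_union_inter_nonneg (fun y hy => by simp [hDv d hd y hy]) hGc]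
    · rintro _ ⟨s₁, hs₁, rfl⟩ d hd
      refine ⟨⟨insert (-d) s₁, ?_, coneSection_inter_nonneg _ _ _ _ _⟩,
        ⟨insert (- -d) s₁, ?_, ?_⟩⟩
      · rintro e he
        rcases Finset.mem_insert.mp he with rfl | he
        exacts [by simp [hDp d hd], hs₁ e he]
      · rintro e he
        rcases Finset.mem_insert.mp he with rfl | he
        exacts [by simp [hDp d hd], hs₁ e he]
      · rw [inter_nonpos_eq]
        exact coneSection_inter_nonneg _ _ _ _ _
    · rintro _ ⟨s₁, hs₁, rfl⟩ hsort
      have hp' : p ∈ coneSection U ℓ (s ∪ s₁) := ⟨hp.1, hp.2.1, fun m hm => by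
        rcases Finset.mem_union.mp hm with hm | hm
        exacts [hp.2.2 m hm, (hs₁ m hm).le]⟩
      obtain ⟨m, hmp, hm⟩ := exists_pyramid (hcomp s₁) hp' hs₁ (by
        intro m hm m' hm' h1 h2
        have hd : ((m p)⁻¹ • m - (m' p)⁻¹ • m').comp π ∈ D :=
          Finset.mem_image.mpr ⟨(m, m'), Finset.mem_product.mpr
            ⟨Finset.mem_filter.mpr ⟨hm, h1⟩, Finset.mem_filter.mpr ⟨hm', h2⟩⟩, rfl⟩
        refine (hsort _ hd).imp (fun h y hy => ?_) (fun h y hy => ?_)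
        · simpa [hπU y hy.1] using h y hy
        · simpa [hπU y hy.1] using h y hy)
      set U' := U ⊓ LinearMap.ker m with hU'
      have hlt : U' < U := inf_le_left.lt_of_ne fun h => hmp (by
        have : p ∈ U' := by rw [hU', h]; exact hp.1
        exact this.2)
      have hpv : p ∉ Submodule.span ℝ v := fun h => by
        have h0 : p = 0 := by simpa using hdisj.le_bot ⟨h, hp.1⟩
        have := hp.2.1
        simp [h0] at this
      -- The apex `p` of the pyramid becomes a new vertex of the simplex.
      have heq : convexHull ℝ (X ∪ v ∪ coneSection U ℓ (s ∪ s₁)) =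
          convexHull ℝ (X ∪ insert p v ∪ coneSection U' ℓ (s ∪ s₁)) := by
        refine Set.Subset.antisymm (convexHull_min ?_ (convex_convexHull ℝ _))
          (convexHull_mono ?_)
        · have hsub : X ∪ v ⊆ convexHull ℝ (X ∪ insert p v ∪ coneSection U' ℓ (s ∪ s₁)) := by
            refine Set.Subset.trans ?_ (subset_convexHull ℝ _)
            intro y hy
            rcases hy with hy | hy
            exacts [Or.inl (Or.inl hy), Or.inl (Or.inr (Or.inr hy))]
          have hpm : p ∈ convexHull ℝ (X ∪ insert p v ∪ coneSection U' ℓ (s ∪ s₁)) :=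
            subset_convexHull ℝ _ (Or.inl (Or.inr (Or.inl rfl)))
          refine Set.union_subset hsub fun y hy => ?_
          rcases hm y hy with rfl | ⟨z, hz, hyz⟩
          · exact hpm
          · exact (convex_convexHull ℝ _).segment_subset hpm
              (subset_convexHull ℝ _ (Or.inr hz)) hyz
        · rintro y ((hy | hy | hy) | hy)
          · exact Or.inl (Or.inl hy)
          · exact Or.inr (hy ▸ hp')
          · exact Or.inl (Or.inr hy)
          · exact Or.inr (coneSection_mono hlt.le ℓ (Finset.Subset.refl _) hy)
      rw [heq]
      refine ih U' (hlt.le.trans hUW) ?_ _ (hv.id_insert hpv) ?_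
        (Set.insert_subset (hUW hp.1) hvW) ℓ _
        ((hcomp s₁).of_isClosed_subset (isClosed_coneSection _ _ _)
          (coneSection_mono hlt.le ℓ (Finset.Subset.refl _)))
      · have := Submodule.finrank_lt_finrank_of_lt hlt
        omega
      · rw [Submodule.disjoint_def]
        intro u hu huU
        obtain ⟨a, w, hw, rfl⟩ := Submodule.mem_span_insert.mp hu
        have hw0 : w = 0 := by
          have hwU : w ∈ U := by
            have := U.sub_mem huU.1 (U.smul_mem a hp.1)
            simpa using this
          simpa using hdisj.le_bot ⟨hw, hwU⟩
        have ham : a * m p = 0 := by simpa [hw0] using huU.2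
        have ha : a = 0 := (mul_eq_zero.mp ham).resolve_right hmp
        simp [ha, hw0]

end SetValuation

/-! ### Truncated cones -/

section SetValuation

variable {V : Type*} [NormedAddCommGroup V] [NormedSpace ℝ V]

/-- The set of points of `W` that satisfy `ℓ ≤ 1` for `ℓ ∈ A`, `1 ≤ ℓ` for `ℓ ∈ B` and `m ≤ 0` for
`m ∈ S`. Every polyhedral subset of `W` has this form. -/
def truncatedCone (W : Submodule ℝ V) (A B S : Finset (V →ₗ[ℝ] ℝ)) : Set V :=
  {y | y ∈ W ∧ (∀ ℓ ∈ A, ℓ y ≤ 1) ∧ (∀ ℓ ∈ B, 1 ≤ ℓ y) ∧ ∀ m ∈ S, m y ≤ 0}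

theorem convex_truncatedCone (W : Submodule ℝ V) (A B S : Finset (V →ₗ[ℝ] ℝ)) :
    Convex ℝ (truncatedCone W A B S) := by
  intro y hy z hz a b ha hb hab
  refine ⟨W.add_mem (W.smul_mem _ hy.1) (W.smul_mem _ hz.1), fun m hm => ?_, fun m hm => ?_,
    convex_forall_nonpos S hy.2.2.2 hz.2.2.2 ha hb hab⟩
  · exact convex_halfSpace_le m.isLinear 1 (hy.2.1 m hm) (hz.2.1 m hm) ha hb hab
  · exact convex_halfSpace_ge m.isLinear 1 (hy.2.2.1 m hm) (hz.2.2.1 m hm) ha hb hab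

open scoped Classical in
theorem truncatedCone_inter_nonneg (W : Submodule ℝ V) (A B S : Finset (V →ₗ[ℝ] ℝ))
    (d : V →ₗ[ℝ] ℝ) :
    truncatedCone W A B S ∩ {y | 0 ≤ d y} = truncatedCone W A B (insert (-d) S) := by
  ext y
  simp only [truncatedCone, Set.mem_inter_iff, Set.mem_ofPred_eq, Finset.forall_mem_insert,
    LinearMap.neg_apply, Left.neg_nonpos_iff]
  tauto

open scoped Classical in
theorem truncatedCone_inter_eq_one (W : Submodule ℝ V) (A B S : Finset (V →ₗ[ℝ] ℝ))
    (g : V →ₗ[ℝ] ℝ) :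
    truncatedCone W A B S ∩ {y | g y = 1} =
      coneSection W g (A.image (fun ℓ => ℓ - g) ∪ (B.image (fun ℓ => g - ℓ) ∪ S)) := by
  ext y
  simp only [truncatedCone, coneSection, Set.mem_inter_iff, Set.mem_ofPred_eq,
    Finset.forall_mem_union, Finset.forall_mem_image, LinearMap.sub_apply, sub_nonpos]
  constructor
  · rintro ⟨⟨h1, h2, h3, h4⟩, h5⟩
    exact ⟨h1, h5, by simpa [h5] using h2, by simpa [h5] using h3, h4⟩
  · rintro ⟨h1, h5, h2, h3, h4⟩
    exact ⟨⟨h1, by simpa [h5] using h2, by simpa [h5] using h3, h4⟩, h5⟩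

theorem exists_smul_of_mem_convexHull_zero_union {F : Set V} (hF : Convex ℝ F) (hF0 : F.Nonempty)
    {y : V} (hy : y ∈ convexHull ℝ ({0} ∪ F)) :
    ∃ t : ℝ, 0 ≤ t ∧ t ≤ 1 ∧ ∃ z ∈ F, y = t • z := by
  rw [convexHull_union (Set.singleton_nonempty 0) hF0, convexHull_singleton, hF.convexHull_eq,
    mem_convexJoin] at hy
  obtain ⟨a, rfl, z, hz, hyz⟩ := hy
  rw [segment_eq_image'] at hyz
  obtain ⟨t, ht, rfl⟩ := hyz
  exact ⟨t, ht.1, ht.2, z, hz, by simp⟩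

theorem smul_mem_convexHull_zero_union {F : Set V} {z : V} (hz : z ∈ F) {t : ℝ} (h0 : 0 ≤ t)
    (h1 : t ≤ 1) : t • z ∈ convexHull ℝ ({0} ∪ F) := by
  have := (convex_convexHull ℝ ({0} ∪ F)) (subset_convexHull ℝ _ (Or.inl rfl))
    (subset_convexHull ℝ _ (Or.inr hz)) (sub_nonneg.mpr h1) h0 (by ring)
  simpa using this

variable [FiniteDimensional ℝ V]

theorem isClosed_truncatedCone (W : Submodule ℝ V) (A B S : Finset (V →ₗ[ℝ] ℝ)) :
    IsClosed (truncatedCone W A B S) := by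
  refine W.closed_of_finiteDimensional.inter (IsClosed.inter ?_ (IsClosed.inter ?_
    (isClosed_forall_nonpos S)))
  · have : IsClosed {y : V | ∀ ℓ ∈ A, ℓ y ≤ 1} := by
      simp only [Set.ofPred_forall]
      exact isClosed_biInter fun m _ =>
        isClosed_le m.continuous_of_finiteDimensional continuous_const
    exact this
  · have : IsClosed {y : V | ∀ ℓ ∈ B, 1 ≤ ℓ y} := by
      simp only [Set.ofPred_forall]
      exact isClosed_biInter fun m _ =>
        isClosed_le continuous_const m.continuous_of_finiteDimensional
    exact this

/-- If one of the constraints `ℓ ≤ 1` dominates the others and one of the constraints `1 ≤ ℓ'` is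
dominated by the others, then the truncated cone is the difference of two pyramids with apex at
the origin. -/
theorem IsSetValuation.frustum_eq_zero {f : Set V → ℝ} (hf : IsSetValuation f)
    {W : Submodule ℝ V} {A B S : Finset (V →ₗ[ℝ] ℝ)} (hK : IsCompact (truncatedCone W A B S))
    (hsec : ∀ g : V →ₗ[ℝ] ℝ, f (truncatedCone W A B S ∩ {y | g y = 1}) = 0)
    (hpyr : ∀ g : V →ₗ[ℝ] ℝ, f (convexHull ℝ ({0} ∪ (truncatedCone W A B S ∩ {y | g y = 1}))) = 0)
    {ℓ : V →ₗ[ℝ] ℝ} (hℓ : ℓ ∈ A) (hmax : ∀ m ∈ A, ∀ y ∈ truncatedCone W A B S, m y ≤ ℓ y)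
    (hmin : B.Nonempty → ∃ ℓ' ∈ B, ∀ m ∈ B, ∀ y ∈ truncatedCone W A B S, ℓ' y ≤ m y) :
    f (truncatedCone W A B S) = 0 := by
  set K := truncatedCone W A B S with hKdef
  have hKc : Convex ℝ K := convex_truncatedCone W A B S
  have hscale : ∀ y ∈ K, ∀ t : ℝ, 0 ≤ t → t * ℓ y ≤ 1 → (∀ m ∈ B, 1 ≤ t * m y) → t • y ∈ K := by
    intro y hy t ht h1 h2
    refine ⟨W.smul_mem _ hy.1, fun m hm => ?_, fun m hm => ?_, fun m hm => ?_⟩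
    · rw [map_smul, smul_eq_mul]
      exact (mul_le_mul_of_nonneg_left (hmax m hm y hy) ht).trans h1
    · rw [map_smul, smul_eq_mul]
      exact h2 m hm
    · rw [map_smul, smul_eq_mul]
      exact mul_nonpos_of_nonneg_of_nonpos ht (hy.2.2.2 m hm)
  have hpos : ∀ y ∈ K, y ≠ 0 → 0 < ℓ y := by
    intro y hy hy0
    -- If `ℓ y ≤ 0`, then `K` contains the ray from `y` in direction `y`.
    by_contra hcon
    push Not at hcon
    refine hy0 (eq_zero_of_ray_subset hK.isBounded (y := y) fun t ht => ?_)
    have := hscale y hy (1 + t) (by linarith) (by nlinarith) fun m hm => by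
      nlinarith [hy.2.2.1 m hm]
    rwa [add_smul, one_smul] at this
  have hup : ∀ y ∈ K, y ≠ 0 → (ℓ y)⁻¹ • y ∈ K ∩ {y | ℓ y = 1} := by
    intro y hy hy0
    have h := hpos y hy hy0
    have h1 : 1 ≤ (ℓ y)⁻¹ := (one_le_inv₀ h).mpr (hy.2.1 ℓ hℓ)
    refine ⟨hscale y hy _ (by positivity) (inv_mul_cancel₀ h.ne').le fun m hm => ?_, ?_⟩
    · nlinarith [hy.2.2.1 m hm]
    · simp [inv_mul_cancel₀ h.ne']
  have hKup : K ⊆ convexHull ℝ ({0} ∪ (K ∩ {y | ℓ y = 1})) := by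
    intro y hy
    rcases eq_or_ne y 0 with rfl | hy0
    · exact subset_convexHull ℝ _ (Or.inl rfl)
    have h := hpos y hy hy0
    have := smul_mem_convexHull_zero_union (hup y hy hy0) h.le (hy.2.1 ℓ hℓ)
    rwa [smul_smul, mul_inv_cancel₀ h.ne', one_smul] at this
  -- Without lower constraints, `K` itself is a pyramid with apex at the origin.
  rcases B.eq_empty_or_nonempty with rfl | hB
  · have h0 : (0 : V) ∈ K := ⟨W.zero_mem, by simp, by simp, by simp⟩
    have : K = convexHull ℝ ({0} ∪ (K ∩ {y | ℓ y = 1})) :=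
      hKup.antisymm (convexHull_min (Set.union_subset (by simpa using h0) Set.inter_subset_left)
        hKc)
    rw [this]
    exact hpyr ℓ
  obtain ⟨ℓ', hℓ', hmin⟩ := hmin hB
  have h0K : ∀ y ∈ K, y ≠ 0 := by
    rintro y hy rfl
    have := hy.2.2.1 ℓ' hℓ'
    simp at this
    linarith
  have hdown : ∀ y ∈ K, (ℓ' y)⁻¹ • y ∈ K ∩ {y | ℓ' y = 1} := by
    intro y hy
    have h1 := hy.2.2.1 ℓ' hℓ'
    have h : 0 < ℓ' y := by linarith
    refine ⟨hscale y hy _ (by positivity) ?_ fun m hm => ?_, ?_⟩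
    · rw [inv_mul_le_iff₀ h]
      linarith [hy.2.1 ℓ hℓ]
    · rw [le_inv_mul_iff₀ h]
      linarith [hmin m hm y hy]
    · simp [inv_mul_cancel₀ h.ne']
  rcases K.eq_empty_or_nonempty with hemp | ⟨y₀, hy₀⟩
  · rw [hemp, hf.empty]
  have hcone : ∀ g : V →ₗ[ℝ] ℝ, Convex ℝ (K ∩ {y | g y = 1}) := fun g =>
    hKc.inter (convex_hyperplane g.isLinear 1)
  have hcpt : ∀ g : V →ₗ[ℝ] ℝ, IsCompact (convexHull ℝ ({0} ∪ (K ∩ {y | g y = 1}))) := by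
    intro g
    refine isCompact_convexHull_union (by simp) ?_
    rw [(hcone g).convexHull_eq]
    exact hK.inter_right (isClosed_eq g.continuous_of_finiteDimensional continuous_const)
  have hunion : K ∪ convexHull ℝ ({0} ∪ (K ∩ {y | ℓ' y = 1})) =
      convexHull ℝ ({0} ∪ (K ∩ {y | ℓ y = 1})) := by
    refine Set.Subset.antisymm (Set.union_subset hKup (convexHull_min (Set.union_subset ?_ ?_)
      (convex_convexHull ℝ _))) fun y hy => ?_
    · exact Set.subset_union_left.trans (subset_convexHull ℝ _)
    · exact Set.inter_subset_left.trans hKup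
    · obtain ⟨t, ht0, ht1, z, ⟨hz, hz1⟩, rfl⟩ := exists_smul_of_mem_convexHull_zero_union (hcone ℓ)
        ⟨_, hup y₀ hy₀ (h0K y₀ hy₀)⟩ hy
      by_cases hc : 1 ≤ t * ℓ' z
      · refine Or.inl (hscale z hz t ht0 ?_ fun m hm => ?_)
        · rw [show ℓ z = 1 from hz1]
          linarith
        · nlinarith [hmin m hm z hz]
      · push Not at hc
        have h1 := hz.2.2.1 ℓ' hℓ'
        have h : 0 < ℓ' z := by linarith
        have := smul_mem_convexHull_zero_union (hdown z hz) (mul_nonneg ht0 h.le) hc.le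
        rw [smul_smul, mul_assoc, mul_inv_cancel₀ h.ne', mul_one] at this
        exact Or.inr this
  have hinter : K ∩ convexHull ℝ ({0} ∪ (K ∩ {y | ℓ' y = 1})) = K ∩ {y | ℓ' y = 1} := by
    refine Set.Subset.antisymm (fun y hy => ⟨hy.1, le_antisymm ?_ (hy.1.2.2.1 ℓ' hℓ')⟩)
      fun y hy => ⟨hy.1, subset_convexHull ℝ _ (Or.inr hy)⟩
    have hsub : convexHull ℝ ({0} ∪ (K ∩ {y | ℓ' y = 1})) ⊆ {y | ℓ' y ≤ 1} := by
      refine convexHull_min (Set.union_subset ?_ ?_) (convex_halfSpace_le ℓ'.isLinear 1)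
      · simp
      · exact fun y hy => hy.2.le
    exact hsub hy.2
  have h := hf.union_inter K _ hK hKc (hcpt ℓ') (convex_convexHull ℝ _)
    (hunion ▸ convex_convexHull ℝ _)
  rw [hunion, hinter, hpyr, hpyr, hsec] at h
  linarith

/-- A valuation that vanishes on the simplices with linearly independent vertices, on the convex
hulls of these with the origin, and on the compact convex sets in proper subspaces of `W` vanishes
on the polytopes in `W`. -/
theorem IsSetValuation.polytope_eq_zero {f : Set V → ℝ} (hf : IsSetValuation f)
    {W : Submodule ℝ V} (hlow : VanishesBelow f W)
    (h₀ : ∀ v : Set V, LinearIndepOn ℝ id v → f (convexHull ℝ v) = 0)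
    (h₁ : ∀ v : Set V, LinearIndepOn ℝ id v → f (convexHull ℝ ({0} ∪ v)) = 0)
    {A B S : Finset (V →ₗ[ℝ] ℝ)} (hA : A.Nonempty) (hK : IsCompact (truncatedCone W A B S)) :
    f (truncatedCone W A B S) = 0 := by
  classical
  -- Cutting along these hyperplanes makes the functionals of `A`, and those of `B`, comparable.
  set D : Finset (V →ₗ[ℝ] ℝ) :=
    (A ×ˢ A).image (fun q => q.2 - q.1) ∪ (B ×ˢ B).image (fun q => q.2 - q.1) with hD
  have hsub : ∀ S' : Finset (V →ₗ[ℝ] ℝ),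
      truncatedCone W A B (S' ∪ S) ⊆ truncatedCone W A B S := fun S' y hy =>
    ⟨hy.1, hy.2.1, hy.2.2.1, fun m hm => hy.2.2.2 m (Finset.mem_union_right _ hm)⟩
  have hcomp : ∀ S' : Finset (V →ₗ[ℝ] ℝ), IsCompact (truncatedCone W A B (S' ∪ S)) := fun S' =>
    hK.of_isClosed_subset (isClosed_truncatedCone _ _ _ _) (hsub S')
  refine of_sorted_pieces (P := fun G => ∃ S' : Finset (V →ₗ[ℝ] ℝ),
    G = truncatedCone W A B (S' ∪ S)) (Z := fun G => f G = 0) D ?_ ?_ ?_ _ ⟨∅, by simp⟩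
  · rintro _ ⟨S', rfl⟩ d hd h1 h2
    exact hf.eq_zero_of_cut hlow (fun y hy => hy.1) (hcomp S') (convex_truncatedCone _ _ _ _) d
      h1 h2
  · rintro _ ⟨S', rfl⟩ d hd
    refine ⟨⟨insert (-d) S', ?_⟩, ⟨insert (- -d) S', ?_⟩⟩
    · rw [truncatedCone_inter_nonneg, Finset.insert_union]
    · rw [inter_nonpos_eq, truncatedCone_inter_nonneg, Finset.insert_union]
  · rintro _ ⟨S', rfl⟩ hsort
    have hcmp : ∀ C : Finset (V →ₗ[ℝ] ℝ), (∀ m ∈ C, ∀ m' ∈ C, m' - m ∈ D) →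
        ∀ m ∈ C, ∀ m' ∈ C, (∀ y ∈ truncatedCone W A B (S' ∪ S), m y ≤ m' y) ∨
          (∀ y ∈ truncatedCone W A B (S' ∪ S), m' y ≤ m y) := by
      intro C hC m hm m' hm'
      refine (hsort _ (hC m hm m' hm')).imp (fun h y hy => ?_) (fun h y hy => ?_)
      · simpa using h y hy
      · simpa using h y hy
    obtain ⟨ℓ, hℓ, hmax⟩ := exists_forall_le_of_comparable (truncatedCone W A B (S' ∪ S))
      (fun m : V →ₗ[ℝ] ℝ => (m : V → ℝ)) hA (hcmp A fun m hm m' hm' => Finset.mem_union_left _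
        (Finset.mem_image.mpr ⟨(m, m'), Finset.mem_product.mpr ⟨hm, hm'⟩, rfl⟩))
    -- Sections by `g = 1` and the pyramids over them are joins with an empty simplex.
    have hjoin : ∀ X : Set V, X ⊆ {0} →
        (∀ v : Set V, LinearIndepOn ℝ id v → f (convexHull ℝ (X ∪ v)) = 0) → ∀ g : V →ₗ[ℝ] ℝ,
        f (convexHull ℝ (X ∪ (truncatedCone W A B (S' ∪ S) ∩ {y | g y = 1}))) = 0 := by
      intro X hX hv g
      have hc := (hcomp S').inter_right
        (isClosed_eq g.continuous_of_finiteDimensional (continuous_const (y := (1 : ℝ))))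
      rw [truncatedCone_inter_eq_one] at hc ⊢
      simpa using hf.join_eq_zero hlow hX hv _ W le_rfl le_rfl ∅ (linearIndepOn_empty ℝ id)
        (by simp) (by simp) g _ hc
    refine hf.frustum_eq_zero (hcomp S') (fun g => ?_) (hjoin {0} le_rfl h₁) hℓ hmax fun hB => ?_
    · have := hjoin ∅ (Set.empty_subset _) (by simpa using h₀) g
      rwa [Set.empty_union, ((convex_truncatedCone W A B (S' ∪ S)).inter
        (convex_hyperplane g.isLinear 1)).convexHull_eq] at this
    · refine (exists_forall_le_of_comparable (truncatedCone W A B (S' ∪ S))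
        (fun m : V →ₗ[ℝ] ℝ => fun y => -m y) hB ?_).imp fun m hm => ⟨hm.1, fun m' hm' y hy => ?_⟩
      · intro m hm m' hm'
        refine (hcmp B (fun m hm m' hm' => Finset.mem_union_right _ (Finset.mem_image.mpr
          ⟨(m, m'), Finset.mem_product.mpr ⟨hm, hm'⟩, rfl⟩)) m' hm' m hm).imp
          (fun h y hy => neg_le_neg (h y hy)) (fun h y hy => neg_le_neg (h y hy))
      · exact neg_le_neg_iff.mp (hm.2 m' hm' y hy)

end SetValuation

/-! ### Valuations vanishing on simplices -/

section SetValuation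

variable {V : Type*} [NormedAddCommGroup V] [NormedSpace ℝ V]

theorem exists_truncatedCone_eq (W : Submodule ℝ V) (T : Finset ((V →ₗ[ℝ] ℝ) × ℝ)) :
    ∃ A B S : Finset (V →ₗ[ℝ] ℝ), A.Nonempty ∧
      {y | y ∈ W ∧ ∀ p ∈ T, p.1 y ≤ p.2} = truncatedCone W A B S := by
  classical
  -- The functional `0` only serves to make `A` nonempty.
  refine ⟨insert 0 ((T.filter fun p => 0 < p.2).image fun p => p.2⁻¹ • p.1),
    (T.filter fun p => p.2 < 0).image fun p => p.2⁻¹ • p.1,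
    (T.filter fun p => p.2 = 0).image fun p => p.1, Finset.insert_nonempty _ _, ?_⟩
  ext y
  simp only [truncatedCone, Set.mem_ofPred_eq, Finset.forall_mem_insert, Finset.forall_mem_image,
    Finset.mem_filter, and_imp, LinearMap.smul_apply, smul_eq_mul, LinearMap.zero_apply,
    zero_le_one, true_and, and_congr_right_iff]
  intro _
  have hpos : ∀ p : (V →ₗ[ℝ] ℝ) × ℝ, 0 < p.2 → (p.2⁻¹ * p.1 y ≤ 1 ↔ p.1 y ≤ p.2) := by
    intro p hp
    rw [inv_mul_le_iff₀ hp, mul_one]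
  have hneg : ∀ p : (V →ₗ[ℝ] ℝ) × ℝ, p.2 < 0 → (1 ≤ p.2⁻¹ * p.1 y ↔ p.1 y ≤ p.2) := by
    intro p hp
    rw [inv_mul_eq_div, one_le_div_of_neg hp]
  constructor
  · intro h
    exact ⟨fun p hp h0 => (hpos p h0).mpr (h p hp), fun p hp h0 => (hneg p h0).mpr (h p hp),
      fun p hp h0 => h0 ▸ h p hp⟩
  · rintro ⟨h1, h2, h3⟩ p hp
    rcases lt_trichotomy p.2 0 with h | h | h
    · exact (hneg p h).mp (h2 hp h)
    · exact (h3 hp h).trans h.ge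
    · exact (hpos p h).mp (h1 hp h)

variable [FiniteDimensional ℝ V]

/-- Outer approximation of a compact convex set by a decreasing sequence of polytopes. -/
theorem exists_polytope_approx (W : Submodule ℝ V) {K : Set V} (hKW : K ⊆ W) (hK : IsCompact K)
    (hKc : Convex ℝ K) :
    ∃ P : ℕ → Set V, Antitone P ∧ ⋂ N, P N = K ∧ (∀ N, IsCompact (P N)) ∧
      ∀ N, ∃ A B S : Finset (V →ₗ[ℝ] ℝ), A.Nonempty ∧ P N = truncatedCone W A B S := by
  classical
  obtain ⟨l, c, hlc⟩ := RCLike.iInter_countable_halfSpaces_eq (𝕜 := ℝ) hKc hK.isClosed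
  let b := Module.finBasis ℝ V
  obtain ⟨R, hR⟩ := (hK.image b.equivFunL.continuous).isBounded.exists_norm_le
  have hbox : IsCompact {y : V | ∀ i, |b.coord i y| ≤ R} := by
    have h1 : IsCompact (Set.univ.pi fun _ : Fin (Module.finrank ℝ V) => Set.Icc (-R) R) :=
      isCompact_univ_pi fun _ => isCompact_Icc
    have h2 := b.equivFunL.symm.toHomeomorph.isCompact_image.mpr h1
    refine h2.of_isClosed_subset ?_ fun y hy => ⟨b.equivFunL y, fun i _ => ?_, by simp⟩
    · simp only [Set.ofPred_forall]
      exact isClosed_iInter fun i => isClosed_le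
        (continuous_abs.comp (b.coord i).continuous_of_finiteDimensional) continuous_const
    · exact abs_le.mp (hy i)
  let T : ℕ → Finset ((V →ₗ[ℝ] ℝ) × ℝ) := fun N =>
    (Finset.range N).image (fun k => ((l k : V →ₗ[ℝ] ℝ), c k)) ∪
      (Finset.univ.image (fun i => (b.coord i, R)) ∪ Finset.univ.image fun i => (-b.coord i, R))
  have hT : ∀ N y, (∀ p ∈ T N, p.1 y ≤ p.2) ↔
      (∀ k < N, l k y ≤ c k) ∧ ∀ i, |b.coord i y| ≤ R := by
    intro N y
    simp only [T, Finset.forall_mem_union, Finset.forall_mem_image, Finset.mem_range,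
      Finset.mem_univ, forall_true_left, LinearMap.neg_apply, abs_le, ContinuousLinearMap.coe_coe,
      ← forall_and, neg_le]
    exact ⟨fun h => ⟨fun k hk => h.1 hk, fun i => (h.2 i).symm⟩,
      fun h => ⟨fun k hk => h.1 k hk, fun i => (h.2 i).symm⟩⟩
  have hin : ∀ y ∈ K, (∀ k, l k y ≤ c k) ∧ ∀ i, |b.coord i y| ≤ R := by
    intro y hy
    refine ⟨fun k => ?_, fun i => ?_⟩
    · rw [← hlc] at hy
      simpa using Set.mem_iInter.mp hy k
    · have := (norm_le_pi_norm (b.equivFunL y) i).trans (hR _ ⟨y, hy, rfl⟩)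
      simpa using this
  refine ⟨fun N => {y | y ∈ W ∧ ∀ p ∈ T N, p.1 y ≤ p.2}, fun M N hMN y hy => ?_, ?_, fun N => ?_,
    fun N => exists_truncatedCone_eq W (T N)⟩
  · refine ⟨hy.1, (hT M y).mpr ?_⟩
    have := (hT N y).mp hy.2
    exact ⟨fun k hk => this.1 k (hk.trans_le hMN), this.2⟩
  · ext y
    simp only [Set.mem_iInter, Set.mem_ofPred_eq, hT]
    constructor
    · intro h
      rw [← hlc]
      simpa using fun k => (h (k + 1)).2.1 k k.lt_succ_self
    · exact fun hy N => ⟨hKW hy, fun k _ => (hin y hy).1 k, (hin y hy).2⟩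
  · obtain ⟨A, B, S, -, h⟩ := exists_truncatedCone_eq W (T N)
    refine hbox.of_isClosed_subset ?_ fun y hy => ((hT N y).mp hy.2).2
    have hc := isClosed_truncatedCone W A B S
    rwa [← h] at hc

/-- A valuation that is continuous along decreasing sequences is determined by its values at the
simplices with linearly independent vertices and at their convex hulls with the origin. -/
theorem IsSetValuation.eq_zero {f : Set V → ℝ} (hf : IsSetValuation f)
    (h₀ : ∀ v : Set V, LinearIndepOn ℝ id v → f (convexHull ℝ v) = 0)
    (h₁ : ∀ v : Set V, LinearIndepOn ℝ id v → f (convexHull ℝ ({0} ∪ v)) = 0)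
    (hcont : ∀ (P : ℕ → Set V), Antitone P → (∀ N, IsCompact (P N)) → (∀ N, Convex ℝ (P N)) →
      (⋂ N, P N).Nonempty → (∀ N, f (P N) = 0) → f (⋂ N, P N) = 0)
    {K : Set V} (hK : IsCompact K) (hKc : Convex ℝ K) : f K = 0 := by
  suffices h : ∀ (k : ℕ) (W : Submodule ℝ V), Module.finrank ℝ W < k → ∀ K : Set V, K ⊆ W →
      IsCompact K → Convex ℝ K → f K = 0 from
    h _ ⊤ (Nat.lt_succ_self _) K (by simp) hK hKc
  intro k
  induction k with
  | zero => exact fun W hW => absurd hW (Nat.not_lt_zero _)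
  | succ k ih =>
    intro W hW K hKW hK hKc
    have hlow : VanishesBelow f W := fun W' hW' =>
      ih W' ((Submodule.finrank_lt_finrank_of_lt hW').trans_le (Nat.lt_succ_iff.mp hW))
    rcases K.eq_empty_or_nonempty with rfl | hne
    · exact hf.empty
    obtain ⟨P, hanti, hP, hcomp, hpoly⟩ := exists_polytope_approx W hKW hK hKc
    rw [← hP]
    refine hcont P hanti hcomp (fun N => ?_) (hP ▸ hne) fun N => ?_
    · obtain ⟨A, B, S, -, h⟩ := hpoly N
      rw [h]
      exact convex_truncatedCone W A B S
    · obtain ⟨A, B, S, hA, h⟩ := hpoly N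
      have := hcomp N
      rw [h] at this ⊢
      exact hf.polytope_eq_zero hlow h₀ h₁ hA this

end SetValuation

/-! ### Support functions -/

variable {n : ℕ}

/-- The support function `h(K, x) = max {⟨x, z⟩ : z ∈ K}`. -/
def supportFn (K : ConvexBody (E n)) (x : E n) : ℝ :=
  sSup ((fun z : E n => inner ℝ x z) '' (K : Set (E n)))

theorem isGreatest_supportFn (K : ConvexBody (E n)) (x : E n) :
    IsGreatest ((fun z : E n => inner ℝ x z) '' (K : Set (E n))) (supportFn K x) :=
  (K.isCompact.image (continuous_const.inner continuous_id)).isGreatest_sSup (K.nonempty.image _)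

theorem inner_le_supportFn {K : ConvexBody (E n)} {z : E n} (hz : z ∈ (K : Set (E n))) (x : E n) :
    inner ℝ x z ≤ supportFn K x :=
  (isGreatest_supportFn K x).2 ⟨z, hz, rfl⟩

theorem exists_inner_eq_supportFn (K : ConvexBody (E n)) (x : E n) :
    ∃ z ∈ (K : Set (E n)), inner ℝ x z = supportFn K x :=
  (isGreatest_supportFn K x).1

theorem supportFn_le {K : ConvexBody (E n)} {x : E n} {c : ℝ}
    (h : ∀ z ∈ (K : Set (E n)), inner ℝ x z ≤ c) : supportFn K x ≤ c := by
  obtain ⟨z, hz, h'⟩ := exists_inner_eq_supportFn K x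
  exact h' ▸ h z hz

theorem supportFn_add (K L : ConvexBody (E n)) (x : E n) :
    supportFn (K + L) x = supportFn K x + supportFn L x := by
  apply le_antisymm
  · refine supportFn_le fun z hz => ?_
    obtain ⟨a, ha, b, hb, rfl⟩ := hz
    simp only [inner_add_right]
    exact add_le_add (inner_le_supportFn ha x) (inner_le_supportFn hb x)
  · obtain ⟨a, ha, ha'⟩ := exists_inner_eq_supportFn K x
    obtain ⟨b, hb, hb'⟩ := exists_inner_eq_supportFn L x
    rw [← ha', ← hb', ← inner_add_right]
    exact inner_le_supportFn (show a + b ∈ ((K + L : ConvexBody (E n)) : Set (E n)) from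
      Set.add_mem_add ha hb) x

theorem supportFn_linImage (φ : E n →ₗ[ℝ] E n) (K : ConvexBody (E n)) {x x' : E n}
    (h : ∀ y : E n, (inner ℝ x (φ y) : ℝ) = inner ℝ x' y) :
    supportFn (linImage φ K) x = supportFn K x' := by
  apply le_antisymm
  · refine supportFn_le fun z hz => ?_
    obtain ⟨y, hy, rfl⟩ := hz
    rw [h]
    exact inner_le_supportFn hy x'
  · refine supportFn_le fun z hz => ?_
    rw [← h]
    exact inner_le_supportFn (show φ z ∈ (linImage φ K : Set (E n)) from ⟨z, hz, rfl⟩) x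

theorem supportFn_smul (a : ℝ) (K : ConvexBody (E n)) (x : E n) :
    supportFn (a • K) x = supportFn K (a • x) := by
  have h : a • K = linImage (a • LinearMap.id) K := ConvexBody.ext rfl
  rw [h]
  exact supportFn_linImage _ _ fun y => by simp [inner_smul_left, inner_smul_right]

theorem supportFn_point (p x : E n) : supportFn (point p) x = inner ℝ x p := by
  refine le_antisymm (supportFn_le fun z hz => ?_) (inner_le_supportFn rfl x)
  rw [show z = p from hz]

theorem supportFn_hullZero (K : ConvexBody (E n)) (x : E n) :
    supportFn (hullZero K) x = max 0 (supportFn K x) := by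
  apply le_antisymm
  · refine supportFn_le fun z hz => ?_
    have hsub : convexHull ℝ (insert 0 (K : Set (E n))) ⊆
        {z | inner ℝ x z ≤ max 0 (supportFn K x)} := by
      refine convexHull_min (Set.insert_subset ?_ fun y hy => ?_)
        (convex_halfSpace_le (innerₛₗ ℝ x).isLinear _)
      · simp
      · exact (inner_le_supportFn hy x).trans (le_max_right _ _)
    exact hsub hz
  · refine max_le ?_ (supportFn_le fun z hz => inner_le_supportFn
      (show z ∈ (hullZero K : Set (E n)) from subset_convexHull ℝ _ (Or.inr hz)) x)
    have := inner_le_supportFn (show (0 : E n) ∈ (hullZero K : Set (E n)) from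
      subset_convexHull ℝ _ (Or.inl rfl)) x
    simpa using this

theorem supportFn_momentBodyOf {A : Set (E n)} (hb : Bornology.IsBounded A) (x : E n) :
    supportFn (momentBodyOf A) x = ∫ y in A, |inner ℝ x y| :=
  (isGreatest_supportFn _ x).unique (isGreatest_momentBodyOf hb x)

theorem supportFn_add_le (K : ConvexBody (E n)) (x y : E n) :
    supportFn K (x + y) ≤ supportFn K x + supportFn K y :=
  supportFn_le fun z hz => by
    rw [inner_add_left]
    exact add_le_add (inner_le_supportFn hz x) (inner_le_supportFn hz y)

theorem supportFn_zero (K : ConvexBody (E n)) : supportFn K 0 = 0 := by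
  obtain ⟨z, -, h⟩ := exists_inner_eq_supportFn K 0
  simpa using h.symm

theorem supportFn_pos_smul (K : ConvexBody (E n)) (x : E n) {t : ℝ} (ht : 0 ≤ t) :
    supportFn K (t • x) = t * supportFn K x := by
  obtain ⟨z, hz, h⟩ := exists_inner_eq_supportFn K (t • x)
  obtain ⟨w, hw, h'⟩ := exists_inner_eq_supportFn K x
  apply le_antisymm
  · rw [← h, inner_smul_left]
    exact mul_le_mul_of_nonneg_left (inner_le_supportFn hz x) ht
  · have := inner_le_supportFn hw (t • x)
    rw [inner_smul_left] at this
    rw [← h']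
    exact this

theorem subset_of_supportFn_le {K L : ConvexBody (E n)}
    (h : ∀ x, supportFn K x ≤ supportFn L x) : (K : Set (E n)) ⊆ L := by
  intro z hz
  by_contra hzL
  obtain ⟨f, u, hf, hu⟩ := geometric_hahn_banach_closed_point L.convex L.isClosed hzL
  have hin : ∀ y, inner ℝ ((InnerProductSpace.toDual ℝ (E n)).symm f) y = f y := fun y =>
    InnerProductSpace.toDual_symm_apply
  have h1 := (inner_le_supportFn hz _).trans (h ((InnerProductSpace.toDual ℝ (E n)).symm f))
  have h2 : supportFn L ((InnerProductSpace.toDual ℝ (E n)).symm f) ≤ u :=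
    supportFn_le fun y hy => (hin y).trans_le (hf y hy).le
  rw [hin] at h1
  linarith

theorem ext_supportFn {K L : ConvexBody (E n)} (h : ∀ x, supportFn K x = supportFn L x) : K = L :=
  ConvexBody.ext ((subset_of_supportFn_le fun x => (h x).le).antisymm
    (subset_of_supportFn_le fun x => (h x).ge))

theorem abs_supportFn_sub_le (K L : ConvexBody (E n)) (x : E n) :
    |supportFn K x - supportFn L x| ≤ dist K L * ‖x‖ := by
  have key : ∀ K L : ConvexBody (E n), supportFn K x - supportFn L x ≤ dist K L * ‖x‖ := by
    intro K L
    refine le_of_forall_pos_le_add fun ε hε => ?_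
    obtain ⟨z, hz, h⟩ := exists_inner_eq_supportFn K x
    obtain ⟨y, hy, hzy⟩ := Metric.exists_dist_lt_of_hausdorffDist_lt hz
      (show Metric.hausdorffDist (K : Set (E n)) L < dist K L + ε / (‖x‖ + 1) from
        lt_add_of_pos_right _ (by positivity)) ConvexBody.hausdorffEDist_ne_top
    have h1 : inner ℝ x z - inner ℝ x y ≤ ‖x‖ * dist z y := by
      rw [← inner_sub_right, dist_eq_norm]
      exact real_inner_le_norm _ _
    have h2 : ‖x‖ * dist z y ≤ ‖x‖ * (dist K L + ε / (‖x‖ + 1)) := by gcongr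
    have h3 : ‖x‖ * (ε / (‖x‖ + 1)) ≤ ε := by
      rw [mul_div_assoc', div_le_iff₀ (by positivity)]
      nlinarith [norm_nonneg x]
    have h4 := inner_le_supportFn hy x
    nlinarith
  rw [abs_le]
  constructor
  · have := key L K
    rw [dist_comm] at this
    linarith
  · exact key K L

theorem dist_le_of_supportFn {K L : ConvexBody (E n)} {ε : ℝ} (hε : 0 ≤ ε)
    (h : ∀ x, |supportFn K x - supportFn L x| ≤ ε * ‖x‖) : dist K L ≤ ε := by
  have key : ∀ K L : ConvexBody (E n), (∀ x, supportFn K x - supportFn L x ≤ ε * ‖x‖) →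
      ∀ z ∈ (K : Set (E n)), ∃ y ∈ (L : Set (E n)), dist z y ≤ ε := by
    intro K L h z hz
    let B : ConvexBody (E n) := ⟨Metric.closedBall 0 ε, convex_closedBall 0 ε,
      isCompact_closedBall 0 ε, Metric.nonempty_closedBall.mpr hε⟩
    have hB : ∀ x, ε * ‖x‖ ≤ supportFn B x := by
      intro x
      rcases eq_or_ne x 0 with rfl | hx
      · simp [supportFn_zero]
      have hx' : 0 < ‖x‖ := norm_pos_iff.mpr hx
      have hmem : (ε / ‖x‖) • x ∈ (B : Set (E n)) := by
        change _ ∈ Metric.closedBall (0 : E n) ε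
        rw [mem_closedBall_zero_iff, norm_smul, Real.norm_of_nonneg (by positivity),
          div_mul_cancel₀ _ hx'.ne']
      refine le_trans (le_of_eq ?_) (inner_le_supportFn hmem x)
      rw [inner_smul_right, real_inner_self_eq_norm_sq]
      field_simp
    have hsub : (K : Set (E n)) ⊆ (L + B : ConvexBody (E n)) :=
      subset_of_supportFn_le fun x => by
        rw [supportFn_add]
        linarith [h x, hB x]
    obtain ⟨y, hy, b, hb, rfl⟩ := hsub hz
    refine ⟨y, hy, ?_⟩
    have hb' : ‖b‖ ≤ ε := mem_closedBall_zero_iff.mp hb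
    simpa using hb'
  refine Metric.hausdorffDist_le_of_mem_dist hε (key K L fun x => (le_abs_self _).trans (h x))
    fun z hz => ?_
  exact key L K (fun x => by
    have := neg_abs_le (supportFn K x - supportFn L x)
    linarith [h x]) z hz

theorem continuous_supportFn (K : ConvexBody (E n)) : Continuous (supportFn K) := by
  obtain ⟨R, hR⟩ := K.isBounded.exists_norm_le
  have key : ∀ x y, supportFn K x - supportFn K y ≤ R * ‖x - y‖ := by
    intro x y
    obtain ⟨z, hz, h⟩ := exists_inner_eq_supportFn K x
    have h1 := inner_le_supportFn hz y
    have h2 : inner ℝ x z - inner ℝ y z ≤ ‖x - y‖ * ‖z‖ := by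
      rw [← inner_sub_left]
      exact real_inner_le_norm _ _
    have h3 : ‖x - y‖ * ‖z‖ ≤ ‖x - y‖ * R := by gcongr; exact hR z hz
    linarith
  refine (LipschitzWith.of_dist_le' (K := R) fun x y => ?_).continuous
  rw [Real.dist_eq, dist_eq_norm, abs_le]
  refine ⟨?_, key x y⟩
  have := key y x
  rw [norm_sub_rev] at this
  linarith

/-- If `K ∪ L` is convex, then `h(K ∪ L) = max (h(K), h(L))` and `h(K ∩ L) = min (h(K), h(L))`. -/
theorem supportFn_union_inter {K L U I : ConvexBody (E n)}
    (hU : (U : Set (E n)) = (K : Set (E n)) ∪ L) (hI : (I : Set (E n)) = (K : Set (E n)) ∩ L)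
    (x : E n) : supportFn U x = max (supportFn K x) (supportFn L x) ∧
      supportFn I x = min (supportFn K x) (supportFn L x) := by
  constructor
  · apply le_antisymm
    · refine supportFn_le fun z hz => ?_
      rw [hU] at hz
      rcases hz with hz | hz
      · exact (inner_le_supportFn hz x).trans (le_max_left _ _)
      · exact (inner_le_supportFn hz x).trans (le_max_right _ _)
    · exact max_le (supportFn_le fun z hz => inner_le_supportFn (hU ▸ Or.inl hz) x)
        (supportFn_le fun z hz => inner_le_supportFn (hU ▸ Or.inr hz) x)
  · apply le_antisymm
    · refine supportFn_le fun z hz => ?_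
      rw [hI] at hz
      exact le_min (inner_le_supportFn hz.1 x) (inner_le_supportFn hz.2 x)
    · obtain ⟨y, hy, hy'⟩ := exists_inner_eq_supportFn K x
      obtain ⟨z, hz, hz'⟩ := exists_inner_eq_supportFn L x
      -- The segment joining maximisers in `K` and in `L` meets `K ∩ L`, by connectedness.
      have hseg : segment ℝ y z ⊆ (K : Set (E n)) ∪ L := by
        rw [← hU]
        exact U.convex.segment_subset (hU ▸ Or.inl hy) (hU ▸ Or.inr hz)
      obtain ⟨w, hw, hwK, hwL⟩ := isPreconnected_closed_iff.mp
        (convex_segment y z).isPreconnected K L K.isClosed L.isClosed hseg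
        ⟨y, left_mem_segment ℝ y z, hy⟩ ⟨z, right_mem_segment ℝ y z, hz⟩
      have hwI : w ∈ (I : Set (E n)) := by
        rw [hI]
        exact ⟨hwK, hwL⟩
      refine le_trans ?_ (inner_le_supportFn hwI x)
      obtain ⟨a, b, ha, hb, hab, rfl⟩ := hw
      rw [inner_add_right, inner_smul_right, inner_smul_right, hy', hz']
      have h1 := min_le_left (supportFn K x) (supportFn L x)
      have h2 := min_le_right (supportFn K x) (supportFn L x)
      calc min (supportFn K x) (supportFn L x)
          = a * min (supportFn K x) (supportFn L x) + b * min (supportFn K x) (supportFn L x) := by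
            rw [← add_mul, hab, one_mul]
        _ ≤ _ := by gcongr

/-! ### Covariant families -/

open Filter Topology in
/-- The properties of `F K x = h(Φ K, x)` for a continuous Minkowski valuation `Φ` that satisfies
`Φ (φ K) = |det φ|^q φ (Φ K)`, with the sublinearity in `x` dropped so that they are
preserved by differences. The hypothesis on `x'` says that `x' = φᵀ x`. -/
structure IsCovariantFamily (q : ℝ) (F : ConvexBody (E n) → E n → ℝ) : Prop where
  continuous_apply : ∀ K, Continuous (F K)
  eventually_le : ∀ K₀, ∀ ε > 0, ∀ᶠ K in 𝓝 K₀, ∀ x, |F K x - F K₀ x| ≤ ε * ‖x‖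
  union_inter : ∀ K L U I : ConvexBody (E n), (U : Set (E n)) = (K : Set (E n)) ∪ L →
    (I : Set (E n)) = (K : Set (E n)) ∩ L → ∀ x, F K x + F L x = F U x + F I x
  map_linImage : ∀ (φ : E n ≃ₗ[ℝ] E n) (K : ConvexBody (E n)) (x x' : E n),
    (∀ y, (inner ℝ x (φ y) : ℝ) = inner ℝ x' y) →
      F (linImage (φ : E n →ₗ[ℝ] E n) K) x = |LinearMap.det (φ : E n →ₗ[ℝ] E n)| ^ q * F K x'

theorem isCovariantFamily_supportFn_iff {q : ℝ} {Φ : ConvexBody (E n) → ConvexBody (E n)} :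
    IsCovariantFamily q (fun K => supportFn (Φ K)) ↔
      Continuous Φ ∧ (∀ (φ : E n ≃ₗ[ℝ] E n) (K : ConvexBody (E n)),
        Φ (linImage (φ : E n →ₗ[ℝ] E n) K) =
          (|LinearMap.det (φ : E n →ₗ[ℝ] E n)| ^ q) • linImage (φ : E n →ₗ[ℝ] E n) (Φ K)) ∧
      IsMinkowskiValuation Φ := by
  have hq : ∀ (φ : E n ≃ₗ[ℝ] E n) (K : ConvexBody (E n)) (x x' : E n),
      (∀ y, (inner ℝ x (φ y) : ℝ) = inner ℝ x' y) →
      supportFn ((|LinearMap.det (φ : E n →ₗ[ℝ] E n)| ^ q) • linImage (φ : E n →ₗ[ℝ] E n) (Φ K)) x =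
        |LinearMap.det (φ : E n →ₗ[ℝ] E n)| ^ q * supportFn (Φ K) x' := by
    intro φ K x x' h
    rw [supportFn_smul, supportFn_pos_smul _ _ (by positivity),
      supportFn_linImage (φ : E n →ₗ[ℝ] E n) (Φ K) h]
  constructor
  · intro h
    refine ⟨Metric.continuous_iff'.mpr fun K₀ ε hε => ?_, fun φ K => ?_, fun K L U I hU hI => ?_⟩
    · filter_upwards [h.eventually_le K₀ (ε / 2) (half_pos hε)] with K hK
      exact (dist_le_of_supportFn (half_pos hε).le hK).trans_lt (half_lt_self hε)
    · refine ext_supportFn fun x => ?_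
      have hx : ∀ y, (inner ℝ x (φ y) : ℝ) =
          inner ℝ (LinearMap.adjoint (φ : E n →ₗ[ℝ] E n) x) y := fun y =>
        (LinearMap.adjoint_inner_left (φ : E n →ₗ[ℝ] E n) y x).symm
      rw [hq φ K x _ hx]
      exact h.map_linImage φ K x _ hx
    · refine ext_supportFn fun x => ?_
      rw [supportFn_add, supportFn_add]
      exact h.union_inter K L U I hU hI x
  · rintro ⟨hc, he, hv⟩
    refine ⟨fun K => continuous_supportFn _, fun K₀ ε hε => ?_, fun K L U I hU hI x => ?_,
      fun φ K x x' hx => ?_⟩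
    · filter_upwards [Metric.continuous_iff'.mp hc K₀ ε hε] with K hK x
      exact (abs_supportFn_sub_le _ _ x).trans (by gcongr)
    · rw [← supportFn_add, ← supportFn_add, hv K L U I hU hI]
    · simp only [he]
      exact hq φ K x x' hx

namespace IsCovariantFamily

variable {q : ℝ} {F G : ConvexBody (E n) → E n → ℝ}

theorem add (hF : IsCovariantFamily q F) (hG : IsCovariantFamily q G) :
    IsCovariantFamily q (fun K x => F K x + G K x) where
  continuous_apply K := (hF.continuous_apply K).add (hG.continuous_apply K)
  eventually_le K₀ ε hε := by
    filter_upwards [hF.eventually_le K₀ (ε / 2) (half_pos hε),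
      hG.eventually_le K₀ (ε / 2) (half_pos hε)] with K h1 h2 x
    calc |F K x + G K x - (F K₀ x + G K₀ x)|
        = |(F K x - F K₀ x) + (G K x - G K₀ x)| := by ring_nf
      _ ≤ |F K x - F K₀ x| + |G K x - G K₀ x| := abs_add_le _ _
      _ ≤ ε / 2 * ‖x‖ + ε / 2 * ‖x‖ := add_le_add (h1 x) (h2 x)
      _ = ε * ‖x‖ := by ring
  union_inter K L U I hU hI x := by
    linarith [hF.union_inter K L U I hU hI x, hG.union_inter K L U I hU hI x]
  map_linImage φ K x x' h := by
    rw [hF.map_linImage φ K x x' h, hG.map_linImage φ K x x' h, mul_add]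

theorem const_mul (hF : IsCovariantFamily q F) (a : ℝ) :
    IsCovariantFamily q (fun K x => a * F K x) where
  continuous_apply K := (hF.continuous_apply K).const_mul a
  eventually_le K₀ ε hε := by
    filter_upwards [hF.eventually_le K₀ (ε / (|a| + 1)) (by positivity)] with K h x
    rw [← mul_sub, abs_mul]
    calc |a| * |F K x - F K₀ x| ≤ |a| * (ε / (|a| + 1) * ‖x‖) := by gcongr; exact h x
      _ = (|a| / (|a| + 1)) * (ε * ‖x‖) := by ring
      _ ≤ 1 * (ε * ‖x‖) := by
        gcongr
        rw [div_le_one (by positivity)]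
        linarith
      _ = ε * ‖x‖ := one_mul _
  union_inter K L U I hU hI x := by
    rw [← mul_add, hF.union_inter K L U I hU hI x, mul_add]
  map_linImage φ K x x' h := by
    rw [hF.map_linImage φ K x x' h]
    ring

theorem sub (hF : IsCovariantFamily q F) (hG : IsCovariantFamily q G) :
    IsCovariantFamily q (fun K x => F K x - G K x) := by
  have := hF.add (hG.const_mul (-1))
  simpa only [neg_one_mul, ← sub_eq_add_neg] using this

theorem comp_neg (hF : IsCovariantFamily q F) : IsCovariantFamily q (fun K x => F K (-x)) where
  continuous_apply K := (hF.continuous_apply K).comp continuous_neg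
  eventually_le K₀ ε hε := by
    filter_upwards [hF.eventually_le K₀ ε hε] with K h x
    simpa using h (-x)
  union_inter K L U I hU hI x := hF.union_inter K L U I hU hI (-x)
  map_linImage φ K x x' h :=
    hF.map_linImage φ K (-x) (-x') fun y => by simp [inner_neg_left, h]

end IsCovariantFamily

theorem mem_hullZero {K : ConvexBody (E n)} {y : E n} :
    y ∈ (hullZero K : Set (E n)) ↔ ∃ t : ℝ, 0 ≤ t ∧ t ≤ 1 ∧ ∃ z ∈ (K : Set (E n)), y = t • z := by
  constructor
  · exact fun hy => exists_smul_of_mem_convexHull_zero_union K.convex K.nonempty hy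
  · rintro ⟨t, h0, h1, z, hz, rfl⟩
    exact smul_mem_convexHull_zero_union hz h0 h1

theorem zero_mem_hullZero (K : ConvexBody (E n)) : (0 : E n) ∈ (hullZero K : Set (E n)) :=
  subset_convexHull ℝ _ (Or.inl rfl)

theorem subset_hullZero (K : ConvexBody (E n)) : (K : Set (E n)) ⊆ hullZero K :=
  (Set.subset_insert _ _).trans (subset_convexHull ℝ _)

theorem dist_hullZero_le (K L : ConvexBody (E n)) : dist (hullZero K) (hullZero L) ≤ dist K L :=
  dist_le_of_supportFn dist_nonneg fun x => by
    rw [supportFn_hullZero, supportFn_hullZero, max_comm, max_comm (0 : ℝ)]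
    exact (abs_max_sub_max_le_abs _ _ _).trans (abs_supportFn_sub_le K L x)

theorem continuous_hullZero : Continuous (hullZero : ConvexBody (E n) → ConvexBody (E n)) :=
  (LipschitzWith.of_dist_le_mul (K := 1) fun K L => by
    simpa using dist_hullZero_le K L).continuous

theorem linImage_hullZero (φ : E n →ₗ[ℝ] E n) (K : ConvexBody (E n)) :
    hullZero (linImage φ K) = linImage φ (hullZero K) := by
  refine ConvexBody.ext ?_
  change convexHull ℝ (insert 0 (φ '' (K : Set (E n)))) = φ '' convexHull ℝ (insert 0 (K : Set (E n)))
  rw [φ.image_convexHull, Set.image_insert_eq, map_zero]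

theorem coe_hullZero_union {K L U : ConvexBody (E n)}
    (hU : (U : Set (E n)) = (K : Set (E n)) ∪ L) :
    (hullZero U : Set (E n)) = (hullZero K : Set (E n)) ∪ hullZero L := by
  ext y
  simp only [Set.mem_union, mem_hullZero, hU]
  constructor
  · rintro ⟨t, h0, h1, z, hz | hz, rfl⟩
    exacts [Or.inl ⟨t, h0, h1, z, hz, rfl⟩, Or.inr ⟨t, h0, h1, z, hz, rfl⟩]
  · rintro (⟨t, h0, h1, z, hz, rfl⟩ | ⟨t, h0, h1, z, hz, rfl⟩)
    exacts [⟨t, h0, h1, z, Or.inl hz, rfl⟩, ⟨t, h0, h1, z, Or.inr hz, rfl⟩]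

theorem coe_hullZero_inter {K L U I : ConvexBody (E n)}
    (hU : (U : Set (E n)) = (K : Set (E n)) ∪ L) (hI : (I : Set (E n)) = (K : Set (E n)) ∩ L) :
    (hullZero I : Set (E n)) = (hullZero K : Set (E n)) ∩ hullZero L := by
  refine Set.Subset.antisymm (fun y hy => ?_) fun y hy => ?_
  · obtain ⟨t, h0, h1, z, hz, rfl⟩ := mem_hullZero.mp hy
    rw [hI] at hz
    exact ⟨mem_hullZero.mpr ⟨t, h0, h1, z, hz.1, rfl⟩, mem_hullZero.mpr ⟨t, h0, h1, z, hz.2, rfl⟩⟩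
  · rcases eq_or_ne y 0 with rfl | hy0
    · exact zero_mem_hullZero I
    obtain ⟨⟨t, ht0, ht1, a, ha, hya⟩, ⟨s, hs0, hs1, b, hb, hyb⟩⟩ :=
      And.intro (mem_hullZero.mp hy.1) (mem_hullZero.mp hy.2)
    have ht : 0 < t := ht0.lt_of_ne fun h => hy0 (by simp [hya, ← h])
    have hs : 0 < s := hs0.lt_of_ne fun h => hy0 (by simp [hyb, ← h])
    have ha' : a = t⁻¹ • y := by rw [hya, smul_smul, inv_mul_cancel₀ ht.ne', one_smul]
    have hb' : b = s⁻¹ • y := by rw [hyb, smul_smul, inv_mul_cancel₀ hs.ne', one_smul]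
    -- A point of `K ∩ L` on the segment from `a` to `b` lies on the ray through `y`, beyond `y`.
    have hseg : segment ℝ a b ⊆ (K : Set (E n)) ∪ L := by
      rw [← hU]
      exact U.convex.segment_subset (hU ▸ Or.inl ha) (hU ▸ Or.inr hb)
    obtain ⟨w, hw, hwK, hwL⟩ := isPreconnected_closed_iff.mp
      (convex_segment a b).isPreconnected K L K.isClosed L.isClosed hseg
      ⟨a, left_mem_segment ℝ a b, ha⟩ ⟨b, right_mem_segment ℝ a b, hb⟩
    obtain ⟨α, β, hα, hβ, hαβ, rfl⟩ := hw
    set μ := α * t⁻¹ + β * s⁻¹ with hμ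
    have hμ1 : 1 ≤ μ := by
      have h1 := (one_le_inv₀ ht).mpr ht1
      have h2 := (one_le_inv₀ hs).mpr hs1
      nlinarith
    have hwy : α • a + β • b = μ • y := by
      rw [ha', hb', smul_smul, smul_smul, ← add_smul]
    have hwI : μ • y ∈ (I : Set (E n)) := by
      rw [hI, ← hwy]
      exact ⟨hwK, hwL⟩
    have hμ0 : 0 < μ := by linarith
    refine mem_hullZero.mpr ⟨μ⁻¹, by positivity, inv_le_one_of_one_le₀ hμ1, _, hwI, ?_⟩
    rw [smul_smul, inv_mul_cancel₀ hμ0.ne', one_smul]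

theorem IsCovariantFamily.comp_hullZero {q : ℝ} {F : ConvexBody (E n) → E n → ℝ}
    (hF : IsCovariantFamily q F) : IsCovariantFamily q (fun K => F (hullZero K)) where
  continuous_apply K := hF.continuous_apply _
  eventually_le K₀ ε hε := continuous_hullZero.continuousAt.eventually
    (hF.eventually_le (hullZero K₀) ε hε)
  union_inter K L U I hU hI := hF.union_inter _ _ _ _ (coe_hullZero_union hU)
    (coe_hullZero_inter hU hI)
  map_linImage φ K x x' h := by
    rw [linImage_hullZero]
    exact hF.map_linImage φ _ x x' h

theorem isCovariantFamily_supportFn :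
    IsCovariantFamily 0 (supportFn : ConvexBody (E n) → E n → ℝ) := by
  have h : IsCovariantFamily 0 (fun K : ConvexBody (E n) => supportFn (id K)) := by
    refine isCovariantFamily_supportFn_iff.mpr ⟨continuous_id, fun φ K => ?_,
      fun K L U I hU hI => ?_⟩
    · refine ext_supportFn fun x => ?_
      rw [supportFn_smul]
      simp
    · refine ext_supportFn fun x => ?_
      rw [supportFn_add, supportFn_add]
      obtain ⟨h1, h2⟩ := supportFn_union_inter hU hI x
      simp only [id, h1, h2, max_add_min]
  exact h

/-! ### Moment integrals -/

theorem closedBall_subset_of_dist_le {K L : ConvexBody (E n)} {y : E n} {r : ℝ} (hr : 0 ≤ r)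
    (hy : Metric.closedBall y r ⊆ (K : Set (E n))) (h : dist L K ≤ r) : y ∈ (L : Set (E n)) := by
  have : (point y : Set (E n)) ⊆ L := by
    refine subset_of_supportFn_le fun x => ?_
    rw [supportFn_point]
    have h1 := (abs_le.mp (abs_supportFn_sub_le L K x)).1
    have h2 : inner ℝ x y + r * ‖x‖ ≤ supportFn K x := by
      rcases eq_or_ne x 0 with rfl | hx
      · simp [supportFn_zero]
      have hx' : 0 < ‖x‖ := norm_pos_iff.mpr hx
      have hmem : y + (r / ‖x‖) • x ∈ (K : Set (E n)) := by
        refine hy ?_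
        rw [mem_closedBall_iff_norm, add_sub_cancel_left, norm_smul,
          Real.norm_of_nonneg (by positivity), div_mul_cancel₀ _ hx'.ne']
      refine le_trans (le_of_eq ?_) (inner_le_supportFn hmem x)
      rw [inner_add_right, inner_smul_right, real_inner_self_eq_norm_sq]
      field_simp
    have h3 : dist L K * ‖x‖ ≤ r * ‖x‖ := by gcongr
    linarith
  exact this rfl

open Filter Topology in
/-- A point off the boundary of `K₀` lies in all or in none of the bodies close to `K₀`. -/
theorem eventually_mem_iff {K₀ : ConvexBody (E n)} {y : E n}
    (hy : y ∉ frontier (K₀ : Set (E n))) :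
    ∀ᶠ K : ConvexBody (E n) in 𝓝 K₀, (y ∈ (K : Set (E n)) ↔ y ∈ (K₀ : Set (E n))) := by
  by_cases hyK : y ∈ (K₀ : Set (E n))
  · have hint : y ∈ interior (K₀ : Set (E n)) := by
      by_contra h
      exact hy ⟨subset_closure hyK, h⟩
    obtain ⟨r, hr, hball⟩ :=
      Metric.nhds_basis_closedBall.mem_iff.mp (mem_interior_iff_mem_nhds.mp hint)
    filter_upwards [Metric.ball_mem_nhds K₀ hr] with K hK
    exact iff_of_true (closedBall_subset_of_dist_le hr.le hball hK.le) hyK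
  · have hpos : 0 < Metric.infDist y (K₀ : Set (E n)) :=
      (K₀.isClosed.notMem_iff_infDist_pos K₀.nonempty).mp hyK
    filter_upwards [Metric.ball_mem_nhds K₀ hpos] with K hK
    refine iff_of_false (fun hmem => ?_) hyK
    obtain ⟨z, hz, hyz⟩ := Metric.exists_dist_lt_of_hausdorffDist_lt hmem
      (show Metric.hausdorffDist (K : Set (E n)) K₀ < Metric.infDist y (K₀ : Set (E n)) from hK)
      ConvexBody.hausdorffEDist_ne_top
    exact absurd (Metric.infDist_le_dist_of_mem hz) (not_le.mpr hyz)

open Filter Topology in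
/-- By dominated convergence, since the boundary of a convex body is a null set. -/
theorem tendsto_integral_abs_indicator_sub (K₀ : ConvexBody (E n)) :
    Tendsto (fun K : ConvexBody (E n) => ∫ y, |(K : Set (E n)).indicator (fun _ => (1 : ℝ)) y -
      (K₀ : Set (E n)).indicator (fun _ => (1 : ℝ)) y| * ‖y‖) (𝓝 K₀) (𝓝 0) := by
  obtain ⟨R, hR⟩ := K₀.isBounded.exists_norm_le
  have hlim := tendsto_integral_filter_of_dominated_convergence (μ := volume) (l := 𝓝 K₀)
    (F := fun (K : ConvexBody (E n)) y => |(K : Set (E n)).indicator (fun _ => (1 : ℝ)) y -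
      (K₀ : Set (E n)).indicator (fun _ => (1 : ℝ)) y| * ‖y‖) (f := fun _ => 0)
    ((Metric.closedBall (0 : E n) (R + 1)).indicator fun y => ‖y‖) ?_ ?_ ?_ ?_
  · simpa using hlim
  · refine Eventually.of_forall fun K => Measurable.aestronglyMeasurable ?_
    exact (continuous_abs.measurable.comp
      ((measurable_const.indicator K.isClosed.measurableSet).sub
        (measurable_const.indicator K₀.isClosed.measurableSet))).mul measurable_norm
  · filter_upwards [Metric.ball_mem_nhds K₀ one_pos] with K hK
    refine Eventually.of_forall fun y => ?_
    have hKR : ∀ z ∈ (K : Set (E n)), ‖z‖ ≤ R + 1 := by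
      intro z hz
      obtain ⟨w, hw, hzw⟩ := Metric.exists_dist_lt_of_hausdorffDist_lt hz
        (show Metric.hausdorffDist (K : Set (E n)) K₀ < 1 from hK)
        ConvexBody.hausdorffEDist_ne_top
      have := norm_le_norm_add_norm_sub w z
      rw [dist_comm, dist_eq_norm] at hzw
      rw [norm_sub_rev] at this
      rw [norm_sub_rev] at hzw
      linarith [hR w hw]
    by_cases hy : y ∈ Metric.closedBall (0 : E n) (R + 1)
    · rw [Set.indicator_of_mem hy, norm_mul, norm_norm, Real.norm_eq_abs, abs_abs]
      refine mul_le_of_le_one_left (norm_nonneg y) ?_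
      by_cases h1 : y ∈ (K : Set (E n)) <;> by_cases h2 : y ∈ (K₀ : Set (E n)) <;>
        simp [h1, h2]
    · have hy' : R + 1 < ‖y‖ := by simpa using hy
      have h1 : y ∉ (K : Set (E n)) := fun h => absurd (hKR y h) (not_le.mpr hy')
      have h2 : y ∉ (K₀ : Set (E n)) := fun h => by linarith [hR y h]
      simp [h1, h2, Set.indicator_of_notMem hy]
  · rw [integrable_indicator_iff Metric.isClosed_closedBall.measurableSet]
    exact continuous_norm.continuousOn.integrableOn_compact (isCompact_closedBall _ _)
  · have hnull : volume (frontier (K₀ : Set (E n))) = 0 := K₀.convex.addHaar_frontier volume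
    filter_upwards [measure_eq_zero_iff_ae_notMem.mp hnull] with y hy
    refine tendsto_const_nhds.congr' ?_
    filter_upwards [eventually_mem_iff hy] with K hK
    by_cases h : y ∈ (K₀ : Set (E n))
    · simp [Set.indicator_of_mem h, Set.indicator_of_mem (hK.mpr h)]
    · simp [Set.indicator_of_notMem h, Set.indicator_of_notMem (mt hK.mp h)]

/-- The integral of `k ⟨x, y⟩` over `y ∈ K`; for `k t = |t|` it is the support function of the
moment body and for `k t = t` the support function of the moment vector. -/
def momentFn (k : ℝ → ℝ) (K : ConvexBody (E n)) (x : E n) : ℝ :=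
  ∫ y in (K : Set (E n)), k (inner ℝ x y)

theorem integrableOn_momentFn {k : ℝ → ℝ} (hk : Continuous k) (K : ConvexBody (E n)) (x : E n) :
    IntegrableOn (fun y : E n => k (inner ℝ x y)) (K : Set (E n)) :=
  (hk.comp (continuous_const.inner continuous_id)).continuousOn.integrableOn_compact K.isCompact

theorem isCovariantFamily_momentFn {k : ℝ → ℝ} (hk : Continuous k) (hk1 : ∀ t, |k t| ≤ |t|) :
    IsCovariantFamily 1 (momentFn k : ConvexBody (E n) → E n → ℝ) where
  continuous_apply K := by
    refine continuous_parametric_integral_of_continuous (f := fun x y : E n => k (inner ℝ x y)) ?_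
      K.isCompact
    exact hk.comp (continuous_fst.inner continuous_snd)
  eventually_le K₀ ε hε := by
    filter_upwards [(tendsto_integral_abs_indicator_sub K₀).eventually (gt_mem_nhds hε)] with K hK x
    have hKi := (integrableOn_momentFn hk K x).integrable_indicator K.isClosed.measurableSet
    have hKi₀ := (integrableOn_momentFn hk K₀ x).integrable_indicator K₀.isClosed.measurableSet
    have hni : ∀ L : ConvexBody (E n), Integrable
        ((L : Set (E n)).indicator fun y : E n => ‖y‖) := fun L =>
      (continuous_norm.continuousOn.integrableOn_compact L.isCompact).integrable_indicator
        L.isClosed.measurableSet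
    rw [momentFn, momentFn, ← integral_indicator K.isClosed.measurableSet,
      ← integral_indicator K₀.isClosed.measurableSet, ← integral_sub hKi hKi₀]
    have hint : Integrable fun y : E n => ‖x‖ * (|(K : Set (E n)).indicator (fun _ => (1 : ℝ)) y -
        (K₀ : Set (E n)).indicator (fun _ => (1 : ℝ)) y| * ‖y‖) := by
      refine (((hni K).sub (hni K₀)).norm.congr (Filter.Eventually.of_forall fun y => ?_)).const_mul _
      by_cases h1 : y ∈ (K : Set (E n)) <;> by_cases h2 : y ∈ (K₀ : Set (E n)) <;> simp [h1, h2]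
    refine (abs_integral_le_integral_abs).trans ((integral_mono (hKi.sub hKi₀).abs hint
      fun y => ?_).trans ?_)
    · have hb : |k (inner ℝ x y)| ≤ ‖x‖ * ‖y‖ := (hk1 _).trans (abs_real_inner_le_norm x y)
      by_cases h1 : y ∈ (K : Set (E n)) <;> by_cases h2 : y ∈ (K₀ : Set (E n)) <;>
        simp [h1, h2, hb]
    · rw [integral_const_mul, mul_comm]
      gcongr
  union_inter K L U I hU hI x := by
    have h1 := integral_inter_add_sdiff L.isClosed.measurableSet (integrableOn_momentFn hk K x)
    have h2 := integral_inter_add_sdiff L.isClosed.measurableSet (integrableOn_momentFn hk U x)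
    have e1 : (U : Set (E n)) ∩ L = L := by
      rw [hU]
      exact Set.inter_eq_right.mpr Set.subset_union_right
    have e2 : (U : Set (E n)) \ L = (K : Set (E n)) \ L := by
      rw [hU, Set.union_sdiff_right]
    rw [e1, e2] at h2
    rw [← hI] at h1
    simp only [momentFn]
    linarith
  map_linImage φ K x x' h := by
    have hd : ∀ y ∈ (K : Set (E n)), HasFDerivWithinAt φ
        (φ.toContinuousLinearEquiv : E n →L[ℝ] E n) (K : Set (E n)) y := fun y _ =>
      φ.toContinuousLinearEquiv.hasFDerivWithinAt
    have := integral_image_eq_integral_abs_det_fderiv_smul volume K.isClosed.measurableSet hd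
      φ.injective.injOn fun y => k (inner ℝ x y)
    rw [momentFn, momentFn, Real.rpow_one, ← integral_const_mul]
    simp only [h, smul_eq_mul] at this
    exact this

/-! ### Reduction to standard simplices -/

open Filter Topology in
theorem IsCovariantFamily.continuous_left {q : ℝ} {F : ConvexBody (E n) → E n → ℝ}
    (hF : IsCovariantFamily q F) (x : E n) : Continuous fun K => F K x := by
  refine Metric.continuous_iff'.mpr fun K₀ ε hε => ?_
  filter_upwards [hF.eventually_le K₀ (ε / (‖x‖ + 1)) (by positivity)] with K hK
  refine (hK x).trans_lt ?_
  rw [div_mul_eq_mul_div, div_lt_iff₀ (by positivity)]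
  nlinarith [norm_nonneg x]

open scoped Classical in
/-- The extension of `K ↦ F K x` to all sets, with the value `0` at sets that are not
convex bodies; in particular at `∅`. -/
def setFn (F : ConvexBody (E n) → E n → ℝ) (x : E n) (A : Set (E n)) : ℝ :=
  if h : IsCompact A ∧ Convex ℝ A ∧ A.Nonempty then F ⟨A, h.2.1, h.1, h.2.2⟩ x else 0

theorem setFn_coe (F : ConvexBody (E n) → E n → ℝ) (x : E n) (K : ConvexBody (E n)) :
    setFn F x (K : Set (E n)) = F K x :=
  dif_pos ⟨K.isCompact, K.convex, K.nonempty⟩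

theorem setFn_empty (F : ConvexBody (E n) → E n → ℝ) (x : E n) : setFn F x ∅ = 0 :=
  dif_neg fun h => Set.not_nonempty_empty h.2.2

theorem IsCovariantFamily.isSetValuation {q : ℝ} {F : ConvexBody (E n) → E n → ℝ}
    (hF : IsCovariantFamily q F) (x : E n) : IsSetValuation (setFn F x) where
  empty := setFn_empty F x
  union_inter A B hA hAc hB hBc hU := by
    rcases A.eq_empty_or_nonempty with rfl | hA0
    · simp [setFn_empty]
    rcases B.eq_empty_or_nonempty with rfl | hB0
    · simp [setFn_empty]
    have hI : (A ∩ B).Nonempty := by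
      obtain ⟨y, hy⟩ := hA0
      obtain ⟨z, hz⟩ := hB0
      obtain ⟨w, -, hw⟩ := isPreconnected_closed_iff.mp hU.isPreconnected A B hA.isClosed
        hB.isClosed subset_rfl ⟨y, Or.inl hy, hy⟩ ⟨z, Or.inr hz, hz⟩
      exact ⟨w, hw⟩
    have := hF.union_inter ⟨A, hAc, hA, hA0⟩ ⟨B, hBc, hB, hB0⟩
      ⟨A ∪ B, hU, hA.union hB, hA0.mono Set.subset_union_left⟩
      ⟨A ∩ B, hAc.inter hBc, hA.inter hB, hI⟩ rfl rfl x
    simpa only [← setFn_coe F x, ConvexBody.coe_mk] using this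

theorem IsCovariantFamily.setFn_image {q : ℝ} {F : ConvexBody (E n) → E n → ℝ}
    (hF : IsCovariantFamily q F) (φ : E n ≃ₗ[ℝ] E n) {A : Set (E n)} (hA : IsCompact A)
    (hAc : Convex ℝ A) {x x' : E n} (h : ∀ y, (inner ℝ x (φ y) : ℝ) = inner ℝ x' y) :
    setFn F x (φ '' A) = |LinearMap.det (φ : E n →ₗ[ℝ] E n)| ^ q * setFn F x' A := by
  rcases A.eq_empty_or_nonempty with rfl | hA0
  · simp [setFn_empty]
  have := hF.map_linImage φ ⟨A, hAc, hA, hA0⟩ x x' h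
  rw [← setFn_coe F, ← setFn_coe F] at this
  exact this

open Filter Topology in
theorem tendsto_of_antitone {P : ℕ → ConvexBody (E n)} {K : ConvexBody (E n)}
    (hP : Antitone fun N => (P N : Set (E n))) (hK : ⋂ N, (P N : Set (E n)) = K) :
    Tendsto P atTop (𝓝 K) := by
  refine Metric.tendsto_atTop'.mpr fun ε hε => ?_
  have hε2 := half_pos hε
  obtain ⟨N, hN⟩ := exists_subset_nhds_of_isCompact (U := Metric.thickening (ε / 2) (K : Set (E n)))
    (V := fun N => (P N : Set (E n))) (hP.directed_ge) (fun N => (P N).isCompact) fun y hy =>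
      Metric.isOpen_thickening.mem_nhds (Metric.self_subset_thickening hε2 _ (hK ▸ hy))
  refine ⟨N, fun M hM => lt_of_le_of_lt ?_ (half_lt_self hε)⟩
  refine Metric.hausdorffDist_le_of_mem_dist hε2.le (fun z hz => ?_) fun z hz => ⟨z, ?_, ?_⟩
  · obtain ⟨y, hy, hzy⟩ := Metric.mem_thickening_iff.mp (hN (hP hM.le hz))
    exact ⟨y, hy, hzy.le⟩
  · rw [← hK] at hz
    exact Set.mem_iInter.mp hz M
  · simpa using hε2.le

/-- The standard basis vector `e_i`. -/
def stdVec (i : Fin n) : E n := EuclideanSpace.single i (1 : ℝ)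

theorem inner_stdVec (x : E n) (i : Fin n) : (inner ℝ x (stdVec i) : ℝ) = x i := by
  simp [stdVec, EuclideanSpace.inner_single_right]

theorem stdVec_apply (i j : Fin n) : stdVec i j = if j = i then (1 : ℝ) else 0 := by
  simp [stdVec]

/-- The convex hull of `X` and the basis vectors `e_i`, `i ∈ s`. It is used with `X = ∅` and with
`X = {0}`, so that both kinds of simplices are treated simultaneously. -/
def simplex (X : Set (E n)) (s : Finset (Fin n)) : Set (E n) :=
  convexHull ℝ (X ∪ stdVec '' s)

theorem isCompact_simplex {X : Set (E n)} (hX : X ⊆ {0}) (s : Finset (Fin n)) :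
    IsCompact (simplex X s) :=
  (((Set.finite_singleton _).subset hX).union (s.finite_toSet.image _)).isCompact_convexHull ℝ

theorem convex_simplex (X : Set (E n)) (s : Finset (Fin n)) : Convex ℝ (simplex X s) :=
  convex_convexHull ℝ _

theorem image_eq_self_of_subset_zero {X : Set (E n)} (hX : X ⊆ {0}) (φ : E n →ₗ[ℝ] E n) :
    φ '' X = X := by
  rcases Set.subset_singleton_iff_eq.mp hX with rfl | rfl <;> simp

theorem exists_linearEquiv_image_stdVec {v : Set (E n)} (hv : LinearIndepOn ℝ id v) :
    ∃ (s : Finset (Fin n)) (φ : E n ≃ₗ[ℝ] E n), φ '' (stdVec '' (s : Set (Fin n))) = v := by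
  classical
  let b := Module.Basis.extend hv
  have : Fintype (hv.extend (Set.subset_univ v)) := FiniteDimensional.fintypeBasisIndex b
  have hcard : Fintype.card (hv.extend (Set.subset_univ v)) = Fintype.card (Fin n) := by
    rw [← Module.finrank_eq_card_basis b]
    simp
  let e := Fintype.equivOfCardEq hcard
  let b' := b.reindex e
  let φ : E n ≃ₗ[ℝ] E n := (EuclideanSpace.basisFun (Fin n) ℝ).toBasis.equiv b' (Equiv.refl _)
  have hφ : ∀ i, φ (stdVec i) = (e.symm i : E n) := by
    intro i
    have h1 : stdVec i = (EuclideanSpace.basisFun (Fin n) ℝ).toBasis i := by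
      simp [stdVec]
    rw [h1, Module.Basis.equiv_apply]
    simp [b', b]
  refine ⟨Finset.univ.filter fun i => (e.symm i : E n) ∈ v, φ, ?_⟩
  ext y
  simp only [Set.mem_image, Finset.coe_filter, Finset.mem_univ, true_and, Set.mem_ofPred_eq,
    exists_exists_and_eq_and, hφ]
  constructor
  · rintro ⟨i, hi, rfl⟩
    exact hi
  · intro hy
    exact ⟨e ⟨y, hv.subset_extend _ hy⟩, by simpa using hy, by simp⟩

/-- A covariant family is determined by its values at the simplices `conv {e_i : i ∈ s}` and
`conv ({0} ∪ {e_i : i ∈ s})`. -/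
theorem IsCovariantFamily.eq_zero {q : ℝ} {F : ConvexBody (E n) → E n → ℝ}
    (hF : IsCovariantFamily q F)
    (h : ∀ X : Set (E n), X ⊆ {0} → ∀ (s : Finset (Fin n)) (x : E n), setFn F x (simplex X s) = 0)
    (K : ConvexBody (E n)) (x : E n) : F K x = 0 := by
  have hv : ∀ X : Set (E n), X ⊆ {0} → ∀ v : Set (E n), LinearIndepOn ℝ id v →
      setFn F x (convexHull ℝ (X ∪ v)) = 0 := by
    intro X hX v hv
    obtain ⟨s, φ, rfl⟩ := exists_linearEquiv_image_stdVec hv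
    have he : convexHull ℝ (X ∪ φ '' (stdVec '' (s : Set (Fin n)))) = φ '' simplex X s := by
      rw [simplex, ← LinearEquiv.coe_coe, LinearMap.image_convexHull, Set.image_union,
        image_eq_self_of_subset_zero hX]
    rw [he, hF.setFn_image φ (isCompact_simplex hX s) (convex_simplex X s)
      (x' := LinearMap.adjoint (φ : E n →ₗ[ℝ] E n) x)
      fun y => (LinearMap.adjoint_inner_left (φ : E n →ₗ[ℝ] E n) y x).symm, h X hX, mul_zero]
  rw [← setFn_coe F x K]
  refine (hF.isSetValuation x).eq_zero (fun v hv' => ?_) (hv {0} subset_rfl) ?_ K.isCompact K.convex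
  · simpa using hv ∅ (Set.empty_subset _) v hv'
  · intro P hP hc hconv hne h0
    have hPne : ∀ N, (P N).Nonempty := fun N => hne.mono (Set.iInter_subset P N)
    let P' : ℕ → ConvexBody (E n) := fun N => ⟨P N, hconv N, hc N, hPne N⟩
    let K' : ConvexBody (E n) := ⟨⋂ N, P N, convex_iInter hconv,
      (hc 0).of_isClosed_subset (isClosed_iInter fun N => (hc N).isClosed)
        (Set.iInter_subset P 0), hne⟩
    have ht : Filter.Tendsto P' Filter.atTop (nhds K') := tendsto_of_antitone hP rfl
    have hlim := ((hF.continuous_left x).tendsto K').comp ht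
    have hzero : (fun K => F K x) ∘ P' = fun _ => 0 := by
      funext N
      have := h0 N
      rwa [show P N = (P' N : Set (E n)) from rfl, setFn_coe] at this
    rw [hzero] at hlim
    rw [show (⋂ N, P N) = (K' : Set (E n)) from rfl, setFn_coe]
    exact tendsto_nhds_unique hlim tendsto_const_nhds

/-! ### Cutting an edge of a simplex -/

section Cut

variable {V : Type*} [AddCommGroup V] [Module ℝ V]

/-- Cutting a simplex at a point `c` of the edge `[a, b]`. -/
theorem convexHull_pair_union_eq {Y : Set V} {a b c : V} (hc : c ∈ segment ℝ a b) :
    convexHull ℝ (Y ∪ {a, b}) = convexHull ℝ (Y ∪ {a, c}) ∪ convexHull ℝ (Y ∪ {c, b}) := by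
  have hcm : c ∈ convexHull ℝ (Y ∪ {a, b}) := by
    rw [← convexHull_pair] at hc
    exact convexHull_mono Set.subset_union_right hc
  have hsub : ∀ y, y ∈ Y ∪ {a, b} → y ∈ convexHull ℝ (Y ∪ {a, b}) := fun y hy =>
    subset_convexHull ℝ _ hy
  refine Set.Subset.antisymm ?_ (Set.union_subset (convexHull_min ?_ (convex_convexHull ℝ _))
    (convexHull_min ?_ (convex_convexHull ℝ _)))
  · have hseg : ∀ p ∈ segment ℝ a b, p ∈ segment ℝ a c ∨ p ∈ segment ℝ c b := by
      intro p hp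
      rw [segment_eq_image'] at hc hp
      obtain ⟨t, ht, rfl⟩ := hc
      obtain ⟨u, hu, rfl⟩ := hp
      rcases le_total u t with h | h
      · left
        rw [segment_eq_image']
        rcases ht.1.eq_or_lt with h0 | h0
        · exact ⟨0, by simp, by simp [show u = 0 by linarith [hu.1]]⟩
        · refine ⟨u / t, ⟨div_nonneg hu.1 ht.1, (div_le_one h0).mpr h⟩, ?_⟩
          simp only [add_sub_cancel_left]
          rw [smul_smul, div_mul_cancel₀ _ h0.ne']
      · right
        rw [segment_symm, segment_eq_image']
        rcases ht.2.eq_or_lt with h1 | h1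
        · exact ⟨0, by simp, by simp [show u = 1 by linarith [hu.2]]⟩
        · refine ⟨(1 - u) / (1 - t), ⟨div_nonneg (by linarith [hu.2]) (by linarith),
            (div_le_one (by linarith)).mpr (by linarith)⟩, ?_⟩
          have h2 : a + t • (b - a) - b = (-(1 - t)) • (b - a) := by module
          have h3 : (1 - u) / (1 - t) * -(1 - t) = u - 1 := by
            have : 1 - t ≠ 0 := by linarith
            field_simp
            ring
          change b + ((1 - u) / (1 - t)) • (a + t • (b - a) - b) = a + u • (b - a)
          rw [h2, smul_smul, h3]
          module
    intro y hy
    have hpm : ∀ p q r : V, p ∈ segment ℝ q r → p ∈ convexHull ℝ (Y ∪ {q, r}) := by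
      intro p q r hp
      rw [← convexHull_pair] at hp
      exact convexHull_mono Set.subset_union_right hp
    have key : ∃ p ∈ segment ℝ a b, y = p ∨ ∃ z ∈ convexHull ℝ Y, y ∈ segment ℝ z p := by
      rcases Y.eq_empty_or_nonempty with rfl | hY
      · exact ⟨y, by simpa [convexHull_pair] using hy, Or.inl rfl⟩
      · rw [convexHull_union hY (Set.insert_nonempty _ _), convexHull_pair, mem_convexJoin] at hy
        obtain ⟨z, hz, p, hp, hy⟩ := hy
        exact ⟨p, hp, Or.inr ⟨z, hz, hy⟩⟩
    obtain ⟨p, hp, hyp⟩ := key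
    rcases hseg p hp with h | h
    · left
      rcases hyp with rfl | ⟨z, hz, hyz⟩
      · exact hpm _ _ _ h
      · exact (convex_convexHull ℝ _).segment_subset (convexHull_mono Set.subset_union_left hz)
          (hpm _ _ _ h) hyz
    · right
      rcases hyp with rfl | ⟨z, hz, hyz⟩
      · exact hpm _ _ _ h
      · exact (convex_convexHull ℝ _).segment_subset (convexHull_mono Set.subset_union_left hz)
          (hpm _ _ _ h) hyz
  · rintro y (hy | rfl | rfl)
    exacts [hsub y (Or.inl hy), hsub y (Or.inr (Or.inl rfl)), hcm]
  · rintro y (hy | rfl | rfl)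
    exacts [hsub y (Or.inl hy), hcm, hsub y (Or.inr (Or.inr rfl))]

/-- The two parts of a simplex cut at a point `c` of the edge `[a, b]` meet in the common facet. -/
theorem convexHull_union_inter_eq {Y : Set V} {a b c : V} {d : V →ₗ[ℝ] ℝ}
    (hY : ∀ y ∈ Y, d y = 0) (hdc : d c = 0) (ha : d a < 0) (hb : 0 < d b) :
    convexHull ℝ (Y ∪ {a, c}) ∩ convexHull ℝ (Y ∪ {c, b}) = convexHull ℝ (Y ∪ {c}) := by
  refine Set.Subset.antisymm ?_ (Set.subset_inter (convexHull_mono ?_) (convexHull_mono ?_))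
  · rintro y ⟨h1, h2⟩
    have hge : 0 ≤ d y := by
      have : convexHull ℝ (Y ∪ {c, b}) ⊆ {y | 0 ≤ d y} := by
        refine convexHull_min ?_ (convex_halfSpace_ge d.isLinear 0)
        rintro y (hy | rfl | rfl)
        exacts [(hY y hy).ge, hdc.ge, hb.le]
      exact this h2
    have he : Y ∪ {a, c} = insert a (Y ∪ {c}) := by
      ext z
      simp only [Set.mem_union, Set.mem_insert_iff, Set.mem_singleton_iff]
      tauto
    rw [he, convexHull_insert ⟨c, Or.inr rfl⟩, mem_convexJoin] at h1
    obtain ⟨a', ha', z, hz, α, β, hα, hβ, hαβ, rfl⟩ := h1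
    obtain rfl : a' = a := ha'
    have hdz : d z = 0 := by
      have : convexHull ℝ (Y ∪ {c}) ⊆ (LinearMap.ker d : Set V) := by
        refine convexHull_min ?_ (LinearMap.ker d).convex
        rintro y (hy | rfl)
        exacts [hY y hy, hdc]
      exact this hz
    have h0 : 0 ≤ α * d a' := by simpa [hdz] using hge
    have hα0 : α = 0 := by
      by_contra hne
      have := mul_neg_of_pos_of_neg (hα.lt_of_ne (Ne.symm hne)) ha
      linarith
    subst hα0
    have hβ1 : β = 1 := by linarith
    simpa [hβ1] using hz
  · exact Set.union_subset_union_right _ (by simp)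
  · exact Set.union_subset_union_right _ (by simp)

end Cut

/-- The vector `x` with the `i`-th coordinate replaced by `c`. -/
def upd (x : E n) (i : Fin n) (c : ℝ) : E n := x + (c - x i) • stdVec i

theorem upd_apply (x : E n) (i j : Fin n) (c : ℝ) : upd x i c j = if j = i then c else x j := by
  by_cases h : j = i
  · subst h; simp [upd, stdVec_apply]
  · simp [upd, stdVec_apply, h]

theorem upd_self (x : E n) (i : Fin n) : upd x i (x i) = x := by simp [upd]

theorem continuous_upd (x : E n) (i : Fin n) : Continuous (upd x i) := by
  unfold upd; fun_prop

/-- The linear automorphism that maps `e_j` to `c` and fixes the other basis vectors. -/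
theorem exists_linearEquiv_replace (j : Fin n) {c : E n} (hc : c j ≠ 0) :
    ∃ φ : E n ≃ₗ[ℝ] E n, LinearMap.det (φ : E n →ₗ[ℝ] E n) = c j ∧ φ (stdVec j) = c ∧
      (∀ i, i ≠ j → φ (stdVec i) = stdVec i) ∧
      ∀ x y : E n, (inner ℝ x (φ y) : ℝ) = inner ℝ (upd x j (inner ℝ x c)) y := by
  let f : E n →ₗ[ℝ] ℝ := (EuclideanSpace.proj j : E n →L[ℝ] ℝ)
  have hf : ∀ y : E n, f y = y j := fun y => rfl
  have h1 : 1 + f (c - stdVec j) = c j := by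
    rw [hf]
    simp [stdVec_apply]
  have hu : IsUnit (1 + f (c - stdVec j)) := by
    rw [h1]
    exact isUnit_iff_ne_zero.mpr hc
  refine ⟨LinearEquiv.dilatransvection hu, ?_, ?_, fun i hi => ?_, fun x y => ?_⟩
  · rw [LinearEquiv.dilatransvection.coe_toLinearMap, LinearMap.transvection.det, h1]
  · rw [LinearEquiv.dilatransvection.apply, hf]
    simp [stdVec_apply]
  · rw [LinearEquiv.dilatransvection.apply, hf]
    simp [stdVec_apply, hi.symm]
  · rw [LinearEquiv.dilatransvection.apply, hf, upd, inner_add_right, inner_add_left,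
      inner_smul_right, inner_smul_left, inner_sub_right, inner_stdVec,
      real_inner_comm y (stdVec j), inner_stdVec]
    simp only [conj_trivial]
    ring

namespace IsCovariantFamily

variable {q : ℝ} {F : ConvexBody (E n) → E n → ℝ}

/-- The value at a simplex whose vertex `e_j` is replaced by `c`. -/
theorem setFn_replace (hF : IsCovariantFamily q F) {X : Set (E n)} (hX : X ⊆ {0})
    {s : Finset (Fin n)} {j : Fin n} (hj : j ∈ s) {c : E n} (hc : c j ≠ 0) (x : E n) :
    setFn F x (convexHull ℝ (X ∪ insert c (stdVec '' (s.erase j : Finset (Fin n))))) =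
      |c j| ^ q * setFn F (upd x j (inner ℝ x c)) (simplex X s) := by
  obtain ⟨φ, hdet, hφj, hφi, hin⟩ := exists_linearEquiv_replace j hc
  have h : convexHull ℝ (X ∪ insert c (stdVec '' (s.erase j : Finset (Fin n)))) =
      φ '' simplex X s := by
    rw [simplex, ← LinearEquiv.coe_coe, LinearMap.image_convexHull, Set.image_union,
      image_eq_self_of_subset_zero hX, ← Finset.insert_erase hj, Finset.coe_insert,
      Set.image_insert_eq, Set.image_insert_eq, Finset.erase_insert (Finset.notMem_erase j s),
      LinearEquiv.coe_coe, hφj, Set.image_image]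
    congr 3
    refine Set.image_congr fun i hi => ?_
    exact (hφi i (Finset.ne_of_mem_erase hi)).symm
  rw [h, hF.setFn_image φ (isCompact_simplex hX s) (convex_simplex X s) (hin x), hdet]

/-- Invariance of the simplex under maps that only move basis vectors not among its vertices. -/
theorem setFn_simplex_of_notMem (hF : IsCovariantFamily q F) {X : Set (E n)} (hX : X ⊆ {0})
    {s : Finset (Fin n)} {j : Fin n} (hj : j ∉ s) {c : E n} (hc : c j ≠ 0) (x : E n) :
    setFn F x (simplex X s) = |c j| ^ q * setFn F (upd x j (inner ℝ x c)) (simplex X s) := by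
  obtain ⟨φ, hdet, hφj, hφi, hin⟩ := exists_linearEquiv_replace j hc
  have h : simplex X s = φ '' simplex X s := by
    rw [simplex, ← LinearEquiv.coe_coe, LinearMap.image_convexHull, Set.image_union,
      image_eq_self_of_subset_zero hX, LinearEquiv.coe_coe, Set.image_image]
    congr 2
    refine Set.image_congr fun i hi => ?_
    exact (hφi i fun h => hj (h ▸ hi)).symm
  conv_lhs => rw [h]
  rw [hF.setFn_image φ (isCompact_simplex hX s) (convex_simplex X s) (hin x), hdet]

/-- The functional equation obtained by cutting a simplex at the point `(1 - t) e_i + t e_j`. -/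
theorem setFn_simplex_cut (hF : IsCovariantFamily q F) {X : Set (E n)} (hX : X ⊆ {0})
    {s : Finset (Fin n)} {i j : Fin n} (hi : i ∈ s) (hj : j ∈ s) (hij : i ≠ j) {t : ℝ}
    (ht0 : 0 < t) (ht1 : t < 1) (x : E n) :
    setFn F x (simplex X s) +
        (1 - t) ^ q * setFn F (upd x i ((1 - t) * x i + t * x j)) (simplex X (s.erase j)) =
      t ^ q * setFn F (upd x j ((1 - t) * x i + t * x j)) (simplex X s) +
        (1 - t) ^ q * setFn F (upd x i ((1 - t) * x i + t * x j)) (simplex X s) := by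
  have ht1' : 0 < 1 - t := by linarith
  set c : E n := (1 - t) • stdVec i + t • stdVec j with hc
  have hci : c i = 1 - t := by simp [hc, stdVec_apply, hij]
  have hcj : c j = t := by simp [hc, stdVec_apply, hij.symm]
  have hxc : (inner ℝ x c : ℝ) = (1 - t) * x i + t * x j := by
    rw [hc, inner_add_right, inner_smul_right, inner_smul_right, inner_stdVec, inner_stdVec]
  set Y : Set (E n) := X ∪ stdVec '' ((s.erase i).erase j : Finset (Fin n)) with hY
  have hsi : s = insert i (insert j ((s.erase i).erase j)) := by
    rw [Finset.insert_erase (Finset.mem_erase.mpr ⟨hij.symm, hj⟩), Finset.insert_erase hi]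
  have h1 : simplex X s = convexHull ℝ (Y ∪ {stdVec i, stdVec j}) := by
    rw [simplex]
    conv_lhs => rw [hsi]
    rw [Finset.coe_insert, Finset.coe_insert, Set.image_insert_eq, Set.image_insert_eq, hY,
      Set.union_assoc]
    congr 2
    ext z
    simp only [Set.mem_union, Set.mem_insert_iff, Set.mem_singleton_iff]
    tauto
  have hej : s.erase j = insert i ((s.erase i).erase j) := by
    rw [Finset.erase_right_comm, Finset.insert_erase (Finset.mem_erase.mpr ⟨hij, hi⟩)]
  have hei : s.erase i = insert j ((s.erase i).erase j) := by
    rw [Finset.insert_erase (Finset.mem_erase.mpr ⟨hij.symm, hj⟩)]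
  have h2 : X ∪ insert c (stdVec '' (s.erase j : Finset (Fin n))) = Y ∪ {stdVec i, c} := by
    rw [hej, Finset.coe_insert, Set.image_insert_eq, hY, Set.union_assoc]
    congr 1
    ext z
    simp only [Set.mem_union, Set.mem_insert_iff, Set.mem_singleton_iff]
    tauto
  have h3 : X ∪ insert c (stdVec '' (s.erase i : Finset (Fin n))) = Y ∪ {c, stdVec j} := by
    rw [hei, Finset.coe_insert, Set.image_insert_eq, hY, Set.union_assoc]
    congr 1
    ext z
    simp only [Set.mem_union, Set.mem_insert_iff, Set.mem_singleton_iff]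
    tauto
  have h4 : X ∪ insert c (stdVec '' ((s.erase j).erase i : Finset (Fin n))) = Y ∪ {c} := by
    rw [Finset.erase_right_comm, hY, Set.union_assoc, Set.union_singleton]
  -- The hyperplane through `c` and the vertices other than `e_i` and `e_j`.
  let d : E n →ₗ[ℝ] ℝ := (1 - t) • (EuclideanSpace.proj j : E n →L[ℝ] ℝ) -
    t • (EuclideanSpace.proj i : E n →L[ℝ] ℝ)
  have hd : ∀ y : E n, d y = (1 - t) * y j - t * y i := fun y => rfl
  have hdY : ∀ y ∈ Y, d y = 0 := by
    rintro y (hy | ⟨k, hk, rfl⟩)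
    · rw [show y = 0 by simpa using hX hy, map_zero]
    · have hki : i ≠ k := fun h => by simp [h] at hk
      have hkj : j ≠ k := fun h => by simp [h] at hk
      rw [hd, stdVec_apply, stdVec_apply, if_neg hki, if_neg hkj]
      ring
  have hcut := convexHull_pair_union_eq (Y := Y) (a := stdVec i) (b := stdVec j) (c := c)
    ⟨1 - t, t, ht1'.le, ht0.le, by ring, rfl⟩
  have hint := convexHull_union_inter_eq (a := stdVec i) (b := stdVec j) (c := c) hdY
    (by rw [hd, hci, hcj]; ring) (by rw [hd]; simp [stdVec_apply, hij.symm, ht0])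
    (by rw [hd]; simp [stdVec_apply, hij, ht1])
  have hYfin : Y.Finite := ((Set.finite_singleton _).subset hX).union
    ((Finset.finite_toSet _).image _)
  have hval := (hF.isSetValuation x).union_inter (convexHull ℝ (Y ∪ {stdVec i, c}))
    (convexHull ℝ (Y ∪ {c, stdVec j}))
    ((hYfin.union (Set.toFinite _)).isCompact_convexHull ℝ) (convex_convexHull ℝ _)
    ((hYfin.union (Set.toFinite _)).isCompact_convexHull ℝ) (convex_convexHull ℝ _)
    (hcut ▸ convex_convexHull ℝ _)
  rw [← hcut, hint, ← h1, ← h2, ← h3, ← h4, hF.setFn_replace hX hj (by rw [hcj]; exact ht0.ne'),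
    hF.setFn_replace hX hi (by rw [hci]; exact ht1'.ne'),
    hF.setFn_replace hX (Finset.mem_erase.mpr ⟨hij, hi⟩) (by rw [hci]; exact ht1'.ne'),
    hci, hcj, abs_of_pos ht0, abs_of_pos ht1', hxc] at hval
  exact hval.symm

end IsCovariantFamily

/-! ### Uniqueness from few values -/

/-- A maximum principle: a continuous solution of the functional equation for `q = 1` that is
nonpositive on the diagonal is nonpositive. The set of maximisers in a cube is closed under
replacing one coordinate by another one, hence contains a point of the diagonal. -/
theorem nonpos_of_diagonal_nonpos {H : E n → ℝ} (hH : Continuous H)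
    (heq : ∀ (i j : Fin n), i ≠ j → ∀ t : ℝ, 0 < t → t < 1 → ∀ x : E n,
      H x = t * H (upd x j ((1 - t) * x i + t * x j)) +
        (1 - t) * H (upd x i ((1 - t) * x i + t * x j)))
    (hdiag : ∀ x : E n, (∀ i j, x i = x j) → H x ≤ 0) (x : E n) : H x ≤ 0 := by
  classical
  rcases isEmpty_or_nonempty (Fin n) with hn | ⟨⟨i₀⟩⟩
  · exact hdiag x fun i => hn.elim i
  set R : ℝ := ‖x‖
  set Q : Set (E n) := {y | ∀ i, |y i| ≤ R} with hQ
  have hQc : IsCompact Q := by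
    have h1 : IsCompact (Set.univ.pi fun _ : Fin n => Set.Icc (-R) R) :=
      isCompact_univ_pi fun _ => isCompact_Icc
    refine (h1.image (PiLp.continuous_toLp 2 _)).of_isClosed_subset ?_
      fun y hy => ⟨y.ofLp, fun i _ => abs_le.mp (hy i), rfl⟩
    simp only [hQ, Set.ofPred_forall]
    exact isClosed_iInter fun i => isClosed_le (by fun_prop) continuous_const
  have hxQ : x ∈ Q := fun i => PiLp.norm_apply_le x i
  obtain ⟨y, hyQ, hmax⟩ := hQc.exists_isMaxOn ⟨x, hxQ⟩ hH.continuousOn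
  have hupd : ∀ z ∈ Q, ∀ i c, |c| ≤ R → upd z i c ∈ Q := by
    intro z hz i c hc k
    rw [upd_apply]
    split_ifs
    exacts [hc, hz k]
  have key : ∀ s : Finset (Fin n), ∃ z ∈ Q, H z = H y ∧ ∀ k ∈ s, z k = z i₀ := by
    intro s
    induction s using Finset.induction_on with
    | empty => exact ⟨y, hyQ, rfl, by simp⟩
    | insert j s hj ih =>
      obtain ⟨z, hzQ, hz, hzs⟩ := ih
      by_cases hji : j = i₀
      · exact ⟨z, hzQ, hz, by simpa [hji] using hzs⟩
      refine ⟨upd z j (z i₀), hupd z hzQ j _ (hzQ i₀), ?_, fun k hk => ?_⟩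
      -- `H (upd z j _)` is maximal on the half-open segment, hence at its end point.
      · have hconst : ∀ t : ℝ, 0 < t → t < 1 →
            H (upd z j ((1 - t) * z i₀ + t * z j)) = H y := by
          intro t ht0 ht1
          have hc : |(1 - t) * z i₀ + t * z j| ≤ R := by
            have h1 := abs_le.mp (hzQ i₀)
            have h2 := abs_le.mp (hzQ j)
            rw [abs_le]
            constructor <;> nlinarith
          have h0 := heq i₀ j (Ne.symm hji) t ht0 ht1 z
          have h1 := hmax (hupd z hzQ j _ hc)
          have h2 := hmax (hupd z hzQ i₀ _ hc)
          simp only [Set.mem_ofPred_eq] at h1 h2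
          rw [hz] at h0
          refine le_antisymm h1 ?_
          nlinarith
        have hcont : Continuous fun t : ℝ => H (upd z j ((1 - t) * z i₀ + t * z j)) :=
          hH.comp ((continuous_upd z j).comp (by fun_prop))
        have hlim : Filter.Tendsto (fun t : ℝ => H (upd z j ((1 - t) * z i₀ + t * z j)))
            (nhdsWithin 0 (Set.Ioi 0)) (nhds (H (upd z j (z i₀)))) := by
          have := (hcont.tendsto 0).mono_left (nhdsWithin_le_nhds (s := Set.Ioi 0))
          simpa using this
        refine tendsto_nhds_unique hlim (tendsto_const_nhds.congr' ?_)
        filter_upwards [Ioo_mem_nhdsGT (zero_lt_one' ℝ)] with t ht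
        exact (hconst t ht.1 ht.2).symm
      · rw [upd_apply, upd_apply, if_neg (Ne.symm hji)]
        split_ifs with h
        · rfl
        · exact hzs k ((Finset.mem_insert.mp hk).resolve_left h)
  obtain ⟨z, -, hz, hzs⟩ := key Finset.univ
  have h1 : H z ≤ 0 := hdiag z fun i j => by rw [hzs i (by simp), hzs j (by simp)]
  have h2 : H x ≤ H y := hmax hxQ
  linarith

theorem dist_convexHull_insert_le {K L : ConvexBody (E n)} {p p' : E n} {G : Set (E n)}
    (hK : (K : Set (E n)) = convexHull ℝ (insert p G))
    (hL : (L : Set (E n)) = convexHull ℝ (insert p' G)) : dist K L ≤ ‖p - p'‖ := by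
  have key : ∀ (K L : ConvexBody (E n)) (p p' : E n),
      (K : Set (E n)) = convexHull ℝ (insert p G) → (L : Set (E n)) = convexHull ℝ (insert p' G) →
      ∀ x, supportFn K x ≤ supportFn L x + ‖p - p'‖ * ‖x‖ := by
    intro K L p p' hK hL x
    have hG : ∀ g ∈ insert p' G, g ∈ (L : Set (E n)) := fun g hg =>
      hL ▸ subset_convexHull ℝ _ hg
    have hsub : convexHull ℝ (insert p G) ⊆
        {z | inner ℝ x z ≤ supportFn L x + ‖p - p'‖ * ‖x‖} := by
      refine convexHull_min (Set.insert_subset ?_ fun g hg => ?_)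
        (convex_halfSpace_le (innerₛₗ ℝ x).isLinear _)
      · have h1 := inner_le_supportFn (hG p' (Or.inl rfl)) x
        have h2 := real_inner_le_norm x (p - p')
        rw [inner_sub_right] at h2
        simp only [Set.mem_ofPred_eq]
        linarith
      · have h1 := inner_le_supportFn (hG g (Or.inr hg)) x
        have h2 : 0 ≤ ‖p - p'‖ * ‖x‖ := by positivity
        simp only [Set.mem_ofPred_eq]
        linarith
    exact supportFn_le fun z hz => hsub (hK ▸ hz)
  refine dist_le_of_supportFn (norm_nonneg _) fun x => ?_
  rw [abs_le]
  have h1 := key K L p p' hK hL x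
  have h2 := key L K p' p hL hK x
  rw [norm_sub_rev] at h2
  constructor <;> linarith

namespace IsCovariantFamily

variable {q : ℝ} {F : ConvexBody (E n) → E n → ℝ}

theorem continuous_setFn (hF : IsCovariantFamily q F) (A : Set (E n)) :
    Continuous fun x => setFn F x A := by
  unfold setFn
  split_ifs
  exacts [hF.continuous_apply _, continuous_const]

/-- For `q ≠ 0` the family vanishes at lower-dimensional simplices spanning a subspace: the value
is invariant under shears fixing the simplex and multiplied by `t^q` under dilations. -/
theorem setFn_simplex_eq_zero (hn : 2 ≤ n) (hF : IsCovariantFamily q F) (hq : q ≠ 0)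
    {X : Set (E n)} (hX : X ⊆ {0}) {s : Finset (Fin n)} (hs : s ≠ Finset.univ) (x : E n) :
    setFn F x (simplex X s) = 0 := by
  obtain ⟨j, hj⟩ : ∃ j, j ∉ s := by
    by_contra! h
    exact hs (Finset.eq_univ_iff_forall.mpr h)
  have hzero : ∀ y : E n, y j = 0 → setFn F y (simplex X s) = 0 := by
    intro y hy
    have h := hF.setFn_simplex_of_notMem hX hj (c := (2 : ℝ) • stdVec j)
      (by simp [stdVec_apply]) y
    have h1 : ((2 : ℝ) • stdVec j : E n) j = 2 := by simp [stdVec_apply]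
    have h2 : (inner ℝ y ((2 : ℝ) • stdVec j) : ℝ) = y j := by
      rw [inner_smul_right, inner_stdVec, hy, mul_zero]
    rw [h1, h2, upd_self, abs_of_pos two_pos] at h
    have h3 : (2 : ℝ) ^ q ≠ 1 := fun h => by
      have h4 := congrArg Real.log h
      rw [Real.log_rpow two_pos, Real.log_one] at h4
      exact (mul_eq_zero.mp h4).elim hq (Real.log_pos one_lt_two).ne'
    have : (1 - (2 : ℝ) ^ q) * setFn F y (simplex X s) = 0 := by linarith
    exact (mul_eq_zero.mp this).resolve_left (sub_ne_zero.mpr h3.symm)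
  obtain ⟨i, hij⟩ : ∃ i : Fin n, i ≠ j := by
    have : Nontrivial (Fin n) := Fin.nontrivial_iff_two_le.mpr hn
    exact exists_ne j
  have hne : ∀ y : E n, y i ≠ 0 → setFn F y (simplex X s) = 0 := by
    intro y hy
    have h1 : (stdVec j + (-(y j) / y i) • stdVec i : E n) j = 1 := by
      simp [stdVec_apply, hij.symm]
    have h2 : (inner ℝ y (stdVec j + (-(y j) / y i) • stdVec i) : ℝ) = 0 := by
      rw [inner_add_right, inner_smul_right, inner_stdVec, inner_stdVec]
      field_simp
      ring
    rw [hF.setFn_simplex_of_notMem hX hj (by rw [h1]; exact one_ne_zero) y, h1, h2,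
      hzero _ (by simp [upd_apply]), mul_zero]
  by_cases hxi : x i = 0
  · have hcont := (hF.continuous_setFn (simplex X s)).comp (continuous_upd x i)
    have hlim := (hcont.tendsto 0).mono_left (nhdsWithin_le_nhds (s := Set.Ioi 0))
    have h0 : upd x i 0 = x := by rw [← hxi, upd_self]
    simp only [Function.comp_apply, h0] at hlim
    refine tendsto_nhds_unique hlim (tendsto_const_nhds.congr' ?_)
    filter_upwards [self_mem_nhdsWithin] with t ht
    exact (hne _ (by simpa [upd_apply] using ne_of_gt ht)).symm
  · exact hne x hxi

theorem setFn_simplex_cut_of_ne_zero (hn : 2 ≤ n) (hF : IsCovariantFamily q F) (hq : q ≠ 0)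
    {X : Set (E n)} (hX : X ⊆ {0}) {i j : Fin n} (hij : i ≠ j) {t : ℝ} (ht0 : 0 < t) (ht1 : t < 1)
    (x : E n) :
    setFn F x (simplex X Finset.univ) =
      t ^ q * setFn F (upd x j ((1 - t) * x i + t * x j)) (simplex X Finset.univ) +
        (1 - t) ^ q * setFn F (upd x i ((1 - t) * x i + t * x j)) (simplex X Finset.univ) := by
  have h := hF.setFn_simplex_cut hX (Finset.mem_univ i) (Finset.mem_univ j) hij ht0 ht1 x
  rw [hF.setFn_simplex_eq_zero hn hq hX (s := Finset.univ.erase j) (fun h => by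
    have := h ▸ Finset.mem_univ j
    simp at this), mul_zero, add_zero] at h
  exact h

/-- For `q ≠ 0, 1`, bisecting the simplex at the midpoint of `[e_i, e_j]` shows that the value
`c` at a vector with `x i = x j` satisfies `c = 2 (1/2)^q c`. -/
theorem setFn_simplex_eq_zero_of_apply_eq (hn : 2 ≤ n) (hF : IsCovariantFamily q F) (hq : q ≠ 0)
    (hq1 : q ≠ 1) {X : Set (E n)} (hX : X ⊆ {0}) {i j : Fin n} (hij : i ≠ j) {x : E n}
    (hx : x i = x j) : setFn F x (simplex X Finset.univ) = 0 := by
  have h := hF.setFn_simplex_cut_of_ne_zero hn hq hX hij (t := 1 / 2) (by norm_num) (by norm_num) x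
  have h1 : (1 - 1 / 2) * x i + 1 / 2 * x j = x j := by rw [hx]; ring
  rw [h1, upd_self] at h
  have h2 : upd x i (x j) = x := by rw [← hx, upd_self]
  rw [h2, show (1 - 1 / 2 : ℝ) = 1 / 2 by norm_num] at h
  have h3 : 2 * (1 / 2 : ℝ) ^ q ≠ 1 := by
    intro h
    have h4 : (1 / 2 : ℝ) ^ q = (1 / 2 : ℝ) ^ (1 : ℝ) := by
      rw [Real.rpow_one]
      linarith
    have h5 := congrArg Real.log h4
    rw [Real.log_rpow (by norm_num), Real.log_rpow (by norm_num)] at h5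
    have h6 : Real.log (1 / 2) ≠ 0 := by
      refine Real.log_ne_zero_of_pos_of_ne_one (by norm_num) (by norm_num)
    exact hq1 (mul_right_cancel₀ h6 h5)
  have : (1 - 2 * (1 / 2 : ℝ) ^ q) * setFn F x (simplex X Finset.univ) = 0 := by linarith
  exact (mul_eq_zero.mp this).resolve_left (sub_ne_zero.mpr h3.symm)

/-- A covariant family with `q = 1` is determined by its values at the two `n`-dimensional
simplices and the vectors with equal coordinates. -/
theorem eq_zero_of_diagonal {F : ConvexBody (E n) → E n → ℝ} (hn : 2 ≤ n)
    (hF : IsCovariantFamily 1 F)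
    (h : ∀ X : Set (E n), X ⊆ {0} → ∀ x : E n, (∀ i j, x i = x j) →
      setFn F x (simplex X Finset.univ) = 0) (K : ConvexBody (E n)) (x : E n) : F K x = 0 := by
  refine hF.eq_zero (fun X hX s x => ?_) K x
  by_cases hs : s = Finset.univ
  · subst hs
    have hc := hF.continuous_setFn (simplex X Finset.univ)
    have hcut : ∀ (i j : Fin n), i ≠ j → ∀ t : ℝ, 0 < t → t < 1 → ∀ x : E n, _ :=
      fun i j hij t ht0 ht1 x =>
        hF.setFn_simplex_cut_of_ne_zero hn one_ne_zero hX hij ht0 ht1 x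
    simp only [Real.rpow_one] at hcut
    refine le_antisymm (nonpos_of_diagonal_nonpos hc hcut (fun x hx => (h X hX x hx).le) x) ?_
    refine neg_nonpos.mp (nonpos_of_diagonal_nonpos (H := fun x =>
      -setFn F x (simplex X Finset.univ)) hc.neg (fun i j hij t ht0 ht1 x => ?_)
      (fun x hx => ?_) x)
    · rw [hcut i j hij t ht0 ht1 x]
      ring
    · simp [h X hX x hx]
  · exact hF.setFn_simplex_eq_zero hn one_ne_zero hX hs x

/-- For `q = 0` the value at a simplex does not depend on the coordinates not belonging to it. -/
theorem setFn_simplex_upd {F : ConvexBody (E n) → E n → ℝ} (hF : IsCovariantFamily 0 F)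
    {X : Set (E n)} (hX : X ⊆ {0}) {s : Finset (Fin n)} {j : Fin n} (hj : j ∉ s) (x : E n) (c : ℝ) :
    setFn F (upd x j c) (simplex X s) = setFn F x (simplex X s) := by
  have key : ∀ y : E n, setFn F y (simplex X s) = setFn F (upd y j 0) (simplex X s) := by
    intro y
    have hcont := (hF.continuous_setFn (simplex X s)).comp
      ((continuous_upd y j).comp (continuous_mul_const (y j)))
    have hlim := (hcont.tendsto 0).mono_left (nhdsWithin_le_nhds (s := Set.Ioi 0))
    simp only [Function.comp_apply, zero_mul] at hlim
    refine (tendsto_nhds_unique hlim (tendsto_const_nhds.congr' ?_)).symm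
    filter_upwards [self_mem_nhdsWithin] with t ht
    have h1 : (t • stdVec j : E n) j = t := by simp [stdVec_apply]
    have := hF.setFn_simplex_of_notMem hX hj (c := t • stdVec j) (by rw [h1]; exact ne_of_gt ht) y
    rwa [Real.rpow_zero, one_mul, inner_smul_right, inner_stdVec] at this
  rw [key, key x]
  congr 1
  ext k
  simp only [upd_apply]
  split_ifs <;> rfl

/-- For `q = 0`, letting the vertex `e_i` shrink to the origin. -/
theorem setFn_simplex_erase {F : ConvexBody (E n) → E n → ℝ} (hF : IsCovariantFamily 0 F)
    {X : Set (E n)} (hX : X ⊆ {0}) {s : Finset (Fin n)} {i : Fin n} (hi : i ∈ s) {x : E n}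
    (hx : x i = 0) : setFn F x (simplex X s) = setFn F x (simplex {0} (s.erase i)) := by
  set Z : Set (E n) := stdVec '' (s.erase i : Finset (Fin n)) with hZ
  have hfin : ∀ p : E n, (X ∪ insert p Z).Finite := fun p =>
    ((Set.finite_singleton _).subset hX).union (((Finset.finite_toSet _).image _).insert p)
  let B : E n → ConvexBody (E n) := fun p => ⟨convexHull ℝ (X ∪ insert p Z), convex_convexHull ℝ _,
    (hfin p).isCompact_convexHull ℝ, ⟨p, subset_convexHull ℝ _ (Or.inr (Or.inl rfl))⟩⟩
  have hB : ∀ p, (B p : Set (E n)) = convexHull ℝ (X ∪ insert p Z) := fun p => rfl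
  have hBc : Continuous B := by
    refine (LipschitzWith.of_dist_le_mul (K := 1) fun p p' => ?_).continuous
    rw [NNReal.coe_one, one_mul, dist_eq_norm]
    exact dist_convexHull_insert_le (G := X ∪ Z) (by rw [hB, Set.union_insert])
      (by rw [hB, Set.union_insert])
  have h0 : (B 0 : Set (E n)) = simplex {0} (s.erase i) := by
    rw [hB, simplex, ← hZ]
    congr 1
    ext y
    have := @hX y
    simp only [Set.mem_union, Set.mem_insert_iff, Set.mem_singleton_iff] at this ⊢
    tauto
  have hcont : Continuous fun t : ℝ => F (B (t • stdVec i)) x :=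
    (hF.continuous_left x).comp (hBc.comp (by fun_prop))
  have hlim := (hcont.tendsto 0).mono_left (nhdsWithin_le_nhds (s := Set.Ioi 0))
  rw [zero_smul, ← setFn_coe F x (B 0), h0] at hlim
  refine tendsto_nhds_unique (tendsto_const_nhds.congr' ?_) hlim
  filter_upwards [self_mem_nhdsWithin] with t ht
  have h1 : (t • stdVec i : E n) i = t := by simp [stdVec_apply]
  have := hF.setFn_replace hX hi (c := t • stdVec i) (by rw [h1]; exact ne_of_gt ht) x
  rw [Real.rpow_zero, one_mul, inner_smul_right, inner_stdVec, hx, mul_zero] at this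
  have h2 : upd x i 0 = x := by rw [← hx, upd_self]
  rw [h2] at this
  rw [← this, ← setFn_coe F x (B _), hB]

/-- A covariant family with `q = 0` is determined by its values at the simplices with at most one
vertex besides the origin. -/
theorem eq_zero_of_card_le_one {F : ConvexBody (E n) → E n → ℝ} (hF : IsCovariantFamily 0 F)
    (h : ∀ X : Set (E n), X ⊆ {0} → ∀ s : Finset (Fin n), s.card ≤ 1 → ∀ x : E n,
      setFn F x (simplex X s) = 0) (K : ConvexBody (E n)) (x : E n) : F K x = 0 := by
  suffices hk : ∀ k, ∀ X : Set (E n), X ⊆ {0} → ∀ s : Finset (Fin n), s.card ≤ k → ∀ x : E n,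
      setFn F x (simplex X s) = 0 from hF.eq_zero (fun X hX s x => hk s.card X hX s le_rfl x) K x
  intro k
  induction k with
  | zero => exact fun X hX s hs => h X hX s (hs.trans zero_le_one)
  | succ k ih =>
    intro X hX s hs x
    by_cases hs1 : s.card ≤ 1
    · exact h X hX s hs1 x
    push Not at hs1
    have herase : ∀ i ∈ s, (s.erase i).card ≤ k := fun i hi => by
      rw [Finset.card_erase_of_mem hi]
      omega
    have hzero : ∀ i ∈ s, ∀ y : E n, y i = 0 → setFn F y (simplex X s) = 0 := by
      intro i hi y hy
      rw [hF.setFn_simplex_erase hX hi hy]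
      exact ih {0} subset_rfl _ (herase i hi) y
    have hcut : ∀ i ∈ s, ∀ j ∈ s, i ≠ j → ∀ t : ℝ, 0 < t → t < 1 → ∀ y : E n,
        setFn F y (simplex X s) =
          setFn F (upd y j ((1 - t) * y i + t * y j)) (simplex X s) +
          setFn F (upd y i ((1 - t) * y i + t * y j)) (simplex X s) := by
      intro i hi j hj hij t ht0 ht1 y
      have := hF.setFn_simplex_cut hX hi hj hij ht0 ht1 y
      rwa [ih X hX _ (herase j hj), Real.rpow_zero, Real.rpow_zero, one_mul, one_mul, one_mul,
        add_zero] at this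
    have hpair : ∀ i ∈ s, ∀ j ∈ s, i ≠ j → |x i| ≤ |x j| → setFn F x (simplex X s) = 0 := by
      intro i hi j hj hij hle
      by_cases hxi : x i = 0
      · exact hzero i hi x hxi
      have hxj : x j ≠ 0 := fun h => hxi (by simpa [h] using hle)
      rcases lt_trichotomy (x i / x j) 0 with hneg | h0 | hpos
      · -- Opposite signs: cut at the point where the linear functional `x` vanishes.
        have hd : 0 < 1 - x i / x j := by linarith
        set t : ℝ := (-(x i / x j)) / (1 - x i / x j) with ht
        have ht0 : 0 < t := div_pos (by linarith) hd
        have ht1 : t < 1 := by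
          rw [ht, div_lt_one hd]
          linarith
        have hc : (1 - t) * x i + t * x j = 0 := by
          have h1 : t * (1 - x i / x j) = -(x i / x j) := div_mul_cancel₀ _ hd.ne'
          have h2 : x i = x i / x j * x j := (div_mul_cancel₀ _ hxj).symm
          rw [h2]
          linear_combination x j * h1
        rw [hcut i hi j hj hij t ht0 ht1 x, hc, hzero j hj _ (by simp [upd_apply]),
          hzero i hi _ (by simp [upd_apply]), add_zero]
      · exact absurd (div_eq_zero_iff.mp h0) (by simp [hxi, hxj])
      · rcases eq_or_ne (x i) (x j) with heq | hne
        · have := hcut i hi j hj hij (1 / 2) (by norm_num) (by norm_num) x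
          have h1 : (1 - 1 / 2) * x i + 1 / 2 * x j = x j := by rw [heq]; ring
          rw [h1, upd_self] at this
          have h2 : upd x i (x j) = x := by rw [← heq, upd_self]
          rw [h2] at this
          linarith
        · -- Equal signs: the vector with `i`-th coordinate `0` is cut at the value `x i`.
          have ht1 : x i / x j < 1 := by
            refine lt_of_le_of_ne ?_ fun h => hne ((div_eq_one_iff_eq hxj).mp h)
            rw [← abs_of_pos hpos, abs_div]
            exact div_le_one_of_le₀ hle (abs_nonneg _)
          have := hcut i hi j hj hij (x i / x j) hpos ht1 (upd x i 0)
          have h1 : upd x i 0 i = 0 := by simp [upd_apply]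
          have h2 : upd x i 0 j = x j := by simp [upd_apply, hij.symm]
          rw [h1, h2, mul_zero, zero_add, div_mul_cancel₀ _ hxj, hzero i hi _ h1,
            hzero i hi (upd (upd x i 0) j (x i)) (by simp [upd_apply, hij]), zero_add] at this
          have h3 : upd (upd x i 0) i (x i) = x := by
            ext k
            simp only [upd_apply]
            split_ifs with hk
            · rw [hk]
            · rfl
          rw [h3] at this
          exact this.symm
    obtain ⟨i, hi, j, hj, hij⟩ := Finset.one_lt_card.mp hs1
    rcases le_total |x i| |x j| with hle | hle
    · exact hpair i hi j hj hij hle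
    · exact hpair j hj i hi hij.symm hle

end IsCovariantFamily

/-! ### The two families of examples, and the degrees `q ≠ 0, 1` -/

/-- For nonnegative coefficients, the support function of
`a₁ K + a₂ (-K) + a₃ K_o + a₄ (-K_o)`. -/
def dilationFn (a₁ a₂ a₃ a₄ : ℝ) (K : ConvexBody (E n)) (x : E n) : ℝ :=
  a₁ * supportFn K x + a₂ * supportFn K (-x) + a₃ * supportFn (hullZero K) x +
    a₄ * supportFn (hullZero K) (-x)

/-- For `a₃, a₄ ≥ 0`, the support function of `a₁ m(K) + a₂ m_*(K) + a₃ M K + a₄ M_* K`. -/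
def momentCombFn (a₁ a₂ a₃ a₄ : ℝ) (K : ConvexBody (E n)) (x : E n) : ℝ :=
  a₁ * momentFn id K x + a₂ * (momentFn id (hullZero K) x - momentFn id K x) +
    a₃ * momentFn abs K x + a₄ * (momentFn abs (hullZero K) x - momentFn abs K x)

theorem isCovariantFamily_dilationFn (a₁ a₂ a₃ a₄ : ℝ) :
    IsCovariantFamily 0 (dilationFn a₁ a₂ a₃ a₄ : ConvexBody (E n) → E n → ℝ) := by
  have h := isCovariantFamily_supportFn (n := n)
  exact (((h.const_mul a₁).add (h.comp_neg.const_mul a₂)).add (h.comp_hullZero.const_mul a₃)).add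
    (h.comp_hullZero.comp_neg.const_mul a₄)

theorem isCovariantFamily_momentCombFn (a₁ a₂ a₃ a₄ : ℝ) :
    IsCovariantFamily 1 (momentCombFn a₁ a₂ a₃ a₄ : ConvexBody (E n) → E n → ℝ) := by
  have h := isCovariantFamily_momentFn (n := n) continuous_id (fun t => le_rfl)
  have h' := isCovariantFamily_momentFn (n := n) continuous_abs (fun t => (abs_abs t).le)
  exact (((h.const_mul a₁).add ((h.comp_hullZero.sub h).const_mul a₂)).add
    (h'.const_mul a₃)).add ((h'.comp_hullZero.sub h').const_mul a₄)

theorem supportFn_dilations {a₁ a₂ a₃ a₄ : ℝ} (h₁ : 0 ≤ a₁) (h₂ : 0 ≤ a₂) (h₃ : 0 ≤ a₃)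
    (h₄ : 0 ≤ a₄) (K : ConvexBody (E n)) (x : E n) :
    supportFn (a₁ • K + a₂ • ((-1 : ℝ) • K) + a₃ • hullZero K + a₄ • ((-1 : ℝ) • hullZero K)) x =
      dilationFn a₁ a₂ a₃ a₄ K x := by
  simp only [supportFn_add, supportFn_smul, neg_one_smul, ← smul_neg]
  rw [supportFn_pos_smul _ _ h₁, supportFn_pos_smul _ _ h₂, supportFn_pos_smul _ _ h₃,
    supportFn_pos_smul _ _ h₄, dilationFn]

theorem setIntegral_hullZero_sdiff {G : Type*} [NormedAddCommGroup G] [NormedSpace ℝ G]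
    (K : ConvexBody (E n)) {g : E n → G} (hg : Continuous g) :
    ∫ y in (hullZero K : Set (E n)) \ K, g y =
      (∫ y in (hullZero K : Set (E n)), g y) - ∫ y in (K : Set (E n)), g y :=
  setIntegral_sdiff K.isClosed.measurableSet
    (hg.continuousOn.integrableOn_compact (hullZero K).isCompact) (subset_hullZero K)

theorem supportFn_moments {a₁ a₂ a₃ a₄ : ℝ} (h₃ : 0 ≤ a₃) (h₄ : 0 ≤ a₄) (K : ConvexBody (E n))
    (x : E n) :
    supportFn (point (a₁ • momentVector K + a₂ • momentVectorStar K) + a₃ • momentBody K +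
      a₄ • momentBodyStar K) x = momentCombFn a₁ a₂ a₃ a₄ K x := by
  have hin : ∀ L : ConvexBody (E n), (inner ℝ x (∫ y in (L : Set (E n)), y) : ℝ) =
      momentFn id L x := fun L =>
    (integral_inner (continuous_id.continuousOn.integrableOn_compact L.isCompact) x).symm
  rw [supportFn_add, supportFn_add, supportFn_point, supportFn_smul, supportFn_smul,
    supportFn_pos_smul _ _ h₃, supportFn_pos_smul _ _ h₄, momentBody, momentBodyStar,
    supportFn_momentBodyOf K.isBounded,
    supportFn_momentBodyOf ((hullZero K).isBounded.subset Set.sdiff_subset), momentVector,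
    momentVectorStar, setIntegral_hullZero_sdiff K continuous_id',
    setIntegral_hullZero_sdiff K (by fun_prop), inner_add_right, inner_smul_right,
    inner_smul_right, inner_sub_right, hin, hin]
  rfl

/-- A support function that vanishes at all vectors with two equal coordinates is zero, provided
that there are at least three coordinates. -/
theorem supportFn_eq_zero_of_apply_eq (hn : 3 ≤ n) {K : ConvexBody (E n)}
    (h : ∀ i j : Fin n, i ≠ j → ∀ x : E n, x i = x j → supportFn K x = 0) (x : E n) :
    supportFn K x = 0 := by
  have hle : ∀ x, supportFn K x ≤ 0 := by
    intro x
    let i₀ : Fin n := ⟨0, by omega⟩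
    let i₁ : Fin n := ⟨1, by omega⟩
    let i₂ : Fin n := ⟨2, by omega⟩
    have h01 : i₀ ≠ i₁ := by simp [i₀, i₁]
    have h02 : i₀ ≠ i₂ := by simp [i₀, i₂]
    have h12 : i₁ ≠ i₂ := by simp [i₁, i₂]
    have h1 : supportFn K (upd x i₀ (x i₁)) = 0 :=
      h i₀ i₁ h01 _ (by simp [upd_apply, h01.symm])
    have h2 : supportFn K ((x i₀ - x i₁) • stdVec i₀) = 0 :=
      h i₁ i₂ h12 _ (by simp [stdVec_apply, h01.symm, h02.symm])
    have h3 : upd x i₀ (x i₁) + (x i₀ - x i₁) • stdVec i₀ = x := by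
      rw [upd]
      module
    have := supportFn_add_le K (upd x i₀ (x i₁)) ((x i₀ - x i₁) • stdVec i₀)
    rw [h3, h1, h2] at this
    linarith
  have := supportFn_add_le K x (-x)
  rw [add_neg_cancel, supportFn_zero] at this
  linarith [hle x, hle (-x)]

/-- If `q ≠ 0, 1`, then only the zero map satisfies the conditions. -/
theorem supportFn_eq_zero_of_ne (hn : 3 ≤ n) {q : ℝ} (hq : q ≠ 0) (hq1 : q ≠ 1)
    {Φ : ConvexBody (E n) → ConvexBody (E n)}
    (hF : IsCovariantFamily q fun K => supportFn (Φ K)) (K : ConvexBody (E n)) (x : E n) :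
    supportFn (Φ K) x = 0 := by
  have hn2 : 2 ≤ n := by omega
  refine hF.eq_zero (fun X hX s x => ?_) K x
  by_cases hs : s = Finset.univ
  · subst hs
    have hne : (simplex X (Finset.univ : Finset (Fin n))).Nonempty :=
      ⟨stdVec ⟨0, by omega⟩, subset_convexHull ℝ _ (Or.inr ⟨_, by simp, rfl⟩)⟩
    let T : ConvexBody (E n) := ⟨simplex X Finset.univ, convex_simplex _ _,
      isCompact_simplex hX _, hne⟩
    have hT : ∀ y, setFn (fun K => supportFn (Φ K)) y (simplex X Finset.univ) =
        supportFn (Φ T) y := fun y => setFn_coe _ y T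
    rw [hT]
    refine supportFn_eq_zero_of_apply_eq hn (fun i j hij y hy => ?_) x
    rw [← hT]
    exact hF.setFn_simplex_eq_zero_of_apply_eq hn2 hq hq1 hX hij hy
  · exact hF.setFn_simplex_eq_zero hn2 hq hX hs x

/-- The value of a support function at `t • u` in terms of its values at `±u`. -/
theorem supportFn_smul_right (K : ConvexBody (E n)) (t : ℝ) (u : E n) :
    supportFn K (t • u) = max t 0 * supportFn K u + max (-t) 0 * supportFn K (-u) := by
  rcases le_total 0 t with ht | ht
  · rw [supportFn_pos_smul K u ht, max_eq_left ht, max_eq_right (by linarith)]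
    ring
  · rw [max_eq_right ht, max_eq_left (by linarith), ← supportFn_pos_smul K (-u) (by linarith),
      neg_smul_neg]
    ring

/-! ### The degree `q = 1` -/

theorem coe_hullZero_of_eq_simplex {K : ConvexBody (E n)} {X : Set (E n)} (hX : X ⊆ {0})
    {s : Finset (Fin n)} (hK : (K : Set (E n)) = simplex X s) :
    (hullZero K : Set (E n)) = simplex {0} s := by
  change convexHull ℝ (insert 0 (K : Set (E n))) = _
  rw [hK, simplex, simplex, Set.insert_eq, convexHull_convexHull_union_right]
  congr 1
  ext y
  have := @hX y
  simp only [Set.mem_union, Set.mem_singleton_iff] at this ⊢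
  tauto

/-- The simplex `conv {e_i : i ∈ s}` as a convex body. -/
def stdSimplexBody (s : Finset (Fin n)) (hs : s.Nonempty) : ConvexBody (E n) where
  carrier := simplex ∅ s
  convex' := convex_simplex _ _
  isCompact' := isCompact_simplex (Set.empty_subset _) s
  nonempty' := by
    obtain ⟨i, hi⟩ := hs
    exact ⟨stdVec i, subset_convexHull ℝ _ (Or.inr ⟨i, hi, rfl⟩)⟩

theorem coe_hullZero_stdSimplexBody (s : Finset (Fin n)) (hs : s.Nonempty) :
    (hullZero (stdSimplexBody s hs) : Set (E n)) = simplex {0} s :=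
  coe_hullZero_of_eq_simplex (Set.empty_subset _) rfl

theorem hullZero_hullZero (K : ConvexBody (E n)) : hullZero (hullZero K) = hullZero K := by
  refine ext_supportFn fun x => ?_
  rw [supportFn_hullZero, supportFn_hullZero, max_eq_right (le_max_left _ _)]

theorem supportFn_stdSimplexBody {s : Finset (Fin n)} (hs : s.Nonempty) {x : E n} {i : Fin n}
    (hi : i ∈ s) (hmax : ∀ j ∈ s, x j ≤ x i) : supportFn (stdSimplexBody s hs) x = x i := by
  apply le_antisymm
  · have hsub : simplex (∅ : Set (E n)) s ⊆ {z | inner ℝ x z ≤ x i} := by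
      refine convexHull_min ?_ (convex_halfSpace_le (innerₛₗ ℝ x).isLinear _)
      rintro _ (hy | ⟨j, hj, rfl⟩)
      · exact absurd hy (Set.notMem_empty _)
      · change inner ℝ x (stdVec j) ≤ x i
        rw [inner_stdVec]
        exact hmax j hj
    exact supportFn_le fun z hz => hsub hz
  · rw [← inner_stdVec]
    exact inner_le_supportFn (show stdVec i ∈ (stdSimplexBody s hs : Set (E n)) from
      subset_convexHull ℝ _ (Or.inr ⟨i, hi, rfl⟩)) x

/-- The vector `(1, …, 1)`. -/
def onesVec : E n := ∑ i, stdVec i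

theorem onesVec_apply (j : Fin n) : (onesVec : E n) j = 1 := by
  simp [onesVec, stdVec_apply]

theorem inner_onesVec (y : E n) : (inner ℝ onesVec y : ℝ) = ∑ i, y i := by
  rw [real_inner_comm, onesVec, inner_sum]
  simp only [inner_stdVec]

theorem eq_smul_onesVec {x : E n} (i₀ : Fin n) (hx : ∀ i j, x i = x j) : x = x i₀ • onesVec := by
  ext j
  simp [onesVec_apply, hx j i₀]

theorem inner_onesVec_nonneg {y : E n} (hy : y ∈ simplex {0} (Finset.univ : Finset (Fin n))) :
    0 ≤ (inner ℝ onesVec y : ℝ) := by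
  have hsub : simplex {0} (Finset.univ : Finset (Fin n)) ⊆ {z : E n | 0 ≤ inner ℝ onesVec z} := by
    refine convexHull_min ?_ (convex_halfSpace_ge (innerₛₗ ℝ (onesVec : E n)).isLinear _)
    rintro _ (rfl | ⟨j, hj, rfl⟩)
    · simp
    · change 0 ≤ inner ℝ onesVec (stdVec j)
      rw [inner_stdVec, onesVec_apply]
      exact zero_le_one
  exact hsub hy

theorem volume_simplex_empty_univ (hn : 0 < n) :
    volume (simplex ∅ (Finset.univ : Finset (Fin n))) = 0 := by
  let f : E n →ₗ[ℝ] ℝ := innerₛₗ ℝ (onesVec : E n)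
  have hf : ∀ i, f (stdVec i) = 1 := fun i => by
    change inner ℝ onesVec (stdVec i) = 1
    rw [inner_stdVec, onesVec_apply]
  let p : E n := stdVec ⟨0, hn⟩
  let A : AffineSubspace ℝ (E n) := AffineSubspace.mk' p (LinearMap.ker f)
  have hA : A ≠ ⊤ := by
    intro h
    have h0 : (0 : E n) ∈ A := h ▸ AffineSubspace.mem_top ℝ (E n) 0
    rw [AffineSubspace.mem_mk'] at h0
    have : f p = 0 := by simpa using h0
    rw [hf] at this
    exact one_ne_zero this
  refine measure_mono_null ?_ (Measure.addHaar_affineSubspace volume A hA)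
  refine convexHull_min ?_ A.convex
  rintro _ (hy | ⟨j, hj, rfl⟩)
  · exact absurd hy (Set.notMem_empty _)
  · change stdVec j ∈ A
    rw [AffineSubspace.mem_mk', LinearMap.mem_ker, vsub_eq_sub, map_sub, hf, hf, sub_self]

theorem mem_simplex_of_pos (hn : 0 < n) {y : E n} (hy : ∀ i, 0 < y i) (hsum : ∑ i, y i ≤ 1) :
    y ∈ simplex {0} (Finset.univ : Finset (Fin n)) := by
  have hpos : 0 < ∑ i, y i := Finset.sum_pos (fun i _ => hy i) ⟨⟨0, hn⟩, Finset.mem_univ _⟩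
  have h1 : ∑ i, (y i / ∑ k, y k) • stdVec i ∈
      convexHull ℝ (stdVec '' ((Finset.univ : Finset (Fin n)) : Set (Fin n))) :=
    (convex_convexHull ℝ _).sum_mem (fun i _ => div_nonneg (hy i).le hpos.le)
      (by rw [← Finset.sum_div, div_self hpos.ne'])
      fun i hi => subset_convexHull ℝ _ ⟨i, hi, rfl⟩
  have h2 := smul_mem_convexHull_zero_union h1 hpos.le hsum
  rw [convexHull_convexHull_union_right] at h2
  have h3 : y = (∑ i, y i) • ∑ i, (y i / ∑ k, y k) • stdVec i := by
    ext j
    simp [stdVec_apply, mul_div_cancel₀ _ hpos.ne']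
  rw [h3]
  exact h2

theorem integral_simplex_pos (hn : 0 < n) :
    0 < ∫ y in simplex {0} (Finset.univ : Finset (Fin n)), (inner ℝ onesVec y : ℝ) := by
  have hc := isCompact_simplex (n := n) (X := {0}) subset_rfl Finset.univ
  have hcont : Continuous fun y : E n => (inner ℝ onesVec y : ℝ) := by fun_prop
  rw [setIntegral_pos_iff_support_of_nonneg_ae ?_ (hcont.continuousOn.integrableOn_compact hc)]
  · set O : Set (E n) := {y | (∀ i, 0 < y i) ∧ ∑ i, y i < 1} with hO
    have hopen : IsOpen O := by
      have h1 : IsOpen {y : E n | ∀ i, 0 < y i} := by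
        simp only [Set.ofPred_forall]
        refine isOpen_iInter_of_finite fun i => ?_
        have hi : Continuous fun y : E n => y i := by fun_prop
        exact isOpen_lt continuous_const hi
      have h2 : Continuous fun y : E n => ∑ i, y i := by fun_prop
      exact h1.inter (isOpen_lt h2 continuous_const)
    have hne : O.Nonempty := by
      refine ⟨((n : ℝ) + 1)⁻¹ • onesVec, fun i => ?_, ?_⟩
      · simp only [PiLp.smul_apply, onesVec_apply, smul_eq_mul, mul_one]
        positivity
      · simp only [PiLp.smul_apply, onesVec_apply, smul_eq_mul, mul_one, Finset.sum_const,
          Finset.card_univ, Fintype.card_fin, nsmul_eq_mul]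
        rw [← div_eq_mul_inv, div_lt_one (by positivity)]
        linarith
    refine (hopen.measure_pos volume hne).trans_le (measure_mono fun y hy => ⟨?_, ?_⟩)
    · rw [Function.mem_support, inner_onesVec]
      exact (Finset.sum_pos (fun i _ => hy.1 i) ⟨⟨0, hn⟩, Finset.mem_univ _⟩).ne'
    · exact mem_simplex_of_pos hn hy.1 hy.2.le
  · exact (ae_restrict_iff' hc.isClosed.measurableSet).mpr
      (Filter.Eventually.of_forall fun y hy => inner_onesVec_nonneg hy)

/-- The case `q = 1`: the coefficients are read off from the values at `±(1, …, 1)` for the two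
`n`-dimensional simplices. -/
theorem exists_eq_momentCombFn (hn : 2 ≤ n) {Φ : ConvexBody (E n) → ConvexBody (E n)}
    (hF : IsCovariantFamily 1 fun K => supportFn (Φ K)) :
    ∃ a₁ a₂ a₃ a₄ : ℝ, 0 ≤ a₃ ∧ 0 ≤ a₄ ∧
      ∀ K x, supportFn (Φ K) x = momentCombFn a₁ a₂ a₃ a₄ K x := by
  have hn0 : 0 < n := by omega
  let S : ConvexBody (E n) := stdSimplexBody Finset.univ ⟨⟨0, hn0⟩, Finset.mem_univ _⟩
  let T : ConvexBody (E n) := hullZero S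
  have hT : (T : Set (E n)) = simplex {0} Finset.univ := coe_hullZero_stdSimplexBody _ _
  have hTT : hullZero T = T := hullZero_hullZero S
  set μ : ℝ := ∫ y in (T : Set (E n)), (inner ℝ onesVec y : ℝ) with hμdef
  have hμ : 0 < μ := by
    rw [hμdef, hT]
    exact integral_simplex_pos hn0
  have hidT : ∀ t : ℝ, momentFn id T (t • onesVec) = t * μ := by
    intro t
    simp only [momentFn, id, inner_smul_left, conj_trivial]
    rw [integral_const_mul]
  have habsT : ∀ t : ℝ, momentFn abs T (t • onesVec) = |t| * μ := by
    intro t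
    simp only [momentFn, inner_smul_left, conj_trivial, abs_mul]
    rw [integral_const_mul, hμdef]
    congr 1
    refine setIntegral_congr_fun T.isClosed.measurableSet fun y hy => ?_
    exact abs_of_nonneg (inner_onesVec_nonneg (hT ▸ hy))
  have hSzero : ∀ (k : ℝ → ℝ) (x : E n), momentFn k S x = 0 := fun k x =>
    setIntegral_measure_zero _ (volume_simplex_empty_univ hn0)
  -- On multiples of `(1, …, 1)`, the moment integrals vanish for `S` and are multiples of `t` and
  -- `|t|` for `T`, which determines the coefficients.
  set A := supportFn (Φ T) onesVec
  set B := supportFn (Φ T) (-onesVec)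
  set C := supportFn (Φ S) onesVec
  set D := supportFn (Φ S) (-onesVec)
  have hnonneg : ∀ K : ConvexBody (E n), 0 ≤ supportFn K onesVec + supportFn K (-onesVec) := by
    intro K
    have := supportFn_add_le K onesVec (-onesVec)
    rwa [add_neg_cancel, supportFn_zero] at this
  refine ⟨(A - B) / (2 * μ), (C - D) / (2 * μ), (A + B) / (2 * μ), (C + D) / (2 * μ),
    div_nonneg (hnonneg _) (by positivity), div_nonneg (hnonneg _) (by positivity),
    fun K x => ?_⟩
  refine sub_eq_zero.mp ((hF.sub (isCovariantFamily_momentCombFn (n := n) ((A - B) / (2 * μ))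
    ((C - D) / (2 * μ)) ((A + B) / (2 * μ)) ((C + D) / (2 * μ)))).eq_zero_of_diagonal hn ?_ K x)
  intro X hX y hy
  rw [eq_smul_onesVec ⟨0, hn0⟩ hy]
  set t := y ⟨0, hn0⟩
  rcases Set.subset_singleton_iff_eq.mp hX with rfl | rfl
  · rw [show simplex ∅ Finset.univ = (S : Set (E n)) from rfl, setFn_coe, momentCombFn,
      show hullZero S = T from rfl, hSzero, hSzero, hidT, habsT, supportFn_smul_right]
    rcases le_total 0 t with ht | ht
    · rw [max_eq_left ht, max_eq_right (by linarith), abs_of_nonneg ht]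
      field_simp
      ring
    · rw [max_eq_right ht, max_eq_left (by linarith), abs_of_nonpos ht]
      field_simp
      ring
  · rw [← hT, setFn_coe, momentCombFn, hTT, hidT, habsT, supportFn_smul_right]
    rcases le_total 0 t with ht | ht
    · rw [max_eq_left ht, max_eq_right (by linarith), abs_of_nonneg ht]
      field_simp
      ring
    · rw [max_eq_right ht, max_eq_left (by linarith), abs_of_nonpos ht]
      field_simp
      ring

/-! ### The degree `q = 0` -/

/-- For `q = 0`, the value at the simplex with vertices `e_i`, `i ∈ s`, depends only on the
coordinates with index in `s`. -/
theorem IsCovariantFamily.setFn_simplex_congr {F : ConvexBody (E n) → E n → ℝ}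
    (hF : IsCovariantFamily 0 F) {X : Set (E n)} (hX : X ⊆ {0}) {s : Finset (Fin n)} {x x' : E n}
    (hx : ∀ i ∈ s, x i = x' i) : setFn F x (simplex X s) = setFn F x' (simplex X s) := by
  classical
  have key : ∀ T : Finset (Fin n), (∀ j ∈ T, j ∉ s) →
      setFn F (x + ∑ j ∈ T, (x' j - x j) • stdVec j) (simplex X s) =
        setFn F x (simplex X s) := by
    intro T
    induction T using Finset.induction_on with
    | empty => simp
    | insert j T hj ih =>
      intro h
      rw [← ih fun i hi => h i (Finset.mem_insert_of_mem hi),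
        ← hF.setFn_simplex_upd hX (h j (Finset.mem_insert_self j T))
          (x + ∑ i ∈ T, (x' i - x i) • stdVec i) (x' j)]
      congr 1
      rw [upd, Finset.sum_insert hj, show (x + ∑ i ∈ T, (x' i - x i) • stdVec i) j = x j by
        simp [stdVec_apply, hj]]
      abel
  rw [← key (Finset.univ \ s) fun j hj => (Finset.mem_sdiff.mp hj).2]
  congr 1
  ext i
  by_cases hi : i ∈ s <;> simp [stdVec_apply, hi, hx]

/-- For `q = 0`, all vertices play the same role: the segments `[0, e_i]`, and likewise the points
`e_i`, have a common linear image. -/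
theorem IsCovariantFamily.setFn_simplex_singleton {F : ConvexBody (E n) → E n → ℝ}
    (hF : IsCovariantFamily 0 F) {X : Set (E n)} (hX : X ⊆ {0}) (i j : Fin n) (x : E n) :
    setFn F x (simplex X {i}) = setFn F (x i • stdVec j) (simplex X {j}) := by
  rcases eq_or_ne i j with rfl | hij
  · refine hF.setFn_simplex_congr hX fun k hk => ?_
    rw [Finset.mem_singleton.mp hk]
    simp [stdVec_apply]
  · -- The vertex `e_i`, as well as the vertex `e_j`, can be moved to `e_i + e_j`.
    set c : E n := stdVec i + stdVec j with hc
    set y : E n := x i • stdVec i with hy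
    have hyc : (inner ℝ y c : ℝ) = x i := by
      rw [hc, inner_add_right, inner_stdVec, inner_stdVec]
      simp [hy, stdVec_apply, hij.symm]
    have h1 := hF.setFn_replace hX (Finset.mem_singleton_self i) (c := c)
      (by simp [hc, stdVec_apply, hij]) y
    have h2 := hF.setFn_replace hX (Finset.mem_singleton_self j) (c := c)
      (by simp [hc, stdVec_apply, hij.symm]) y
    simp only [Finset.erase_singleton, hyc, Real.rpow_zero, one_mul] at h1 h2
    calc setFn F x (simplex X {i}) = setFn F (upd y i (x i)) (simplex X {i}) :=
          hF.setFn_simplex_congr hX fun k hk => by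
            rw [Finset.mem_singleton.mp hk, upd_apply, if_pos rfl]
      _ = setFn F (upd y j (x i)) (simplex X {j}) := h1.symm.trans h2
      _ = setFn F (x i • stdVec j) (simplex X {j}) :=
          hF.setFn_simplex_congr hX fun k hk => by
            rw [Finset.mem_singleton.mp hk, upd_apply, if_pos rfl]
            simp [stdVec_apply]

/-- The case `q = 0`, up to the signs of the coefficients: they are read off from the values at
`±e` for the point `e` and for the segment `[0, e]`, where `e` is a basis vector. -/
theorem exists_eq_dilationFn (hn : 0 < n) {Φ : ConvexBody (E n) → ConvexBody (E n)}
    (hF : IsCovariantFamily 0 fun K => supportFn (Φ K)) :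
    ∃ a₁ a₂ a₃ a₄ : ℝ, ∀ K x, supportFn (Φ K) x = dilationFn a₁ a₂ a₃ a₄ K x := by
  let i₀ : Fin n := ⟨0, hn⟩
  let S : ConvexBody (E n) := stdSimplexBody {i₀} (Finset.singleton_nonempty _)
  let T : ConvexBody (E n) := hullZero S
  have hT : (T : Set (E n)) = simplex {0} {i₀} := coe_hullZero_stdSimplexBody _ _
  have hTT : hullZero T = T := hullZero_hullZero S
  have hS : ∀ x, supportFn S x = x i₀ := fun x =>
    supportFn_stdSimplexBody _ (Finset.mem_singleton_self _) fun j hj => by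
      rw [Finset.mem_singleton.mp hj]
  have hTx : ∀ x, supportFn T x = max 0 (x i₀) := fun x => by
    rw [supportFn_hullZero, hS]
  set A := supportFn (Φ T) (stdVec i₀)
  set B := supportFn (Φ T) (-stdVec i₀)
  set C := supportFn (Φ S) (stdVec i₀)
  set D := supportFn (Φ S) (-stdVec i₀)
  refine ⟨B - D, A - C, A - B + D, B - A + C, fun K x => ?_⟩
  have hG := hF.sub (isCovariantFamily_dilationFn (n := n) (B - D) (A - C) (A - B + D) (B - A + C))
  refine sub_eq_zero.mp (hG.eq_zero_of_card_le_one ?_ K x)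
  intro X hX s hs y
  rcases Nat.le_one_iff_eq_zero_or_eq_one.mp hs with h | h
  · rw [Finset.card_eq_zero] at h
    subst h
    rcases Set.subset_singleton_iff_eq.mp hX with rfl | rfl
    · simp [simplex, setFn_empty]
    · rw [hG.setFn_simplex_congr hX (x' := 0) (by simp),
        show simplex {0} ∅ = (point (0 : E n) : Set (E n)) by simp [simplex, point], setFn_coe]
      simp [dilationFn, supportFn_zero]
  · obtain ⟨i, rfl⟩ := Finset.card_eq_one.mp h
    rw [hG.setFn_simplex_singleton hX i i₀]
    set t := y i
    have ht : (t • stdVec i₀ : E n) i₀ = t := by simp [stdVec_apply]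
    have ht' : (-(t • stdVec i₀) : E n) i₀ = -t := by simp [stdVec_apply]
    rcases Set.subset_singleton_iff_eq.mp hX with rfl | rfl
    · rw [show simplex ∅ {i₀} = (S : Set (E n)) from rfl, setFn_coe, dilationFn,
        show hullZero S = T from rfl, hS, hS, hTx, hTx, supportFn_smul_right, ht, ht']
      rcases le_total 0 t with h0 | h0
      · rw [max_eq_left h0, max_eq_right (by linarith), max_eq_right h0,
          max_eq_left (by linarith)]
        ring
      · rw [max_eq_right h0, max_eq_left (by linarith), max_eq_left h0,
          max_eq_right (by linarith)]
        ring
    · rw [← hT, setFn_coe, dilationFn, hTT, hTx, hTx, supportFn_smul_right, ht, ht']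
      rcases le_total 0 t with h0 | h0
      · rw [max_eq_left h0, max_eq_right (by linarith), max_eq_right h0,
          max_eq_left (by linarith)]
        ring
      · rw [max_eq_right h0, max_eq_left (by linarith), max_eq_left h0,
          max_eq_right (by linarith)]
        ring

/-- If `dilationFn` with given coefficients yields support functions, then the coefficients are
nonnegative: this is subadditivity at suitable vectors for a segment and a triangle. -/
theorem nonneg_of_supportFn_eq_dilationFn (hn : 3 ≤ n) {Φ : ConvexBody (E n) → ConvexBody (E n)}
    {a₁ a₂ a₃ a₄ : ℝ} (h : ∀ K x, supportFn (Φ K) x = dilationFn a₁ a₂ a₃ a₄ K x) :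
    0 ≤ a₁ ∧ 0 ≤ a₂ ∧ 0 ≤ a₃ ∧ 0 ≤ a₄ := by
  let i₀ : Fin n := ⟨0, by omega⟩
  let i₁ : Fin n := ⟨1, by omega⟩
  let i₂ : Fin n := ⟨2, by omega⟩
  have h01 : i₀ ≠ i₁ := by simp [i₀, i₁]
  have h02 : i₀ ≠ i₂ := by simp [i₀, i₂]
  have h12 : i₁ ≠ i₂ := by simp [i₁, i₂]
  let v : ℝ → ℝ → ℝ → E n := fun a b c => a • stdVec i₀ + b • stdVec i₁ + c • stdVec i₂
  have hv0 : ∀ a b c, v a b c i₀ = a := fun a b c => by simp [v, stdVec_apply, h01, h02]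
  have hv1 : ∀ a b c, v a b c i₁ = b := fun a b c => by simp [v, stdVec_apply, h01.symm, h12]
  have hv2 : ∀ a b c, v a b c i₂ = c := fun a b c => by simp [v, stdVec_apply, h02.symm, h12.symm]
  have hneg : ∀ a b c, -v a b c = v (-a) (-b) (-c) := fun a b c => by
    simp only [v]
    module
  have hadd : ∀ a b c a' b' c', v a b c + v a' b' c' = v (a + a') (b + b') (c + c') :=
    fun a b c a' b' c' => by
      simp only [v]
      module
  let S : ConvexBody (E n) := stdSimplexBody {i₀, i₁} (Finset.insert_nonempty _ _)
  let S' : ConvexBody (E n) := stdSimplexBody {i₀, i₁, i₂} (Finset.insert_nonempty _ _)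
  have hS : ∀ a b c, supportFn S (v a b c) = max a b := by
    intro a b c
    rcases le_total a b with hab | hab
    · rw [max_eq_right hab, supportFn_stdSimplexBody _ (i := i₁) (by simp) (by simp [hv0, hv1, hab]),
        hv1]
    · rw [max_eq_left hab, supportFn_stdSimplexBody _ (i := i₀) (by simp) (by simp [hv0, hv1, hab]),
        hv0]
  have hS' : ∀ a b c, supportFn S' (v a b c) = max (max a b) c := by
    intro a b c
    rcases le_total (max a b) c with hc | hc
    · rw [max_eq_right hc, supportFn_stdSimplexBody _ (i := i₂) (by simp)
        (by simpa [hv0, hv1, hv2] using hc), hv2]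
    · rw [max_eq_left hc]
      rcases le_total a b with hab | hab
      · rw [max_eq_right hab] at hc ⊢
        rw [supportFn_stdSimplexBody _ (i := i₁) (by simp) (by simp [hv0, hv1, hv2, hab, hc]), hv1]
      · rw [max_eq_left hab] at hc ⊢
        rw [supportFn_stdSimplexBody _ (i := i₀) (by simp) (by simp [hv0, hv1, hv2, hab, hc]), hv0]
  have key : ∀ K : ConvexBody (E n), ∀ a b c a' b' c',
      dilationFn a₁ a₂ a₃ a₄ K (v (a + a') (b + b') (c + c')) ≤
        dilationFn a₁ a₂ a₃ a₄ K (v a b c) + dilationFn a₁ a₂ a₃ a₄ K (v a' b' c') := by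
    intro K a b c a' b' c'
    rw [← h, ← h, ← h, ← hadd]
    exact supportFn_add_le _ _ _
  have k₁ := key S' (-1) (-2) (-4) (-2) (-1) (-4)
  have k₂ := key S' 1 2 4 2 1 4
  have k₃ := key S 1 (-2) 0 (-1) (-2) 0
  have k₄ := key S 1 2 0 (-1) 2 0
  simp only [dilationFn, hneg, supportFn_hullZero, hS, hS'] at k₁ k₂ k₃ k₄
  norm_num at k₁ k₂ k₃ k₄
  refine ⟨?_, ?_, ?_, ?_⟩ <;> linarith

end MinkowskiValuation

end

theorem theorem2 (n : ℕ) (hn : 3 ≤ n)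
    (Φ : ConvexBody (MinkowskiValuation.E n) → ConvexBody (MinkowskiValuation.E n)) :
    (Continuous Φ ∧ MinkowskiValuation.IsGLEquivariant Φ ∧
        MinkowskiValuation.IsMinkowskiValuation Φ) ↔
      ((∃ a₁ a₂ a₃ a₄ : ℝ, 0 ≤ a₁ ∧ 0 ≤ a₂ ∧ 0 ≤ a₃ ∧ 0 ≤ a₄ ∧
          ∀ K : ConvexBody (MinkowskiValuation.E n), Φ K = a₁ • K + a₂ • ((-1 : ℝ) • K) + a₃ • MinkowskiValuation.hullZero K +
            a₄ • ((-1 : ℝ) • MinkowskiValuation.hullZero K)) ∨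
        (∃ a₁ a₂ a₃ a₄ : ℝ, 0 ≤ a₃ ∧ 0 ≤ a₄ ∧
          ∀ K : ConvexBody (MinkowskiValuation.E n), Φ K =
            MinkowskiValuation.point (a₁ • MinkowskiValuation.momentVector K +
              a₂ • MinkowskiValuation.momentVectorStar K) +
            a₃ • MinkowskiValuation.momentBody K +
            a₄ • MinkowskiValuation.momentBodyStar K)) := by
  open MinkowskiValuation in
  constructor
  · rintro ⟨hc, ⟨q, hq⟩, hval⟩
    have hF : IsCovariantFamily q fun K => supportFn (Φ K) :=
      isCovariantFamily_supportFn_iff.mpr ⟨hc, hq, hval⟩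
    by_cases hq0 : q = 0
    · subst hq0
      obtain ⟨a₁, a₂, a₃, a₄, h⟩ := exists_eq_dilationFn (by omega) hF
      obtain ⟨h₁, h₂, h₃, h₄⟩ := nonneg_of_supportFn_eq_dilationFn hn h
      exact Or.inl ⟨a₁, a₂, a₃, a₄, h₁, h₂, h₃, h₄, fun K => ext_supportFn fun x => by
        rw [h, supportFn_dilations h₁ h₂ h₃ h₄]⟩
    by_cases hq1 : q = 1
    · subst hq1
      obtain ⟨a₁, a₂, a₃, a₄, h₃, h₄, h⟩ := exists_eq_momentCombFn (by omega) hF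
      exact Or.inr ⟨a₁, a₂, a₃, a₄, h₃, h₄, fun K => ext_supportFn fun x => by
        rw [h, supportFn_moments h₃ h₄]⟩
    · exact Or.inl ⟨0, 0, 0, 0, le_rfl, le_rfl, le_rfl, le_rfl, fun K => ext_supportFn fun x => by
        rw [supportFn_eq_zero_of_ne hn hq0 hq1 hF, supportFn_dilations le_rfl le_rfl le_rfl le_rfl]
        simp [dilationFn]⟩
  · rintro (⟨a₁, a₂, a₃, a₄, h₁, h₂, h₃, h₄, h⟩ | ⟨a₁, a₂, a₃, a₄, h₃, h₄, h⟩)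
    · have hF : (fun K => supportFn (Φ K)) = dilationFn a₁ a₂ a₃ a₄ := by
        funext K x
        rw [h, supportFn_dilations h₁ h₂ h₃ h₄]
      obtain ⟨hc, hq, hval⟩ := isCovariantFamily_supportFn_iff.mp
        (hF ▸ isCovariantFamily_dilationFn a₁ a₂ a₃ a₄)
      exact ⟨hc, ⟨0, hq⟩, hval⟩
    · have hF : (fun K => supportFn (Φ K)) = momentCombFn a₁ a₂ a₃ a₄ := by
        funext K x
        rw [h, supportFn_moments h₃ h₄]
      obtain ⟨hc, hq, hval⟩ := isCovariantFamily_supportFn_iff.mp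
        (hF ▸ isCovariantFamily_momentCombFn a₁ a₂ a₃ a₄)
      exact ⟨hc, ⟨1, hq⟩, hval⟩
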